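/- **Model.** In the external memory model a machine has a main memory of $M$ cells, an unbounded disk divided into blocks of $B$ cells ($B\ge 1$, $M\ge 2B$), and a constant number of integer registers. One I/O transfers one block between memory and disk; internal computation is free, and what the machine does next depends only on its registers and its main memory. A cell holds an integer word or a colour; colours are indivisible records that can be copied and moved but not manufactured (a palette of $V$ colours is given on disk). An *algorithm* consists of one machine for each $(M,B)$, with the same number of registers for all $(M,B)$. In the upper bounds, all integers and block numbers that occur are at most polynomial in $V$, $M$ and the largest endpoint, that is, words have $O(\log(V+M+\text{largest endpoint}))$ bits. **Input.** A set of $V\ge 1$ intervals with $2V$ pairwise distinct natural numbers as endpoints is given by the sorted array $l_1<\dots<l_V$ of left endpoints and the sorted array $r_1<\dots<r_V$ of right endpoints and, for the colouring problem, by storing for each left endpoint the rank, among the right endpoints, of the right endpoint of the same interval. $G$ is the graph whose vertices are the intervals, two of them being adjacent iff they intersect; $\chi$ is its chromatic number. Write $\mathrm{scan}(V)=\lceil V/B\rceil$ and $$L(V,\chi)=\Big\lceil \frac VB\Big\rceil\cdot\max\Big\{1,\log_{M/B}\frac{\chi}{B}\Big\}.$$ **Theorem.** 1. (Upper bound.)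 There are an algorithm and an absolute constant $C$ such that, for all $M,B,V$ and every such input, the algorithm writes to disk a proper colouring of $G$ with exactly $\chi$ colours, using at most $C\cdot L(V,\chi)$ I/Os; that is, $O\big(\frac VB\log_{M/B}\frac{\chi}{B}\big)$ I/Os. 2. (Matching lower bound.) There is an absolute constant $c>0$ such that, for all $M,B,V,\chi$ with $\chi\ge1$, $2\chi\le V$ and $V\le B(M/B)^B$, every machine (with any number of registers and words of any size) that optimally colours all inputs of $V$ intervals with chromatic number $\chi$ needs at least $c\cdot L(V,\chi)$ I/Os on at least one of these inputs. 3. (Clique number.) There are an algorithm and an absolute constant $C$ such that, for every input consisting only of the two sorted arrays of endpoints, the algorithm computes the clique number of $G$, which equals its chromatic number, using at most $C\cdot\mathrm{scan}(V)$ I/Os. -/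

import Mathlib

/-! ### Interval representations and their graphs -/

/-- An interval representation of `V` intervals with pairwise distinct endpoints. The left
endpoints and the right endpoints are each listed in increasing order; the interval of rank `i` is
the one with the `i`-th left endpoint, and `partner i` is the rank of its right endpoint. -/
structure IntervalRep (V : ℕ) where
  left : Fin V → ℕ
  right : Fin V → ℕ
  partner : Equiv.Perm (Fin V)
  left_strictMono : StrictMono left
  right_strictMono : StrictMono right
  left_ne_right : ∀ i j, left i ≠ right j
  left_lt : ∀ i, left i < right (partner i)

namespace IntervalRep

/-- The points of the `i`-th interval. -/
def interval {V : ℕ} (S : IntervalRep V) (i : Fin V) : Set ℕ :=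
  Set.Icc (S.left i) (S.right (S.partner i))

/-- The interval graph: vertices are the intervals, two of them adjacent iff they intersect. -/
def graph {V : ℕ} (S : IntervalRep V) : SimpleGraph (Fin V) where
  Adj i j := i ≠ j ∧ (S.interval i ∩ S.interval j).Nonempty
  symm := ⟨fun _ _ h => ⟨h.1.symm, by rw [Set.inter_comm]; exact h.2⟩⟩
  loopless := ⟨fun _ h => h.1 rfl⟩

end IntervalRep

/-! ### The external memory model -/

/-- Main memory of `M` cells, blocks of `B` cells. -/
structure EMParams where
  M : ℕ
  B : ℕ
  B_pos : 0 < B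
  two_mul_le : 2 * B ≤ M

/-- The content of one memory or disk cell: an integer word, or a colour. Colours are indivisible
records: they can be copied and moved, but not manufactured. -/
inductive Cell where
  | word (n : ℕ)
  | colour (c : ℕ)

/-- How internal computation fills one memory cell: with a computed word, or with a copy of the
content of memory cell `j`. -/
inductive Source (M : ℕ) where
  | word (n : ℕ)
  | copy (j : Fin M)

/-- One block transfer between main memory and the disk block number `a`. -/
inductive Transfer where
  | read (a : ℕ)
  | write (a : ℕ)

/-- The block number concerned. -/
def Transfer.block : Transfer → ℕ
  | .read a => a
  | .write a => a

/-- What a machine does at a time: internal computation, which refills the registers and the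
memory cells, followed by one block transfer. -/
structure Command (P : EMParams) (r : ℕ) where
  reg : Fin r → ℕ
  mem : Fin P.M → Source P.M
  transfer : Transfer

/-- An external memory machine with `r` word registers. Internal computation is free: the next
command (`none` to halt) is any function of the registers and of the main memory, and of
nothing else. -/
def Machine (P : EMParams) (r : ℕ) : Type :=
  (Fin r → ℕ) → (Fin P.M → Cell) → Option (Command P r)

/-- Registers, main memory, and disk. Disk block `a` consists of the cells `a * B + j`, `j < B`. -/
structure Config (P : EMParams) (r : ℕ) where
  reg : Fin r → ℕ
  mem : Fin P.M → Cell
  disk : ℕ → Cell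

/-- The content denoted by a source. -/
def Source.eval {M : ℕ} (mem : Fin M → Cell) : Source M → Cell
  | .word n => .word n
  | .copy j => mem j

/-- A block transfer; the cells `0, …, B - 1` of main memory serve as the transfer buffer. -/
def Transfer.exec {P : EMParams} {r : ℕ} (c : Config P r) : Transfer → Config P r
  | .read a =>
    { c with mem := fun j => if (j : ℕ) < P.B then c.disk (a * P.B + j) else c.mem j }
  | .write a =>
    { c with disk := fun x =>
        if x / P.B = a then
          c.mem ⟨x % P.B, (Nat.mod_lt x P.B_pos).trans_le (by have := P.two_mul_le; omega)⟩
        else c.disk x }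

/-- The effect of a command. -/
def Command.exec {P : EMParams} {r : ℕ} (d : Command P r) (c : Config P r) : Config P r :=
  d.transfer.exec { reg := d.reg, mem := fun j => (d.mem j).eval c.mem, disk := c.disk }

/-- All words in registers, main memory and on disk are smaller than `W`. -/
def Config.WordsBelow {P : EMParams} {r : ℕ} (W : ℕ) (c : Config P r) : Prop :=
  (∀ i, c.reg i < W) ∧ (∀ j n, c.mem j = .word n → n < W) ∧ (∀ x n, c.disk x = .word n → n < W)

/-- `HaltsIn A W c t c'`: started in `c`, the machine `A` halts in `c'` after exactly `t` block
transfers, and all words and block numbers occurring meanwhile are smaller than `W`. -/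
inductive HaltsIn {P : EMParams} {r : ℕ} (A : Machine P r) (W : ℕ) :
    Config P r → ℕ → Config P r → Prop
  | halt (c : Config P r) (hW : c.WordsBelow W) (h : A c.reg c.mem = none) : HaltsIn A W c 0 c
  | step (c c' : Config P r) (d : Command P r) (t : ℕ) (hW : c.WordsBelow W)
      (h : A c.reg c.mem = some d) (ha : d.transfer.block < W)
      (ht : HaltsIn A W (d.exec c) t c') : HaltsIn A W c (t + 1) c'

/-- The start: register `0` holds `V`, the other registers and the memory are blank. -/
def startConfig (P : EMParams) (r V : ℕ) (disk : ℕ → Cell) : Config P r where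
  reg i := if (i : ℕ) = 0 then V else 0
  mem _ := .word 0
  disk := disk

/-- The array `f` of `V` cells stored on disk from cell number `s` on, `rest` elsewhere. -/
def storeArray {V : ℕ} (s : ℕ) (f : Fin V → Cell) (rest : ℕ → Cell) : ℕ → Cell :=
  fun x => if h : s ≤ x ∧ x < s + V then f ⟨x - s, by omega⟩ else rest x

/-! ### The two problems -/

/-- The sorted left endpoints from cell `0`, the sorted right endpoints from cell `V`. -/
def endpointDisk {V : ℕ} (S : IntervalRep V) : ℕ → Cell :=
  storeArray 0 (fun i => .word (S.left i)) <|
  storeArray V (fun i => .word (S.right i)) fun _ => .word 0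

/-- The sorted endpoints as before; from cell `2 * V`, for each left endpoint, the rank of the
corresponding right endpoint; from cell `3 * V`, a palette of `V` colours. -/
def colouringDisk {V : ℕ} (S : IntervalRep V) : ℕ → Cell :=
  storeArray 0 (fun i => .word (S.left i)) <|
  storeArray V (fun i => .word (S.right i)) <|
  storeArray (2 * V) (fun i => .word (S.partner i)) <|
  storeArray (3 * V) (fun i : Fin V => .colour i) fun _ => .word 0

/-- In exactly `t` block transfers, with words below `W`, the machine writes to the cells
`4 * V, …, 5 * V - 1` a proper colouring of the interval graph with as few colours as possible
(the colour of the `i`-th interval in the `i`-th of these cells). -/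
def ColoursIn {P : EMParams} {r V : ℕ} (A : Machine P r) (W : ℕ) (S : IntervalRep V) (t : ℕ) :
    Prop :=
  ∃ (c' : Config P r) (f : S.graph.Coloring ℕ),
    HaltsIn A W (startConfig P r V (colouringDisk S)) t c' ∧
    (∀ i : Fin V, c'.disk (4 * V + i) = .colour (f i)) ∧
    ((Set.range f).ncard : ℕ∞) = S.graph.chromaticNumber

/-- In exactly `t` block transfers, with words below `W`, the machine writes to cell `2 * V` the
number which is both the clique number and the chromatic number of the interval graph. -/
def FindsCliqueNumberIn {P : EMParams} {r V : ℕ} (A : Machine P r) (W : ℕ) (S : IntervalRep V)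
    (t : ℕ) : Prop :=
  ∃ (c' : Config P r) (n : ℕ),
    HaltsIn A W (startConfig P r V (endpointDisk S)) t c' ∧
    c'.disk (2 * V) = .word n ∧
    n = S.graph.cliqueNum ∧ (n : ℕ∞) = S.graph.chromaticNumber

/-- A bound polynomial in the number of intervals, the size of the memory, and the largest
endpoint: words below it have `O(k log (V + M + largest endpoint))` bits. -/
def wordLimit {V : ℕ} (P : EMParams) (S : IntervalRep V) (k : ℕ) : ℕ :=
  (V + P.M + Finset.univ.sup S.right + 2) ^ k

/-- `scan(V) = ⌈V / B⌉`. -/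
noncomputable def scanBound (P : EMParams) (V : ℕ) : ℝ := (⌈(V : ℝ) / P.B⌉₊ : ℝ)

/-- `(V / B) log_{M/B} (χ / B)`, with the usual conventions that the number of blocks is rounded
up and that a logarithm smaller than `1` counts as `1`. -/
noncomputable def colouringBound (P : EMParams) (V χ : ℕ) : ℝ :=
  scanBound P V * max 1 (Real.logb ((P.M : ℝ) / P.B) ((χ : ℝ) / P.B))

/-! Upper bounds. Let free colours wait in a queue. With `c` colours, the right endpoint of rank `i`
then hands its colour to the interval of rank `i + c`, so the successor `next` of an interval can be
read off the input without simulating the queue. This colouring `fifo` is proper if every right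
endpoint of rank `i` precedes the left endpoint of rank `i + c` (`Fits`, `Fits.fifo_ne`). If,
conversely, some left endpoint of rank `i + c - 1` precedes the right endpoint of rank `i`, there is
a clique of size `c` (`card_clique_ge`), and `c` is both clique number and chromatic number
(`Fits.chromaticNumber_eq`). One simultaneous scan of the two sorted arrays finds such a `c`
(`scan_invariant`, `need_spec`); this settles the third statement.

It remains to send colours along the chains from `i` to `next i`, always forward in rank. This is
time-forward processing in a tree. A leaf is a run of consecutive intervals that fits into memory
(`performs_leaf`), and an inner node has about `M / B` children. Every node has a list of incoming
and a list of outgoing messages. The incoming list is distributed among the children, and after each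
child its outgoing list is distributed among the later children and the outgoing list of the node
(`performs_node`). A level thus costs linear time. At most `χ` messages cross any position
(`Fits.card_crossing_le`), so nodes with at least `χ` intervals need no common ancestor: they are
processed in sequence and hand all crossing messages on directly (`performs_colouring`). The height
is therefore governed by `χ` and not by `V` (`two_mul_height_le`).

These programs are written for a machine with lanes, whose operations each cost two transfers of the
given model (`Compile.machine_halts`). The length of a program depends on `V` and the number of
colours only, so the cost is fixed in advance.

Lower bound. In the instances `shuffled` the endpoints interleave so tightly that each colour set
free is the only one available to the next interval. The `k` permutations of `χ` symbols built into
the instance are thus forced on every optimal colouring and can be recovered from it, even up to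
renaming colours (`shift_injective`). On the other side one counts the arrangements of colours that
`T` transfers can produce, recording only sets of colours: a transfer selects a version of a block
and at most `B` of at most `2 * M` colours (`card_reachable_le`), and at the end every output cell
has at most `B` candidates (`card_arrangements_le`). These candidates cost a factor `B ^ ((k + 1) *
χ)` against only `k` factorials. The surplus `B ^ χ` is recovered by counting also the renamings of
colours within the blocks of the palette, which the sets recorded cannot distinguish
(`le_card_stabilizer`, `card_arrangements_ge`). Logarithms give `log_inequality`. When `χ / B` is
bounded by a constant or by a fixed power of `M / B`, it is enough that the output must be written
(`ColoursIn.scan_le`). -/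

/-! ### A machine with word lanes and colour lanes -/

namespace EMParams

/-- The number of memory cells used for lane words. -/
def wordCells (P : EMParams) : ℕ := (P.M - P.B) / 2

/-- The number of lanes. -/
def lanes (P : EMParams) : ℕ := P.M - P.B - P.wordCells

lemma lanes_eq (P : EMParams) : P.B + P.wordCells + P.lanes = P.M := by
  have h1 := P.two_mul_le
  unfold lanes wordCells
  omega

lemma wordCells_le_lanes (P : EMParams) : P.wordCells ≤ P.lanes := by
  unfold lanes wordCells
  omega

/-- At most one lane finds no memory cell for its words. These go into a register; with `M = 2`, `B
= 1` the only lane is of this kind. -/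
lemma lanes_le_wordCells (P : EMParams) : P.lanes ≤ P.wordCells + 1 := by
  unfold lanes wordCells
  omega

lemma lanes_pos (P : EMParams) : 0 < P.lanes := by
  have h1 := P.two_mul_le
  have h2 := P.B_pos
  unfold lanes wordCells
  omega

/-- The buffer takes at most half of the memory, and at least half of the rest holds lane colours.
Leaves of this size are within a constant factor of the memory. -/
lemma le_four_mul_lanes (P : EMParams) : P.M ≤ 4 * P.lanes := by
  have h1 := P.two_mul_le
  have h2 := P.B_pos
  unfold lanes wordCells
  omega

end EMParams

/-- The words held by the lanes, three to a lane. -/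
abbrev LaneWords (P : EMParams) : Type := Fin P.lanes → ℕ × ℕ × ℕ

/-- Lane words, a scalar, lane colours, and the disk. -/
@[ext]
structure LaneState (P : EMParams) where
  words : LaneWords P
  scalar : ℕ
  colours : Fin P.lanes → Cell
  disk : ℕ → Cell

/-- An elementary operation: reading a block and updating the lanes, or rewriting parts of a
block. -/
inductive Op (P : EMParams) where
  | read (blk : LaneWords P → ℕ → ℕ)
      (upd : LaneWords P → ℕ → (Fin P.B → Cell) → LaneWords P × ℕ)
      (col : LaneWords P → ℕ → Fin P.lanes → Fin P.lanes ⊕ Fin P.B)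
  | write (blk : LaneWords P → ℕ → ℕ) (src : LaneWords P → ℕ → Fin P.B → Option (ℕ ⊕ Fin P.lanes))

namespace Op

variable {P : EMParams}

/-- The block concerned. -/
def block (o : Op P) (s : LaneState P) : ℕ :=
  match o with
  | read blk _ _ => blk s.words s.scalar
  | write blk _ => blk s.words s.scalar

/-- The cell denoted by an instruction for rewriting a cell of content `old`. -/
def newCell (K : Fin P.lanes → Cell) (old : Cell) : Option (ℕ ⊕ Fin P.lanes) → Cell
  | none => old
  | some (.inl n) => .word n
  | some (.inr j) => K j

/-- The effect of an operation. -/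
def exec (o : Op P) (s : LaneState P) : LaneState P :=
  match o with
  | read blk upd col =>
    let buf : Fin P.B → Cell := fun y => s.disk (blk s.words s.scalar * P.B + y)
    { words := (upd s.words s.scalar buf).1
      scalar := (upd s.words s.scalar buf).2
      colours := fun j => Sum.elim s.colours buf (col s.words s.scalar j)
      disk := s.disk }
  | write blk src =>
    { s with disk := fun x =>
        if x / P.B = blk s.words s.scalar then
          newCell s.colours (s.disk x) (src s.words s.scalar ⟨x % P.B, Nat.mod_lt x P.B_pos⟩)
        else s.disk x }

end Op

/-- All words of the state are smaller than `U`. -/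
structure LaneState.Bdd {P : EMParams} (U : ℕ) (s : LaneState P) : Prop where
  words : ∀ j, (s.words j).1 < U ∧ (s.words j).2.1 < U ∧ (s.words j).2.2 < U
  scalar : s.scalar < U
  colours : ∀ j n, s.colours j = .word n → n < U
  disk : ∀ x n, s.disk x = .word n → n < U

/-- `Run U Z p s s'`: the operations `p` lead from `s` to `s'`, with all words and block numbers
below `U` and all scalars in `Z`. -/
def Run {P : EMParams} (U : ℕ) (Z : ℕ → Prop) : List (Op P) → LaneState P → LaneState P → Prop
  | [], s, s' => s.Bdd U ∧ Z s.scalar ∧ s' = s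
  | o :: p, s, s' => s.Bdd U ∧ Z s.scalar ∧ o.block s < U ∧ Run U Z p (o.exec s) s'

section Run

variable {P : EMParams} {U : ℕ} {Z : ℕ → Prop} {p q : List (Op P)} {s s' s'' : LaneState P}

lemma Run.nil (h : s.Bdd U) (hZ : Z s.scalar) : Run U Z [] s s := ⟨h, hZ, rfl⟩

lemma Run.bdd (h : Run U Z p s s') : s.Bdd U := by
  cases p with
  | nil => exact h.1
  | cons => exact h.1

lemma Run.last (h : Run U Z p s s') : s'.Bdd U ∧ Z s'.scalar := by
  induction p generalizing s with
  | nil => obtain ⟨h1, h2, rfl⟩ := h; exact ⟨h1, h2⟩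
  | cons o p ih => exact ih h.2.2.2

lemma Run.append (h : Run U Z p s s') (h' : Run U Z q s' s'') : Run U Z (p ++ q) s s'' := by
  induction p generalizing s with
  | nil => obtain ⟨_, _, rfl⟩ := h; exact h'
  | cons o p ih => exact ⟨h.1, h.2.1, h.2.2.1, ih h.2.2.2⟩

lemma Run.single {o : Op P} (h : s.Bdd U) (hZ : Z s.scalar) (hb : o.block s < U)
    (h' : (o.exec s).Bdd U) (hZ' : Z (o.exec s).scalar) : Run U Z [o] s (o.exec s) :=
  ⟨h, hZ, hb, h', hZ', rfl⟩

end Run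

/-! ### Compilation to external memory machines -/

/-- Three words packed into one. -/
def packWords (w : ℕ × ℕ × ℕ) : ℕ := Nat.pair w.1 (Nat.pair w.2.1 w.2.2)

/-- The inverse of `packWords`. -/
def unpackWords (n : ℕ) : ℕ × ℕ × ℕ := (n.unpair.1, n.unpair.2.unpair.1, n.unpair.2.unpair.2)

@[simp] lemma unpackWords_packWords (w : ℕ × ℕ × ℕ) : unpackWords (packWords w) = w := by
  simp [unpackWords, packWords]

/-- Each of the two nested pairings squares the bound. -/
lemma packWords_lt {U : ℕ} {w : ℕ × ℕ × ℕ} (h : w.1 < U ∧ w.2.1 < U ∧ w.2.2 < U) :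
    packWords w < U ^ 4 := by
  have hp : ∀ {a b n : ℕ}, a < n → b < n → Nat.pair a b < n ^ 2 := by
    intro a b n ha hb
    refine (Nat.pair_lt_max_add_one_sq a b).trans_le (Nat.pow_le_pow_left ?_ 2)
    omega
  have h1 : w.1 < U ^ 2 := h.1.trans_le (Nat.le_self_pow two_ne_zero U)
  have h2 := hp h1 (hp h.2.1 h.2.2)
  simpa [packWords, ← pow_mul] using h2

/-- The word in a cell, `0` if it holds a colour. -/
def Cell.toNat : Cell → ℕ
  | .word n => n
  | .colour _ => 0

namespace Compile

variable {P : EMParams}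

/-- The memory cell of the lane word `j`. -/
def wordIdx (P : EMParams) (j : ℕ) (h : j < P.wordCells) : Fin P.M :=
  ⟨P.B + j, by have := P.lanes_eq; omega⟩

/-- The memory cell of the lane colour `j`. -/
def colourIdx (j : Fin P.lanes) : Fin P.M :=
  ⟨P.B + P.wordCells + j, by have := P.lanes_eq; omega⟩

/-- The buffer cell `y`. -/
def bufIdx (y : Fin P.B) : Fin P.M := ⟨y, by have := P.two_mul_le; omega⟩

/-- The lane words, read off from the registers and the memory. -/
def decode (reg : Fin 4 → ℕ) (mem : Fin P.M → Cell) : LaneWords P := fun j =>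
  if h : (j : ℕ) < P.wordCells then unpackWords (mem (wordIdx P j h)).toNat
  else unpackWords (reg 3)

/-- Registers holding the number of intervals, the program counter, the scalar, and the word of
the last lane. -/
def regs (V pc z : ℕ) (w : LaneWords P) : Fin 4 → ℕ :=
  ![V, pc, z, if P.wordCells < P.lanes then
    packWords (w ⟨P.lanes - 1, by have := P.lanes_pos; omega⟩) else 0]

/-- The memory, apart from the buffer. -/
def memSrc (w : LaneWords P) (col : Fin P.lanes → Source P.M) (buf : Fin P.B → Source P.M) :
    Fin P.M → Source P.M := fun i =>
  if h : (i : ℕ) < P.B then buf ⟨i, h⟩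
  else if h' : (i : ℕ) < P.B + P.wordCells then
    .word (packWords (w ⟨i - P.B, by have := P.wordCells_le_lanes; omega⟩))
  else col ⟨i - (P.B + P.wordCells), by have := P.lanes_eq; omega⟩

/-- The command fetching the block of an operation. -/
def fetch (o : Op P) (V pc z : ℕ) (w : LaneWords P) : Command P 4 where
  reg := regs V (pc + 1) z w
  mem := memSrc w (fun j => .copy (colourIdx j)) (fun y => .copy (bufIdx y))
  transfer := .read (match o with
    | .read blk _ _ => blk w z
    | .write blk _ => blk w z)

/-- The source for the new content of a buffer cell. -/
def writeSrc (y : Fin P.B) : Option (ℕ ⊕ Fin P.lanes) → Source P.M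
  | none => .copy (bufIdx y)
  | some (.inl n) => .word n
  | some (.inr j) => .copy (colourIdx j)

/-- The command completing an operation after its block has been fetched. -/
def complete (o : Op P) (V pc z : ℕ) (w : LaneWords P) (buf : Fin P.B → Cell) : Command P 4 :=
  match o with
  | .read _ upd col =>
    { reg := regs V (pc + 1) (upd w z buf).2 (upd w z buf).1
      mem := memSrc (upd w z buf).1
        (fun j => Sum.elim (fun j' => .copy (colourIdx j')) (fun y => .copy (bufIdx y)) (col w z j))
        (fun y => .copy (bufIdx y))
      transfer := .read 0 }
  | .write blk src =>
    { reg := regs V (pc + 1) z w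
      mem := memSrc w (fun j => .copy (colourIdx j)) (fun y => writeSrc y (src w z y))
      transfer := .write (blk w z) }

/-- The machine running first `p₁ V`, where `V` is the initial content of register `0`, and then
`p₂ V z`, where `z` is the scalar at that time. -/
def machine (p₁ : ℕ → List (Op P)) (p₂ : ℕ → ℕ → List (Op P)) : Machine P 4 := fun reg mem =>
  ((p₁ (reg 0) ++ if reg 1 < 2 * (p₁ (reg 0)).length then [] else p₂ (reg 0) (reg 2))[reg 1 / 2]?).map
    fun o => if reg 1 % 2 = 0 then fetch o (reg 0) (reg 1) (reg 2) (decode reg mem)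
      else complete o (reg 0) (reg 1) (reg 2) (decode reg mem) (fun y => mem (bufIdx y))

/-- The configuration `c` represents the lane state `s`. -/
structure Rep (W V pc : ℕ) (c : Config P 4) (s : LaneState P) : Prop where
  bdd : c.WordsBelow W
  reg0 : c.reg 0 = V
  reg1 : c.reg 1 = pc
  reg2 : c.reg 2 = s.scalar
  words : decode c.reg c.mem = s.words
  colours : ∀ j, c.mem (colourIdx j) = s.colours j
  disk : c.disk = s.disk

lemma decode_regs (V pc z : ℕ) (w : LaneWords P) (mem : Fin P.M → Cell)
    (h : ∀ j (hj : j < P.wordCells), mem (wordIdx P j hj) = .word (packWords (w ⟨j, by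
      have := P.wordCells_le_lanes; omega⟩))) :
    decode (regs V pc z w) mem = w := by
  funext j
  unfold decode
  split_ifs with hj
  · simp [h j hj, Cell.toNat]
  · have h1 := P.wordCells_le_lanes
    have h2 := P.lanes_le_wordCells
    have h3 : P.wordCells < P.lanes := by omega
    have h4 : (⟨P.lanes - 1, by omega⟩ : Fin P.lanes) = j := by
      apply Fin.ext
      simp only
      omega
    simp [regs, h3, h4]

lemma regs_lt {U W V pc z : ℕ} {w : LaneWords P} (hU : U ^ 4 ≤ W) (hV : V < W) (hpc : pc < W)
    (hz : z < U) (hw : ∀ j, (w j).1 < U ∧ (w j).2.1 < U ∧ (w j).2.2 < U) (i : Fin 4) :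
    regs V pc z w i < W := by
  have hzW : z < W := hz.trans_le ((Nat.le_self_pow (by norm_num) U).trans hU)
  have := packWords_lt (hw ⟨P.lanes - 1, by have := P.lanes_pos; omega⟩)
  fin_cases i <;> simp [regs] <;> try omega
  split_ifs <;> omega

lemma memSrc_wordIdx (w : LaneWords P) (col buf) (j : ℕ) (hj : j < P.wordCells) :
    memSrc w col buf (wordIdx P j hj) = .word (packWords (w ⟨j, by
      have := P.wordCells_le_lanes; omega⟩)) := by
  simp [memSrc, wordIdx, hj]

lemma memSrc_colourIdx (w : LaneWords P) (col buf) (j : Fin P.lanes) :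
    memSrc w col buf (colourIdx j) = col j := by
  have h1 : ¬ (P.B + P.wordCells + (j : ℕ) < P.B) := by omega
  simp [memSrc, colourIdx, h1]

lemma memSrc_bufIdx (w : LaneWords P) (col buf) (y : Fin P.B) :
    memSrc w col buf (bufIdx y) = buf y := by
  simp [memSrc, bufIdx]

lemma idx_cases (i : Fin P.M) : (∃ y : Fin P.B, i = bufIdx y) ∨
    (∃ j hj, i = wordIdx P j hj) ∨ ∃ j : Fin P.lanes, i = colourIdx j := by
  have := P.lanes_eq
  by_cases h : (i : ℕ) < P.B
  · exact .inl ⟨⟨i, h⟩, rfl⟩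
  by_cases h' : (i : ℕ) < P.B + P.wordCells
  · exact .inr (.inl ⟨i - P.B, by omega, Fin.ext (by simp [wordIdx]; omega)⟩)
  · exact .inr (.inr ⟨⟨i - (P.B + P.wordCells), by omega⟩, Fin.ext (by simp [colourIdx]; omega)⟩)

/-- A read overwrites only the buffer, and a write changes only the disk. So the registers and the
memory outside the buffer are those prescribed by the command, and only colours, buffer words and
disk are left to compare. -/
lemma rep_exec {U W V pc' : ℕ} {c : Config P 4} {s' : LaneState P} {d : Command P 4}
    (hc : c.WordsBelow W) (hU : U ^ 4 ≤ W) (hV : V < W) (hpc : pc' < W) (hs' : s'.Bdd U)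
    (hreg : d.reg = regs V pc' s'.scalar s'.words)
    (col : Fin P.lanes → Source P.M) (buf : Fin P.B → Source P.M)
    (hmem : d.mem = memSrc s'.words col buf)
    (hcol : ∀ j, (col j).eval c.mem = s'.colours j)
    (hbuf : ∀ y n, (buf y).eval c.mem = .word n → n < W)
    (hdisk : (d.exec c).disk = s'.disk) : Rep W V pc' (d.exec c) s' := by
  have hUW : U ≤ W := (Nat.le_self_pow (by norm_num) U).trans hU
  have hreg' : (d.exec c).reg = regs V pc' s'.scalar s'.words := by
    cases h : d.transfer <;> simp [Command.exec, Transfer.exec, h, hreg]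
  have hmem1 : ∀ i : Fin P.M, P.B ≤ (i : ℕ) → (d.exec c).mem i = (d.mem i).eval c.mem := by
    intro i hi
    cases h : d.transfer <;> simp [Command.exec, Transfer.exec, h, hi]
  have hmem2 : ∀ y : Fin P.B, (∃ x, (d.exec c).mem (bufIdx y) = c.disk x) ∨
      (d.exec c).mem (bufIdx y) = (buf y).eval c.mem := by
    intro y
    cases h : d.transfer with
    | read a =>
      left
      exact ⟨_, by simp [Command.exec, Transfer.exec, h, bufIdx]; rfl⟩
    | write a =>
      right
      simp [Command.exec, Transfer.exec, h, hmem, memSrc_bufIdx]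
  have hw : ∀ j (hj : j < P.wordCells), (d.exec c).mem (wordIdx P j hj) =
      .word (packWords (s'.words ⟨j, by have := P.wordCells_le_lanes; omega⟩)) := by
    intro j hj
    rw [hmem1 _ (by simp [wordIdx]), hmem, memSrc_wordIdx]
    rfl
  have hk : ∀ j, (d.exec c).mem (colourIdx j) = s'.colours j := by
    intro j
    rw [hmem1 _ (by simp [colourIdx]; omega), hmem, memSrc_colourIdx, hcol]
  refine ⟨⟨?_, ?_, ?_⟩, ?_, ?_, ?_, ?_, hk, hdisk⟩
  · intro i
    rw [hreg']
    exact regs_lt hU hV hpc hs'.scalar hs'.words i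
  · intro i n hi
    rcases idx_cases i with ⟨y, rfl⟩ | ⟨j, hj, rfl⟩ | ⟨j, rfl⟩
    · rcases hmem2 y with ⟨x, hx⟩ | hx
      · exact hc.2.2 x n (hx ▸ hi)
      · exact hbuf y n (hx ▸ hi)
    · rw [hw] at hi
      cases hi
      exact (packWords_lt (hs'.words _)).trans_le hU
    · rw [hk] at hi
      exact (hs'.colours j n hi).trans_le hUW
  · intro x n hx
    rw [hdisk] at hx
    exact (hs'.disk x n hx).trans_le hUW
  · simp [hreg', regs]
  · simp [hreg', regs]
  · simp [hreg', regs]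
  · rw [hreg']
    exact decode_regs _ _ _ _ _ hw

/-- The effect of an operation depends on a block which must first be in the buffer; hence two
commands. A rewriting operation writes the block back in the second one, while a reading operation
spends it on an idle read of block `0`. -/
lemma exec_steps {U W V pc : ℕ} {c : Config P 4} {s : LaneState P} (o : Op P)
    (h : Rep W V pc c s) (hU : U ^ 4 ≤ W) (hV : V < W) (hpc : pc + 2 < W) (hs : s.Bdd U)
    (hs' : (o.exec s).Bdd U) :
    ∃ c₁, c₁ = (fetch o V pc s.scalar s.words).exec c ∧ Rep W V (pc + 1) c₁ s ∧
      Rep W V (pc + 2) ((complete o V (pc + 1) s.scalar s.words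
        (fun y => c₁.mem (bufIdx y))).exec c₁) (o.exec s) := by
  refine ⟨_, rfl, ?_, ?_⟩
  · refine rep_exec h.bdd hU hV (by omega) hs rfl (fun j => .copy (colourIdx j))
          (fun y => .copy (bufIdx y)) rfl ?_ ?_ ?_
    · intro j
      simp [Source.eval, h.colours]
    · intro y n hy
      exact h.bdd.2.1 _ _ hy
    · simp [Command.exec, Transfer.exec, fetch, h.disk]
  · have h1 : Rep W V (pc + 1) ((fetch o V pc s.scalar s.words).exec c) s := by
      refine rep_exec h.bdd hU hV (by omega) hs rfl (fun j => .copy (colourIdx j))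
          (fun y => .copy (bufIdx y)) rfl ?_ ?_ ?_
      · intro j
        simp [Source.eval, h.colours]
      · intro y n hy
        exact h.bdd.2.1 _ _ hy
      · simp [Command.exec, Transfer.exec, fetch, h.disk]
    have hb : (fun y => ((fetch o V pc s.scalar s.words).exec c).mem (bufIdx y)) =
        fun y : Fin P.B => s.disk (o.block s * P.B + y) := by
      funext y
      cases o <;> simp [Command.exec, Transfer.exec, fetch, bufIdx, h.disk, Op.block]
    rw [hb]
    set c₁ := (fetch o V pc s.scalar s.words).exec c with hc₁
    have hb' : ∀ y : Fin P.B, c₁.mem (bufIdx y) = s.disk (o.block s * P.B + y) := fun y =>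
      congrFun hb y
    cases o with
    | read blk upd col =>
      refine rep_exec h1.bdd hU hV (by omega) hs' rfl (fun j => Sum.elim (fun j' => .copy (colourIdx j'))
        (fun y => .copy (bufIdx y)) (col s.words s.scalar j)) (fun y => .copy (bufIdx y)) rfl ?_ ?_ ?_
      · intro j
        simp only [Op.exec]
        cases col s.words s.scalar j with
        | inl j' => simp [Source.eval, h1.colours]
        | inr y => simp [Source.eval, hb', Op.block]
      · intro y n hy
        exact h1.bdd.2.1 _ _ hy
      · simp [Command.exec, Transfer.exec, complete, h1.disk, Op.exec]
    | write blk src =>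
      refine rep_exec h1.bdd hU hV (by omega) hs' rfl (fun j => .copy (colourIdx j))
        (fun y => writeSrc y (src s.words s.scalar y)) rfl ?_ ?_ ?_
      · intro j
        simp [Source.eval, h1.colours, Op.exec]
      · intro y n hy
        have hy' : Op.newCell s.colours (s.disk (blk s.words s.scalar * P.B + y))
            (src s.words s.scalar y) = .word n := by
          rw [← hy]
          rcases src s.words s.scalar y with _ | ⟨m | j⟩
          · simp [writeSrc, Source.eval, hb', Op.block, Op.newCell]
          · simp [writeSrc, Source.eval, Op.newCell]
          · simp [writeSrc, Source.eval, h1.colours, Op.newCell]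
        have hx : (blk s.words s.scalar * P.B + (y : ℕ)) / P.B = blk s.words s.scalar := by
          rw [mul_comm, Nat.mul_add_div P.B_pos, Nat.div_eq_of_lt y.2, add_zero]
        have hx' : (blk s.words s.scalar * P.B + (y : ℕ)) % P.B = y := by
          rw [mul_comm, Nat.mul_add_mod, Nat.mod_eq_of_lt y.2]
        have := hs'.disk (blk s.words s.scalar * P.B + y) n (by
          simp only [Op.exec, hx, hx', if_true]
          exact hy')
        exact this.trans_le ((Nat.le_self_pow (by norm_num) U).trans hU)
      · funext x
        simp only [Command.exec, Transfer.exec, complete, h1.disk, Op.exec]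
        split_ifs with hx
        · have hb'' := hb' ⟨x % P.B, Nat.mod_lt x P.B_pos⟩
          have hxx : blk s.words s.scalar * P.B + x % P.B = x := by
            rw [← hx, mul_comm]
            exact Nat.div_add_mod x P.B
          simp only [Op.block, hxx] at hb''
          rw [show (⟨x % P.B, (Nat.mod_lt x P.B_pos).trans_le (by
            have := P.two_mul_le; omega)⟩ : Fin P.M) = bufIdx ⟨x % P.B, Nat.mod_lt x P.B_pos⟩ from rfl,
            memSrc_bufIdx]
          rcases src s.words s.scalar ⟨x % P.B, Nat.mod_lt x P.B_pos⟩ with _ | ⟨m | j⟩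
          · simp [writeSrc, Source.eval, hb'', Op.newCell]
          · simp [writeSrc, Source.eval, Op.newCell]
          · simp [writeSrc, Source.eval, h1.colours, Op.newCell]
        · rfl

/-- The conclusion extends any halting computation backwards, so that two programs can be chained.
The predicate `Z` records what is known of the scalar, from which the machine determines its
program. -/
lemma halts_of_run {A : Machine P 4} {U W V : ℕ} {Z : ℕ → Prop} (hU : U ^ 4 ≤ W) (hV : V < W)
    (p : List (Op P)) {s s' : LaneState P} (hrun : Run U Z p s s') (pc₀ : ℕ)
    {c : Config P 4} (h : Rep W V (2 * pc₀) c s) (hpc : 2 * (pc₀ + p.length) < W)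
    (hA : ∀ k (hk : k < p.length) reg mem, reg 0 = V → Z (reg 2) → reg 1 / 2 = pc₀ + k →
      A reg mem = if reg 1 % 2 = 0 then some (fetch p[k] (reg 0) (reg 1) (reg 2) (decode reg mem))
      else some (complete p[k] (reg 0) (reg 1) (reg 2) (decode reg mem) (fun y => mem (bufIdx y)))) :
    ∃ c', Rep W V (2 * (pc₀ + p.length)) c' s' ∧
      ∀ t c'', HaltsIn A W c' t c'' → HaltsIn A W c (t + 2 * p.length) c'' := by
  induction p generalizing s c pc₀ with
  | nil =>
    obtain ⟨_, _, rfl⟩ := hrun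
    exact ⟨c, by simpa using h, by simp⟩
  | cons o p ih =>
    obtain ⟨hs, hZ, hblk, hrun⟩ := hrun
    simp only [List.length_cons] at hpc
    obtain ⟨c₁, hc₁, h₁, h₂⟩ := exec_steps o h hU hV (by omega) hs hrun.bdd
    set d₂ := complete o V (2 * pc₀ + 1) s.scalar s.words (fun y => c₁.mem (bufIdx y)) with hd₂
    obtain ⟨c', hc', hH⟩ := ih hrun (pc₀ + 1) (c := d₂.exec c₁) (by simpa [mul_add] using h₂)
      (by omega) (by
        intro k hk reg mem h0 h2 h1
        have := hA (k + 1) (by simpa using hk) reg mem h0 h2 (by omega)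
        simpa using this)
    refine ⟨c', by simpa [add_assoc, add_comm 1] using hc', fun t c'' ht => ?_⟩
    have hA1 := hA 0 (by simp) c.reg c.mem h.reg0 (by rw [h.reg2]; exact hZ) (by
      rw [h.reg1]; omega)
    have hA2 := hA 0 (by simp) c₁.reg c₁.mem h₁.reg0 (by rw [h₁.reg2]; exact hZ) (by
      rw [h₁.reg1]; omega)
    rw [h.reg1, if_pos (by omega), h.reg0, h.reg2, h.words, List.getElem_cons_zero] at hA1
    rw [h₁.reg1, if_neg (by omega), h₁.reg0, h₁.reg2, h₁.words, List.getElem_cons_zero] at hA2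
    have hblk' : o.block s < W := hblk.trans_le ((Nat.le_self_pow (by norm_num) U).trans hU)
    rw [List.length_cons, show t + 2 * (p.length + 1) = t + 2 * p.length + 1 + 1 by ring]
    refine .step c c'' _ _ h.bdd hA1 ?_ ?_
    · cases o <;> exact hblk'
    rw [← hc₁]
    refine .step c₁ c'' _ _ h₁.bdd hA2 ?_ (hH t c'' ht)
    cases o
    · exact (Nat.zero_le _).trans_lt hblk'
    · exact hblk'

/-- The start, as a lane state. -/
def startState (P : EMParams) (disk : ℕ → Cell) : LaneState P :=
  ⟨fun _ => (0, 0, 0), 0, fun _ => .word 0, disk⟩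

/-- The machine recomputes its program at every command. During the first phase the scalar is free
because `p₁` depends on `V` alone; during the second it must stay constant because it selects `p₂`.
-/
theorem machine_halts (p₁ : ℕ → List (Op P)) (p₂ : ℕ → ℕ → List (Op P)) {U W V : ℕ}
    {disk : ℕ → Cell} {s₁ s₂ : LaneState P} (hU : U ^ 4 ≤ W) (hV : V < W)
    (h₁ : Run U (fun _ => True) (p₁ V) (startState P disk) s₁)
    (h₂ : Run U (fun z => z = s₁.scalar) (p₂ V s₁.scalar) s₁ s₂)
    (hlen : 2 * ((p₁ V).length + (p₂ V s₁.scalar).length) < W) :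
    ∃ c', HaltsIn (machine p₁ p₂) W (startConfig P 4 V disk)
      (2 * ((p₁ V).length + (p₂ V s₁.scalar).length)) c' ∧ c'.disk = s₂.disk := by
  have hUW : U ≤ W := (Nat.le_self_pow (by norm_num) U).trans hU
  have h0 : Rep W V (2 * 0) (startConfig P 4 V disk) (startState P disk) := by
    refine ⟨⟨?_, ?_, ?_⟩, ?_, ?_, ?_, ?_, ?_, rfl⟩
    · intro i
      simp only [startConfig]
      split_ifs <;> omega
    · intro j n hj
      cases hj
      omega
    · exact fun x n hx => (h₁.bdd.disk x n hx).trans_le hUW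
    · rfl
    · rfl
    · rfl
    · funext j
      simp [decode, startConfig, startState, Cell.toNat, unpackWords]
    · intro j
      rfl
  obtain ⟨c₁, hc₁, hH₁⟩ := halts_of_run (A := machine p₁ p₂) hU hV (p₁ V) h₁ 0 h0 (by omega) (by
    intro k hk reg mem hV' _ h1
    have h1' : reg 1 < 2 * (p₁ V).length := by omega
    have h2 : reg 1 / 2 = k := by omega
    simp only [machine, hV', h1', if_true, List.append_nil, h2, List.getElem?_eq_getElem hk,
      Option.map_some]
    split_ifs <;> rfl)
  obtain ⟨c₂, hc₂, hH₂⟩ := halts_of_run (A := machine p₁ p₂) hU hV (p₂ V s₁.scalar) h₂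
    (p₁ V).length (by simpa using hc₁) hlen (by
    intro k hk reg mem hV' hZ h1
    have h1' : ¬ reg 1 < 2 * (p₁ V).length := by omega
    simp only [machine, hV', h1', if_false, h1, hZ]
    rw [List.getElem?_append_right (by omega), Nat.add_sub_cancel_left,
      List.getElem?_eq_getElem hk, Option.map_some]
    split_ifs <;> rfl)
  -- The program counter now points behind the last operation, where the lookup fails.
  have hend : HaltsIn (machine p₁ p₂) W c₂ 0 c₂ := by
    refine .halt c₂ hc₂.bdd ?_
    have hz : s₂.scalar = s₁.scalar := h₂.last.2
    have h1' : ¬ 2 * ((p₁ V).length + (p₂ V s₁.scalar).length) < 2 * (p₁ V).length := by omega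
    simp only [machine, hc₂.reg0, hc₂.reg1, hc₂.reg2, h1', if_false, hz, Option.map_eq_none_iff]
    apply List.getElem?_eq_none
    rw [List.length_append]
    omega
  refine ⟨c₂, ?_, hc₂.disk⟩
  have := hH₁ _ _ (hH₂ _ _ hend)
  rwa [zero_add, ← mul_add, add_comm (List.length _)] at this

end Compile

/-! ### Gathering and scattering -/

section Lanes

variable {P : EMParams}

lemma Cell.toNat_lt {U : ℕ} (hU : 0 < U) {c : Cell} (h : ∀ n, c = .word n → n < U) :
    c.toNat < U := by
  cases c with
  | word n => exact h n rfl
  | colour n => exact hU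

/-- The blocks of the cells addressed by the lanes. -/
def laneBlocks (a : Fin P.lanes → Option ℕ) : Finset ℕ :=
  Finset.univ.biUnion fun j => (a j).toFinset.image (· / P.B)

lemma mem_laneBlocks {a : Fin P.lanes → Option ℕ} {j : Fin P.lanes} {x : ℕ} (h : a j = some x) :
    x / P.B ∈ laneBlocks a := by
  simp only [laneBlocks, Finset.mem_biUnion, Finset.mem_univ, true_and, Finset.mem_image]
  exact ⟨j, x, by simp [h], rfl⟩

lemma exists_of_mem_laneBlocks {a : Fin P.lanes → Option ℕ} {b : ℕ} (h : b ∈ laneBlocks a) :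
    ∃ j x, a j = some x ∧ x / P.B = b := by
  simp only [laneBlocks, Finset.mem_biUnion, Finset.mem_univ, true_and, Finset.mem_image] at h
  obtain ⟨j, x, hx, hb⟩ := h
  exact ⟨j, x, by simpa using hx, hb⟩

lemma mem_take_succ {α : Type*} {l : List α} {t : ℕ} {b : α} :
    b ∈ l.take (t + 1) ↔ b ∈ l.take t ∨ l[t]? = some b := by
  rw [List.take_add_one]
  simp

lemma Run.of_sequence {U : ℕ} {Z : ℕ → Prop} (f : ℕ → Op P) (S : ℕ → LaneState P) (T : ℕ)
    (hB : ∀ t, t ≤ T → (S t).Bdd U) (hZ : ∀ t, t ≤ T → Z (S t).scalar)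
    (hb : ∀ t, t < T → (f t).block (S t) < U) (hS : ∀ t, t < T → (f t).exec (S t) = S (t + 1)) :
    Run U Z ((List.range T).map f) (S 0) (S T) := by
  induction T with
  | zero => exact Run.nil (hB 0 le_rfl) (hZ 0 le_rfl)
  | succ T ih =>
    rw [List.range_succ, List.map_append]
    refine (ih (fun t h => hB t (by omega)) (fun t h => hZ t (by omega)) (fun t h => hb t (by omega))
      (fun t h => hS t (by omega))).append ?_
    have h1 := hS T (by omega)
    have := Run.single (o := f T) (Z := Z) (hB T (by omega)) (hZ T (by omega)) (hb T (by omega))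
      (by rw [h1]; exact hB _ le_rfl) (by rw [h1]; exact hZ _ le_rfl)
    rwa [h1] at this

/-- The lane words apart from their second components. -/
abbrev outerWords (w : LaneWords P) : Fin P.lanes → ℕ × ℕ := fun j => ((w j).1, (w j).2.2)

open Classical in
/-- Lane words whose second components have been fetched from the addressed cells, as far as
these lie in the blocks `bs`. -/
noncomputable def fetchWords (a : Fin P.lanes → Option ℕ) (D : ℕ → Cell) (bs : List ℕ)
    (w : LaneWords P) : LaneWords P := fun j =>
  ((w j).1, (match a j with
    | none => (w j).2.1
    | some x => if x / P.B ∈ bs then (D x).toNat else (w j).2.1), (w j).2.2)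

open Classical in
/-- Lane colours fetched from the addressed cells, as far as these lie in the blocks `bs`. -/
noncomputable def fetchColours (a : Fin P.lanes → Option ℕ) (D : ℕ → Cell) (bs : List ℕ)
    (K : Fin P.lanes → Cell) : Fin P.lanes → Cell := fun j =>
  match a j with
  | none => K j
  | some x => if x / P.B ∈ bs then D x else K j

/-- The second components of the lane words are replaced by the addressed words on disk. -/
def gatherWords (a : Fin P.lanes → Option ℕ) (s : LaneState P) : LaneState P :=
  { s with words := fun j => ((s.words j).1, (match a j with
    | none => (s.words j).2.1
    | some x => (s.disk x).toNat), (s.words j).2.2) }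

/-- The lane colours are replaced by the addressed cells on disk. -/
def gatherColours (a : Fin P.lanes → Option ℕ) (s : LaneState P) : LaneState P :=
  { s with colours := fun j => match a j with
    | none => s.colours j
    | some x => s.disk x }

open Classical in
/-- The lanes send words or their colours to the addressed cells on disk. -/
noncomputable def scatter (a : Fin P.lanes → Option ℕ) (v : Fin P.lanes → ℕ ⊕ Fin P.lanes)
    (s : LaneState P) : LaneState P :=
  { s with disk := fun x => if h : ∃ j, a j = some x then
      Op.newCell s.colours (s.disk x) (some (v h.choose)) else s.disk x }

lemma scatter_disk_of_forall_ne {a : Fin P.lanes → Option ℕ} {v : Fin P.lanes → ℕ ⊕ Fin P.lanes}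
    {s : LaneState P} {x : ℕ} (h : ∀ j, a j ≠ some x) : (scatter a v s).disk x = s.disk x := by
  simp [scatter, h]

lemma scatter_disk_word {a : Fin P.lanes → Option ℕ} {v : Fin P.lanes → ℕ}
    {s : LaneState P} {x : ℕ} {j : Fin P.lanes} (h : a j = some x)
    (hv : ∀ j', a j' = some x → v j' = v j) :
    (scatter a (fun j => .inl (v j)) s).disk x = .word (v j) := by
  have hx : ∃ j, a j = some x := ⟨j, h⟩
  simp [scatter, hx, Op.newCell, hv _ hx.choose_spec]

lemma scatter_disk_colour {a : Fin P.lanes → Option ℕ} {s : LaneState P} {x : ℕ}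
    {j : Fin P.lanes} (h : a j = some x) (hv : ∀ j', a j' = some x → j' = j) :
    (scatter a .inr s).disk x = s.colours j := by
  have hx : ∃ j, a j = some x := ⟨j, h⟩
  simp [scatter, hx, Op.newCell, hv _ hx.choose_spec]

lemma getD_lt {l : List ℕ} {U : ℕ} (hU : 0 < U) (h : ∀ b ∈ l, b < U) (t : ℕ) : l.getD t 0 < U := by
  by_cases ht : t < l.length
  · simpa [List.getD, ht] using h _ (List.getElem_mem ht)
  · simpa [List.getD, ht] using hU

/-- The blocks addressed by the lanes are read one after the other. Each operation recomputes the
list of blocks from the lane words, so the addresses may not depend on the components that are being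
overwritten: hence `outerWords`. -/
theorem exists_gatherWords (T : ℕ) (addr : (Fin P.lanes → ℕ × ℕ) → ℕ → Fin P.lanes → Option ℕ) :
    ∃ p : List (Op P), p.length = T ∧ ∀ (U : ℕ) (Z : ℕ → Prop) (s : LaneState P), s.Bdd U →
      Z s.scalar → (laneBlocks (addr (outerWords s.words) s.scalar)).card ≤ T →
      (∀ j x, addr (outerWords s.words) s.scalar j = some x → x < U) →
      Run U Z p s (gatherWords (addr (outerWords s.words) s.scalar) s) := by
  classical
  let bs : LaneWords P → ℕ → List ℕ := fun w z => (laneBlocks (addr (outerWords w) z)).toList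
  let f : ℕ → Op P := fun t => .read (fun w z => (bs w z).getD t 0)
    (fun w z buf => (fun j => ((w j).1, (match addr (outerWords w) z j with
      | none => (w j).2.1
      | some x => if (bs w z)[t]? = some (x / P.B) then
        (buf ⟨x % P.B, Nat.mod_lt x P.B_pos⟩).toNat else (w j).2.1), (w j).2.2), z))
    (fun _ _ j => .inl j)
  refine ⟨(List.range T).map f, by simp, fun U Z s hs hZ hT ha => ?_⟩
  set a := addr (outerWords s.words) s.scalar with hadef
  let S : ℕ → LaneState P := fun t =>
    { s with words := fetchWords a s.disk ((bs s.words s.scalar).take t) s.words }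
  have hU : 0 < U := (Nat.zero_le _).trans_lt hs.scalar
  have hout : ∀ t, outerWords (S t).words = outerWords s.words := fun t => rfl
  have hbs : ∀ t, bs (S t).words s.scalar = bs s.words s.scalar := fun t => rfl
  have hS0 : S 0 = s := by
    ext : 1
    · funext j
      simp only [S, fetchWords, List.take_zero, List.not_mem_nil, if_false]
      cases a j <;> rfl
    all_goals rfl
  have hST : S T = gatherWords a s := by
    ext : 1
    · funext j
      simp only [S, fetchWords, gatherWords]
      cases h : a j with
      | none => rfl
      | some x =>
        rw [List.take_of_length_le (by simpa [bs] using hT)]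
        have : x / P.B ∈ bs s.words s.scalar := Finset.mem_toList.2 (mem_laneBlocks h)
        simp [this]
    all_goals rfl
  have key := Run.of_sequence (U := U) (Z := Z) f S T ?_ (fun _ _ => hZ) ?_ ?_
  · rwa [hS0, hST] at key
  · intro t _
    refine ⟨fun j => ⟨(hs.words j).1, ?_, (hs.words j).2.2⟩, hs.scalar, hs.colours, hs.disk⟩
    simp only [S, fetchWords]
    cases h : a j with
    | none => exact (hs.words j).2.1
    | some x =>
      simp only
      split_ifs
      · exact Cell.toNat_lt hU (hs.disk x)
      · exact (hs.words j).2.1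
  · intro t _
    simp only [f, Op.block]
    refine getD_lt hU ?_ t
    intro b hb
    rw [show (S t).scalar = s.scalar from rfl, hbs] at hb
    obtain ⟨j, x, hx, rfl⟩ := exists_of_mem_laneBlocks (Finset.mem_toList.1 hb)
    exact (Nat.div_le_self _ _).trans_lt (ha j x hx)
  · intro t _
    have hstep : ∀ j, ((f t).exec (S t)).words j = (S (t + 1)).words j := by
      intro j
      simp only [f, Op.exec]
      rw [show (S t).scalar = s.scalar from rfl, hbs, hout, ← hadef]
      simp only [S, fetchWords]
      cases h : a j with
      | none => rfl
      | some x =>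
        simp only [mem_take_succ]
        by_cases h1 : (bs s.words s.scalar)[t]? = some (x / P.B)
        · have h2 : x / P.B * P.B + x % P.B = x := by
            rw [mul_comm]; exact Nat.div_add_mod x P.B
          simp [h1, h2]
        · simp [h1]
    ext : 1
    · funext j
      exact hstep j
    all_goals rfl

/-- Here the addresses may use all lane words: only colours change, and these never influence the
list of blocks. -/
theorem exists_gatherColours (T : ℕ) (addr : LaneWords P → ℕ → Fin P.lanes → Option ℕ) :
    ∃ p : List (Op P), p.length = T ∧ ∀ (U : ℕ) (Z : ℕ → Prop) (s : LaneState P), s.Bdd U →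
      Z s.scalar → (laneBlocks (addr s.words s.scalar)).card ≤ T →
      (∀ j x, addr s.words s.scalar j = some x → x < U) →
      Run U Z p s (gatherColours (addr s.words s.scalar) s) := by
  classical
  let bs : LaneWords P → ℕ → List ℕ := fun w z => (laneBlocks (addr w z)).toList
  let f : ℕ → Op P := fun t => .read (fun w z => (bs w z).getD t 0) (fun w z _ => (w, z))
    (fun w z j => match addr w z j with
      | none => .inl j
      | some x => if (bs w z)[t]? = some (x / P.B) then .inr ⟨x % P.B, Nat.mod_lt x P.B_pos⟩
        else .inl j)
  refine ⟨(List.range T).map f, by simp, fun U Z s hs hZ hT ha => ?_⟩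
  set a := addr s.words s.scalar with hadef
  let S : ℕ → LaneState P := fun t =>
    { s with colours := fetchColours a s.disk ((bs s.words s.scalar).take t) s.colours }
  have hU : 0 < U := (Nat.zero_le _).trans_lt hs.scalar
  have hS0 : S 0 = s := by
    ext : 1
    any_goals rfl
    · funext j
      simp only [S, fetchColours, List.take_zero, List.not_mem_nil, if_false]
      cases a j <;> rfl
  have hST : S T = gatherColours a s := by
    ext : 1
    any_goals rfl
    · funext j
      simp only [S, fetchColours, gatherColours]
      cases h : a j with
      | none => rfl
      | some x =>
        rw [List.take_of_length_le (by simpa [bs] using hT)]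
        have : x / P.B ∈ bs s.words s.scalar := Finset.mem_toList.2 (mem_laneBlocks h)
        simp [this]
  have key := Run.of_sequence (U := U) (Z := Z) f S T ?_ (fun _ _ => hZ) ?_ ?_
  · rwa [hS0, hST] at key
  · intro t _
    refine ⟨hs.words, hs.scalar, ?_, hs.disk⟩
    intro j n
    simp only [S, fetchColours]
    cases h : a j with
    | none => exact hs.colours j n
    | some x =>
      simp only
      split_ifs
      · exact hs.disk x n
      · exact hs.colours j n
  · intro t _
    simp only [f, Op.block]
    refine getD_lt hU ?_ t
    intro b hb
    obtain ⟨j, x, hx, rfl⟩ := exists_of_mem_laneBlocks (Finset.mem_toList.1 hb)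
    exact (Nat.div_le_self _ _).trans_lt (ha j x hx)
  · intro t _
    have hstep : ∀ j, ((f t).exec (S t)).colours j = (S (t + 1)).colours j := by
      intro j
      simp only [f, Op.exec, S, fetchColours, ← hadef]
      cases h : a j with
      | none => simp only [Sum.elim_inl, fetchColours, h]
      | some x =>
        simp only [mem_take_succ]
        by_cases h1 : (bs s.words s.scalar)[t]? = some (x / P.B)
        · have h2 : x / P.B * P.B + x % P.B = x := by
            rw [mul_comm]; exact Nat.div_add_mod x P.B
          simp [h1, h2]
        · simp only [h1, if_false, Sum.elim_inl, fetchColours, h, or_false]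
    ext : 1
    any_goals rfl
    · funext j
      exact hstep j

/-- The blocks concerned are rewritten one after the other, each exactly once; cells that are not
addressed keep their content. -/
theorem exists_scatter (T : ℕ) (addr : LaneWords P → ℕ → Fin P.lanes → Option ℕ)
    (val : LaneWords P → ℕ → Fin P.lanes → ℕ ⊕ Fin P.lanes) :
    ∃ p : List (Op P), p.length = T ∧ ∀ (U : ℕ) (Z : ℕ → Prop) (s : LaneState P), s.Bdd U →
      Z s.scalar → (laneBlocks (addr s.words s.scalar)).card ≤ T →
      (∀ j x, addr s.words s.scalar j = some x → x < U) →
      (∀ j x n, addr s.words s.scalar j = some x → val s.words s.scalar j = .inl n → n < U) →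
      Run U Z p s (scatter (addr s.words s.scalar) (val s.words s.scalar) s) := by
  classical
  let bs : LaneWords P → ℕ → List ℕ := fun w z => (laneBlocks (addr w z)).toList
  let f : ℕ → Op P := fun t => .write (fun w z => (bs w z).getD t 0)
    -- The test on `t` matters: behind the end of the list `getD` names block `0`, which must then
    -- be left alone.
    (fun w z y => if h : t < (bs w z).length ∧
      ∃ j, addr w z j = some ((bs w z).getD t 0 * P.B + y) then some (val w z h.2.choose) else none)
  refine ⟨(List.range T).map f, by simp, fun U Z s hs hZ hT ha hv => ?_⟩
  set a := addr s.words s.scalar with hadef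
  let S : ℕ → LaneState P := fun t =>
    { s with disk := fun x => if x / P.B ∈ (bs s.words s.scalar).take t then
        (scatter a (val s.words s.scalar) s).disk x else s.disk x }
  have hU : 0 < U := (Nat.zero_le _).trans_lt hs.scalar
  have hS0 : S 0 = s := by
    ext : 1
    any_goals rfl
  have hST : S T = scatter a (val s.words s.scalar) s := by
    ext : 1
    any_goals rfl
    · funext x
      simp only [S]
      rw [List.take_of_length_le (by simpa [bs] using hT)]
      split_ifs with h
      · rfl
      · rw [scatter_disk_of_forall_ne]
        intro j hj
        exact h (Finset.mem_toList.2 (mem_laneBlocks hj))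
  have hfin : ∀ x n, (scatter a (val s.words s.scalar) s).disk x = .word n → n < U := by
    intro x n
    simp only [scatter]
    split_ifs with h
    · cases h' : val s.words s.scalar h.choose with
      | inl m =>
        intro hm
        simp only [Op.newCell, Cell.word.injEq] at hm
        exact hm ▸ hv _ x m h.choose_spec h'
      | inr j => exact hs.colours j n
    · exact hs.disk x n
  have key := Run.of_sequence (U := U) (Z := Z) f S T ?_ (fun _ _ => hZ) ?_ ?_
  · rwa [hS0, hST] at key
  · intro t _
    refine ⟨hs.words, hs.scalar, hs.colours, ?_⟩
    intro x n
    simp only [S]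
    split_ifs
    · exact hfin x n
    · exact hs.disk x n
  · intro t _
    simp only [f, Op.block]
    refine getD_lt hU ?_ t
    intro b hb
    obtain ⟨j, x, hx, rfl⟩ := exists_of_mem_laneBlocks (Finset.mem_toList.1 hb)
    exact (Nat.div_le_self _ _).trans_lt (ha j x hx)
  · intro t _
    have hstep : ∀ x, ((f t).exec (S t)).disk x = (S (t + 1)).disk x := by
      intro x
      have hx : x / P.B * P.B + x % P.B = x := by
        rw [mul_comm]; exact Nat.div_add_mod x P.B
      simp only [f, Op.exec, S, mem_take_succ, ← hadef]
      by_cases ht : t < (bs s.words s.scalar).length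
      · have hg : (bs s.words s.scalar).getD t 0 = (bs s.words s.scalar)[t] := by
          simp [List.getD, ht]
        rw [hg, List.getElem?_eq_getElem ht]
        by_cases h1 : x / P.B = (bs s.words s.scalar)[t]
        -- The list has no repetitions, so this block still has its original content.
        · have hnd : (bs s.words s.scalar)[t] ∉ (bs s.words s.scalar).take t := by
            have hnd : (bs s.words s.scalar).Nodup := Finset.nodup_toList _
            intro hmem
            obtain ⟨k, hk, hk'⟩ := List.getElem_of_mem hmem
            rw [List.getElem_take] at hk'
            have := (List.Nodup.getElem_inj_iff hnd).1 hk'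
            simp at hk
            omega
          have hx' : (bs s.words s.scalar)[t] * P.B + x % P.B = x := by rw [← h1, hx]
          simp only [h1, hx', if_true, hnd, false_or, if_false, scatter, ht, true_and]
          split_ifs <;> rfl
        · simp only [h1, if_false, Option.some.injEq, Ne.symm h1, or_false]
      · rw [List.getElem?_eq_none (by omega)]
        simp only [ht, false_and, dite_false, Op.newCell, ite_self, reduceCtorEq, or_false]
    ext : 1
    any_goals rfl
    · funext x
      exact hstep x

/-- Replacing lane words and scalar by computed ones and rearranging the lane colours. -/
def compute (f : LaneWords P → ℕ → LaneWords P) (g : LaneWords P → ℕ → ℕ)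
    (col : LaneWords P → ℕ → Fin P.lanes → Fin P.lanes) (s : LaneState P) : LaneState P :=
  { words := f s.words s.scalar
    scalar := g s.words s.scalar
    colours := fun j => s.colours (col s.words s.scalar j)
    disk := s.disk }

/-- Internal computation rides on an idle read of block `0`. -/
theorem exists_compute (f : LaneWords P → ℕ → LaneWords P) (g : LaneWords P → ℕ → ℕ)
    (col : LaneWords P → ℕ → Fin P.lanes → Fin P.lanes) :
    ∃ p : List (Op P), p.length = 1 ∧ ∀ (U : ℕ) (Z : ℕ → Prop) (s : LaneState P), s.Bdd U →
      Z s.scalar → Z (g s.words s.scalar) → g s.words s.scalar < U →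
      (∀ j, (f s.words s.scalar j).1 < U ∧ (f s.words s.scalar j).2.1 < U ∧
        (f s.words s.scalar j).2.2 < U) →
      Run U Z p s (compute f g col s) := by
  refine ⟨[.read (fun _ _ => 0) (fun w z _ => (f w z, g w z)) (fun w z j => .inl (col w z j))], rfl,
    fun U Z s hs hZ hZ' hg hf => ?_⟩
  exact Run.single hs hZ ((Nat.zero_le _).trans_lt hs.scalar)
    ⟨hf, hg, fun j n => hs.colours _ n, hs.disk⟩ hZ'

end Lanes

/-! ### First-in-first-out colourings of interval graphs -/

namespace IntervalRep

variable {V : ℕ} (S : IntervalRep V)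

/-- The right endpoint of rank `i` precedes the left endpoint of rank `i + c`, for all `i`. -/
def Fits (c : ℕ) : Prop := ∀ i j : Fin V, (j : ℕ) = i + c → S.right i < S.left j

/-- The interval taking over the colour of interval `i`, if this is less than `V`. -/
def next (c i : ℕ) : ℕ := if h : i < V then S.partner ⟨i, h⟩ + c else 0

/-- The interval whose colour is taken over by interval `i`. -/
def prev (c i : ℕ) : ℕ := if h : i - c < V then S.partner.symm ⟨i - c, h⟩ else i

/-- The colouring in which every colour set free is reused after all colours set free earlier. -/
def fifo (c i : ℕ) : ℕ := if h : c ≤ i ∧ S.prev c i < i then fifo c (S.prev c i) else i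
termination_by i
decreasing_by exact h.2

variable {S} {c : ℕ}

lemma next_eq {i : ℕ} (h : i < V) : S.next c i = S.partner ⟨i, h⟩ + c := by simp [next, h]

lemma le_next {i : ℕ} (h : i < V) : c ≤ S.next c i := by simp [next, h]

lemma next_lt_add {i : ℕ} (h : i < V) : S.next c i < V + c := by
  rw [next_eq h]
  have := (S.partner ⟨i, h⟩).2
  omega

lemma next_inj {i j : ℕ} (hi : i < V) (hj : j < V) (h : S.next c i = S.next c j) : i = j := by
  rw [next_eq hi, next_eq hj, Nat.add_right_cancel_iff, Fin.val_inj, S.partner.injective.eq_iff,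
    Fin.mk.injEq] at h
  exact h

/-- Otherwise interval `i` would begin no earlier than its successor, which begins after interval
`i` has ended. All messages therefore go forward. -/
lemma Fits.lt_next (h : S.Fits c) {i : ℕ} (hi : i < V) : i < S.next c i := by
  rw [next_eq hi]
  by_contra! hle
  have hj : (S.partner ⟨i, hi⟩ : ℕ) + c < V := by omega
  have h1 := h (S.partner ⟨i, hi⟩) ⟨_, hj⟩ rfl
  have h2 : S.left ⟨_, hj⟩ ≤ S.left ⟨i, hi⟩ := S.left_strictMono.monotone hle
  have h3 := S.left_lt ⟨i, hi⟩
  omega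

lemma prev_lt_card {i : ℕ} (h : i < V) : S.prev c i < V := by
  have h' : i - c < V := by omega
  simp [prev, h']

lemma next_prev {i : ℕ} (h : i < V) (hc : c ≤ i) : S.next c (S.prev c i) = i := by
  rw [next_eq (prev_lt_card h)]
  have h' : i - c < V := by omega
  simp [prev, h', hc]

lemma Fits.prev_lt (hS : S.Fits c) {i : ℕ} (h : i < V) (hc : c ≤ i) : S.prev c i < i := by
  have := hS.lt_next (prev_lt_card (S := S) (c := c) h)
  rwa [next_prev h hc] at this

lemma fifo_of_lt {i : ℕ} (h : i < c) : S.fifo c i = i := by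
  rw [fifo, dif_neg (by omega)]

lemma Fits.fifo_prev (hS : S.Fits c) {i : ℕ} (h : i < V) (hc : c ≤ i) :
    S.fifo c i = S.fifo c (S.prev c i) := by
  rw [fifo, dif_pos ⟨hc, hS.prev_lt h hc⟩]

lemma Fits.fifo_next (hS : S.Fits c) {i : ℕ} (h : i < V) (h' : S.next c i < V) :
    S.fifo c (S.next c i) = S.fifo c i := by
  rw [hS.fifo_prev h' (le_next h)]
  congr 1
  exact next_inj (prev_lt_card h') h (next_prev h' (le_next h))

lemma Fits.fifo_lt (hS : S.Fits c) {i : ℕ} (h : i < V) : S.fifo c i < c := by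
  induction i using Nat.strong_induction_on with
  | _ i ih =>
    by_cases hc : c ≤ i
    · rw [hS.fifo_prev h hc]
      exact ih _ (hS.prev_lt h hc) (prev_lt_card h)
    · rw [fifo_of_lt (by omega)]
      omega

/-- Invariant of the queue: after `t` intervals have begun, those whose colour has not been taken
over yet have distinct colours. When interval `t` begins, it takes the colour of `prev c t`, which
leaves the set at this very moment; if `t < c`, it takes the unused colour `t`. -/
lemma Fits.fifo_ne (hS : S.Fits c) {t : ℕ} (ht : t ≤ V) {i k : ℕ} (hik : i < k) (hk : k < t)
    (hi : t ≤ S.next c i) (hk' : t ≤ S.next c k) : S.fifo c i ≠ S.fifo c k := by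
  induction t generalizing i k with
  | zero => omega
  | succ t ih =>
    have key : ∀ i' < t, t + 1 ≤ S.next c i' → S.fifo c i' ≠ S.fifo c t := by
      intro i' hi' hn
      by_cases hc : c ≤ t
      · rw [hS.fifo_prev (by omega) hc]
        have h1 := hS.prev_lt (i := t) (by omega) hc
        have h2 := next_prev (S := S) (i := t) (by omega) hc
        have hne : i' ≠ S.prev c t := by
          rintro rfl
          omega
        rcases lt_or_gt_of_ne hne with h | h
        · exact ih (by omega) h h1 (by omega) (by omega)
        · exact (ih (by omega) h hi' (by omega) (by omega)).symm
      · rw [fifo_of_lt (by omega), fifo_of_lt (by omega)]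
        omega
    rcases Nat.lt_succ_iff_lt_or_eq.1 hk with h | rfl
    · exact ih (by omega) hik h (by omega) (by omega)
    · exact key i hik hi

/-- Messages that cross a position carry distinct colours. This bounds what one node of the highest
level has to hand on to the next. -/
lemma Fits.card_crossing_le (hS : S.Fits c) {t : ℕ} (A : Finset ℕ)
    (hA : ∀ i ∈ A, i < V ∧ i < t ∧ t ≤ S.next c i) (ht : t ≤ V) : A.card ≤ c := by
  rw [← Finset.card_range c]
  refine Finset.card_le_card_of_injOn (S.fifo c) (fun i hi => ?_) ?_
  · simpa using hS.fifo_lt (hA i hi).1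
  · intro i hi k hk h
    by_contra hne
    rcases lt_or_gt_of_ne hne with h' | h'
    · exact hS.fifo_ne ht h' (hA k hk).2.1 (hA i hi).2.2 (hA k hk).2.2 h
    · exact hS.fifo_ne ht h' (hA i hi).2.1 (hA k hk).2.2 (hA i hi).2.2 h.symm

lemma adj_iff_of_lt {i k : Fin V} (h : i < k) :
    S.graph.Adj i k ↔ S.left k < S.right (S.partner i) := by
  have h1 := S.left_strictMono h
  have h2 := S.left_lt k
  constructor
  · rintro ⟨_, x, hx, hx'⟩
    have h3 := S.left_ne_right k (S.partner i)
    exact lt_of_le_of_ne (hx'.1.trans hx.2) h3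
  · intro h3
    exact ⟨h.ne, S.left k, ⟨h1.le, h3.le⟩, ⟨le_rfl, h2.le⟩⟩

lemma Fits.fifo_ne_of_adj (hS : S.Fits c) {i k : Fin V} (h : S.graph.Adj i k) :
    S.fifo c i ≠ S.fifo c k := by
  have key : ∀ {i k : Fin V}, i < k → S.graph.Adj i k → S.fifo c i ≠ S.fifo c k := by
    intro i k hik h
    rw [adj_iff_of_lt hik] at h
    refine hS.fifo_ne (t := k + 1) (by omega) hik (by omega) ?_ (hS.lt_next k.2)
    by_contra! hlt
    rw [next_eq i.2] at hlt
    have h1 := hS (S.partner i) ⟨S.partner i + c, by have := k.2; simp only [Fin.eta] at hlt; omega⟩ rfl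
    have h2 : S.left ⟨S.partner i + c, by have := k.2; simp only [Fin.eta] at hlt; omega⟩ ≤ S.left k :=
      S.left_strictMono.monotone (by rw [Fin.le_def]; simp only [Fin.eta] at hlt ⊢; omega)
    omega
  rcases lt_or_gt_of_ne h.ne with h' | h'
  · exact key h' h
  · exact (key h' h.symm).symm

/-- The first-in-first-out colouring with `c` colours. -/
def Fits.coloring (hS : S.Fits c) : S.graph.Coloring ℕ :=
  SimpleGraph.Coloring.mk (fun i => S.fifo c i) fun h => hS.fifo_ne_of_adj h

/-- All these intervals contain the left endpoint of rank `j`. -/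
lemma isClique_of_lt {i j : Fin V} (h : S.left j < S.right i) :
    S.graph.IsClique {k | k ≤ j ∧ i ≤ S.partner k} := by
  have key : ∀ {k l : Fin V}, k < l → l ≤ j → i ≤ S.partner k → S.graph.Adj k l := by
    intro k l hkl hl hk
    rw [adj_iff_of_lt hkl]
    exact (S.left_strictMono.monotone hl).trans_lt (h.trans_le (S.right_strictMono.monotone hk))
  intro k hk l hl hne
  rcases lt_or_gt_of_ne hne with h' | h'
  · exact key h' hl.1 hk.2
  · exact (key h' hk.1 hl.2).symm

/-- Of the first `j + 1` intervals only `i` can have a right endpoint of rank below `i`. -/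
lemma card_clique_ge {i j : Fin V} (h : (j : ℕ) + 1 = i + c) :
    c ≤ (Finset.univ.filter fun k => k ≤ j ∧ i ≤ S.partner k).card := by
  have h1 : (Finset.Iic j).card ≤ (Finset.univ.filter fun k => k ≤ j ∧ i ≤ S.partner k).card +
      (Finset.Iio i).card := by
    rw [← Finset.card_map S.partner.symm.toEmbedding (s := Finset.Iio i)]
    refine (Finset.card_le_card fun k hk => ?_).trans (Finset.card_union_le _ _)
    simp only [Finset.mem_Iic] at hk
    by_cases hk' : i ≤ S.partner k
    · simp [hk, hk']
    · refine Finset.mem_union_right _ (Finset.mem_map.2 ⟨S.partner k, by simpa using hk', by simp⟩)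
  rw [Fin.card_Iic, Fin.card_Iio] at h1
  omega

/-- Optimality certificate: the queue gives a colouring with `c` colours, the pair `i`, `j` a clique
of `c` intervals. -/
theorem Fits.chromaticNumber_eq (hS : S.Fits c) {i j : Fin V} (hij : (j : ℕ) + 1 = i + c)
    (h : S.left j < S.right i) :
    S.graph.chromaticNumber = c ∧ S.graph.cliqueNum = c := by
  have h1 : S.graph.Colorable c :=
    ⟨SimpleGraph.Coloring.mk (fun i => (⟨S.fifo c i, hS.fifo_lt i.2⟩ : Fin c)) fun h h' =>
      hS.fifo_ne_of_adj h (by simpa using h')⟩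
  have h2 : S.graph.IsClique ↑(Finset.univ.filter fun k => k ≤ j ∧ i ≤ S.partner k) := by
    simpa using isClique_of_lt h
  have h3 := card_clique_ge (S := S) hij
  have h4 : S.graph.chromaticNumber ≤ c := h1.chromaticNumber_le
  have h5 := h2.card_le_cliqueNum
  have h6 := S.graph.cliqueNum_le_chromaticNumber
  have h7 : (c : ℕ∞) ≤ S.graph.cliqueNum := by exact_mod_cast h3.trans h5
  exact ⟨le_antisymm h4 (h7.trans h6), le_antisymm (by exact_mod_cast h6.trans h4) (h3.trans h5)⟩

lemma Fits.ncard_range_coloring (hS : S.Fits c) (hc : c ≤ V) :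
    (Set.range hS.coloring).ncard = c := by
  have : Set.range hS.coloring = ↑(Finset.range c) := by
    ext x
    simp only [Set.mem_range, Finset.coe_range, Set.mem_Iio]
    constructor
    · rintro ⟨i, rfl⟩
      exact hS.fifo_lt i.2
    · intro hx
      exact ⟨⟨x, by omega⟩, fifo_of_lt hx⟩
  rw [this, Set.ncard_coe_finset, Finset.card_range]

end IntervalRep

/-! ### Programs with pre- and postconditions -/

section Achieves

variable {P : EMParams} {X Y : Type} {U : X → ℕ} {Z : X → ℕ → Prop}
  {Pre Mid Post : X → LaneState P → Prop} {T T' : ℕ}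

/-- Some list of at most `T` operations leads from the precondition to the postcondition, for all
values of the ghost variable `x`. -/
def Achieves (T : ℕ) (U : X → ℕ) (Z : X → ℕ → Prop) (Pre Post : X → LaneState P → Prop) : Prop :=
  ∃ p : List (Op P), p.length ≤ T ∧ ∀ x s, Pre x s → ∃ s', Run (U x) (Z x) p s s' ∧ Post x s'

lemma Achieves.trans (h : Achieves T U Z Pre Mid) (h' : Achieves T' U Z Mid Post) :
    Achieves (T + T') U Z Pre Post := by
  obtain ⟨p, hp, H⟩ := h
  obtain ⟨p', hp', H'⟩ := h'
  refine ⟨p ++ p', by rw [List.length_append]; omega, fun x s hs => ?_⟩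
  obtain ⟨s', hs', hm⟩ := H x s hs
  obtain ⟨s'', hs'', hm'⟩ := H' x s' hm
  exact ⟨s'', hs'.append hs'', hm'⟩

lemma Achieves.mono (h : Achieves T U Z Pre Post) (hT : T ≤ T') : Achieves T' U Z Pre Post := by
  obtain ⟨p, hp, H⟩ := h
  exact ⟨p, hp.trans hT, H⟩

/-- The program is the same for all ghost values, so a ghost may be chosen after looking at the
start state. In this way existential data of an invariant, such as the order of a list or the
content of the disk, become fixed parameters. -/
lemma Achieves.conseq {U' : Y → ℕ} {Z' : Y → ℕ → Prop} {Pre' Post' : Y → LaneState P → Prop}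
    (h : Achieves T U Z Pre Post)
    (h' : ∀ y s, Pre' y s → ∃ x, U x = U' y ∧ Z x = Z' y ∧ Pre x s ∧ ∀ s', Post x s' → Post' y s') :
    Achieves T U' Z' Pre' Post' := by
  obtain ⟨p, hp, H⟩ := h
  refine ⟨p, hp, fun y s hs => ?_⟩
  obtain ⟨x, hU, hZ, hpre, hpost⟩ := h' y s hs
  obtain ⟨s', hr, hs'⟩ := H x s hpre
  exact ⟨s', hU ▸ hZ ▸ hr, hpost s' hs'⟩

lemma Achieves.skip (h : ∀ x s, Pre x s → s.Bdd (U x) ∧ Z x s.scalar ∧ Post x s) :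
    Achieves 0 U Z Pre Post :=
  ⟨[], le_rfl, fun x s hs => ⟨s, .nil (h x s hs).1 (h x s hs).2.1, (h x s hs).2.2⟩⟩

lemma Achieves.loop (I : ℕ → X → LaneState P → Prop) (c : ℕ → ℕ) (Q : ℕ)
    (hI : ∀ x s, I 0 x s → s.Bdd (U x) ∧ Z x s.scalar)
    (h : ∀ q, q < Q → Achieves (c q) U Z (I q) (I (q + 1))) :
    Achieves (∑ q ∈ Finset.range Q, c q) U Z (I 0) (I Q) := by
  induction Q with
  | zero => exact Achieves.skip fun x s hs => ⟨(hI x s hs).1, (hI x s hs).2, hs⟩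
  | succ Q ih =>
    rw [Finset.sum_range_succ]
    exact (ih fun q hq => h q (by omega)).trans (h Q (by omega))

lemma Achieves.gatherWords (T : ℕ)
    (addr : (Fin P.lanes → ℕ × ℕ) → ℕ → Fin P.lanes → Option ℕ)
    (h : ∀ x s, Pre x s → s.Bdd (U x) ∧ Z x s.scalar ∧
      (laneBlocks (addr (outerWords s.words) s.scalar)).card ≤ T ∧
      (∀ j a, addr (outerWords s.words) s.scalar j = some a → a < U x) ∧
      Post x (gatherWords (addr (outerWords s.words) s.scalar) s)) : Achieves T U Z Pre Post := by
  obtain ⟨p, hp, H⟩ := exists_gatherWords T addr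
  refine ⟨p, hp.le, fun x s hs => ?_⟩
  obtain ⟨h1, h2, h3, h4, h5⟩ := h x s hs
  exact ⟨_, H (U x) (Z x) s h1 h2 h3 h4, h5⟩

lemma Achieves.gatherColours (T : ℕ) (addr : LaneWords P → ℕ → Fin P.lanes → Option ℕ)
    (h : ∀ x s, Pre x s → s.Bdd (U x) ∧ Z x s.scalar ∧
      (laneBlocks (addr s.words s.scalar)).card ≤ T ∧
      (∀ j a, addr s.words s.scalar j = some a → a < U x) ∧
      Post x (gatherColours (addr s.words s.scalar) s)) : Achieves T U Z Pre Post := by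
  obtain ⟨p, hp, H⟩ := exists_gatherColours T addr
  refine ⟨p, hp.le, fun x s hs => ?_⟩
  obtain ⟨h1, h2, h3, h4, h5⟩ := h x s hs
  exact ⟨_, H (U x) (Z x) s h1 h2 h3 h4, h5⟩

lemma Achieves.scatter (T : ℕ) (addr : LaneWords P → ℕ → Fin P.lanes → Option ℕ)
    (val : LaneWords P → ℕ → Fin P.lanes → ℕ ⊕ Fin P.lanes)
    (h : ∀ x s, Pre x s → s.Bdd (U x) ∧ Z x s.scalar ∧
      (laneBlocks (addr s.words s.scalar)).card ≤ T ∧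
      (∀ j a, addr s.words s.scalar j = some a → a < U x) ∧
      (∀ j a n, addr s.words s.scalar j = some a → val s.words s.scalar j = .inl n → n < U x) ∧
      Post x (scatter (addr s.words s.scalar) (val s.words s.scalar) s)) :
    Achieves T U Z Pre Post := by
  obtain ⟨p, hp, H⟩ := exists_scatter T addr val
  refine ⟨p, hp.le, fun x s hs => ?_⟩
  obtain ⟨h1, h2, h3, h4, h5, h6⟩ := h x s hs
  exact ⟨_, H (U x) (Z x) s h1 h2 h3 h4 h5, h6⟩

lemma Achieves.compute (f : LaneWords P → ℕ → LaneWords P) (g : LaneWords P → ℕ → ℕ)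
    (col : LaneWords P → ℕ → Fin P.lanes → Fin P.lanes)
    (h : ∀ x s, Pre x s → s.Bdd (U x) ∧ Z x s.scalar ∧ Z x (g s.words s.scalar) ∧
      g s.words s.scalar < U x ∧
      (∀ j, (f s.words s.scalar j).1 < U x ∧ (f s.words s.scalar j).2.1 < U x ∧
        (f s.words s.scalar j).2.2 < U x) ∧
      Post x (compute f g col s)) : Achieves 1 U Z Pre Post := by
  obtain ⟨p, hp, H⟩ := exists_compute f g col
  refine ⟨p, hp.le, fun x s hs => ?_⟩
  obtain ⟨h1, h2, h3, h4, h5, h6⟩ := h x s hs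
  exact ⟨_, H (U x) (Z x) s h1 h2 h3 h4 h5, h6⟩

/-- A range of `k` cells need not be aligned with the blocks; the summand `2` pays for its two ends.
-/
lemma card_laneBlocks_le {a : Fin P.lanes → Option ℕ} {b k : ℕ}
    (h : ∀ j x, a j = some x → b ≤ x ∧ x < b + k) : (laneBlocks a).card ≤ k / P.B + 2 := by
  have hB := P.B_pos
  have hsub : laneBlocks a ⊆ Finset.Icc (b / P.B) (b / P.B + (k / P.B + 1)) := by
    intro y hy
    obtain ⟨j, x, hx, rfl⟩ := exists_of_mem_laneBlocks hy
    obtain ⟨h1, h2⟩ := h j x hx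
    rw [Finset.mem_Icc]
    refine ⟨Nat.div_le_div_right h1, Nat.lt_succ_iff.1 ((Nat.div_lt_iff_lt_mul hB).2 ?_)⟩
    have h3 := Nat.div_add_mod b P.B
    have h4 := Nat.mod_lt b hB
    have h5 := Nat.div_add_mod k P.B
    have h6 := Nat.mod_lt k hB
    simp only [Nat.succ_eq_add_one]
    nlinarith
  refine (Finset.card_le_card hsub).trans ?_
  rw [Nat.card_Icc]
  generalize b / P.B = u
  generalize k / P.B = v
  omega

lemma laneBlocks_subset_singleton {a : Fin P.lanes → Option ℕ} {b : ℕ}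
    (h : ∀ j x, a j = some x → x = b) : (laneBlocks a).card ≤ 1 := by
  refine (Finset.card_le_card (t := {b / P.B}) fun y hy => ?_).trans (by simp)
  obtain ⟨j, x, hx, rfl⟩ := exists_of_mem_laneBlocks hy
  rw [h j x hx, Finset.mem_singleton]

lemma gatherWords_bdd {s : LaneState P} {a : Fin P.lanes → Option ℕ} {U : ℕ} (hs : s.Bdd U) :
    (_root_.gatherWords a s).Bdd U := by
  refine ⟨fun j => ⟨(hs.words j).1, ?_, (hs.words j).2.2⟩, hs.scalar, hs.colours, hs.disk⟩
  simp only [_root_.gatherWords]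
  cases a j with
  | none => exact (hs.words j).2.1
  | some x => exact Cell.toNat_lt ((Nat.zero_le _).trans_lt hs.scalar) (hs.disk x)

lemma gatherColours_bdd {s : LaneState P} {a : Fin P.lanes → Option ℕ} {U : ℕ} (hs : s.Bdd U) :
    (_root_.gatherColours a s).Bdd U := by
  refine ⟨hs.words, hs.scalar, fun j n => ?_, hs.disk⟩
  simp only [_root_.gatherColours]
  cases a j with
  | none => exact hs.colours j n
  | some x => exact hs.disk x n

lemma scatter_bdd {s : LaneState P} {a : Fin P.lanes → Option ℕ} {U : ℕ}
    {v : Fin P.lanes → ℕ ⊕ Fin P.lanes} (hs : s.Bdd U)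
    (hv : ∀ j x n, a j = some x → v j = .inl n → n < U) : (_root_.scatter a v s).Bdd U := by
  classical
  refine ⟨hs.words, hs.scalar, hs.colours, fun x n => ?_⟩
  simp only [_root_.scatter]
  split_ifs with h
  · cases h' : v h.choose with
    | inl m =>
      intro hm
      simp only [Op.newCell, Cell.word.injEq] at hm
      exact hm ▸ hv _ x m h.choose_spec h'
    | inr j => exact hs.colours j n
  · exact hs.disk x n

end Achieves

/-! ### Scanning for the chromatic number -/

/-- The number of entries of `r` passed when `r` is compared with `k` successive entries of `l`. -/
def scan (l r : ℕ → ℕ) : ℕ → ℕ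
  | 0 => 0
  | p + 1 => if r (scan l r p) < l p then scan l r p + 1 else scan l r p

lemma scan_le (l r : ℕ → ℕ) (p : ℕ) : scan l r p ≤ p := by
  induction p with
  | zero => rfl
  | succ p ih =>
    rw [scan]
    split_ifs <;> omega

/-- This cuts a scan into memory loads. By `scan_le`, `k` further left endpoints call for no more
than `k` further right endpoints. -/
lemma scan_add (l r : ℕ → ℕ) (p k : ℕ) : scan l r (p + k) = scan l r p +
    scan (fun j => l (p + j)) (fun j => r (scan l r p + j)) k := by
  induction k with
  | zero => rfl
  | succ k ih =>
    rw [← add_assoc, scan, ih, scan]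
    split_ifs <;> omega

lemma scan_congr {l r l' r' : ℕ → ℕ} {k : ℕ} (hl : ∀ j < k, l j = l' j) (hr : ∀ j < k, r j = r' j) :
    scan l r k = scan l' r' k := by
  induction k with
  | zero => rfl
  | succ k ih =>
    have h := ih (fun j hj => hl j (by omega)) (fun j hj => hr j (by omega))
    have h' := scan_le l' r' k
    rw [scan, scan, h, hl k (by omega), hr _ (by omega)]

namespace IntervalRep

variable {V : ℕ} (S : IntervalRep V)

/-- The left endpoints as a function on `ℕ`. -/
def leftAt (i : ℕ) : ℕ := if h : i < V then S.left ⟨i, h⟩ else 0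

/-- The right endpoints as a function on `ℕ`. -/
def rightAt (i : ℕ) : ℕ := if h : i < V then S.right ⟨i, h⟩ else 0

/-- The lag `p - scan p` is the number of colours needed so far. A new left endpoint either lies
behind the next right endpoint, and both pointers advance, or before it, and then the lag grows by
one and this pair is the new witness for a clique. -/
lemma scan_invariant {p : ℕ} (hp : p ≤ V) :
    (∀ i j : Fin V, (i : ℕ) < scan S.leftAt S.rightAt p →
      (j : ℕ) = i + (p - scan S.leftAt S.rightAt p) → S.right i < S.left j) ∧
    (p - scan S.leftAt S.rightAt p = 0 ∨ ∃ i j : Fin V,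
      (j : ℕ) + 1 = i + (p - scan S.leftAt S.rightAt p) ∧ S.left j < S.right i) := by
  induction p with
  | zero => simp [scan]
  | succ p ih =>
    obtain ⟨ih1, ih2⟩ := ih (by omega)
    have hle := scan_le S.leftAt S.rightAt p
    rw [scan]
    set i₀ := scan S.leftAt S.rightAt p with hi₀
    have hi₀V : i₀ < V := by omega
    simp only [leftAt, rightAt, hi₀V, dif_pos, show p < V by omega]
    split_ifs with h
    · rw [Nat.add_sub_add_right]
      refine ⟨fun i j hi hj => ?_, ih2⟩
      rcases Nat.lt_succ_iff_lt_or_eq.1 hi with h1 | h1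
      · exact ih1 i j h1 hj
      · rw [show i = ⟨i₀, hi₀V⟩ from Fin.ext h1, show j = ⟨p, by omega⟩ from Fin.ext (by
          simp only; omega)]
        exact h
    · refine ⟨fun i j hi hj => ?_, .inr ⟨⟨i₀, hi₀V⟩, ⟨p, by omega⟩, by simp only; omega, ?_⟩⟩
      · have h1 := ih1 i ⟨i + (p - i₀), by have := j.2; omega⟩ hi rfl
        exact h1.trans (S.left_strictMono (by rw [Fin.lt_def]; simp only; omega))
      · have := S.left_ne_right ⟨p, by omega⟩ ⟨i₀, hi₀V⟩
        omega

/-- The number of colours needed, as found by a scan. -/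
def need : ℕ := V - scan S.leftAt S.rightAt V

lemma need_le : S.need ≤ V := Nat.sub_le _ _

lemma fits_need : S.Fits S.need := by
  intro i j hij
  have h := (S.scan_invariant le_rfl).1 i j
  refine h ?_ hij
  have h1 := j.2
  have h2 := scan_le S.leftAt S.rightAt V
  unfold need at hij
  omega

lemma need_spec (hV : 0 < V) : S.graph.chromaticNumber = S.need ∧ S.graph.cliqueNum = S.need := by
  rcases (S.scan_invariant le_rfl).2 with h | ⟨i, j, hij, h⟩
  -- Without colours the last interval would have to pass its colour to a later interval of rank
  -- below `V`.
  · exfalso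
    have h0 : S.need = 0 := h
    have hf := S.fits_need.lt_next (i := V - 1) (by omega)
    have := next_lt_add (S := S) (c := S.need) (i := V - 1) (by omega)
    omega
  · exact S.fits_need.chromaticNumber_eq hij h

end IntervalRep

/-! ### The scan as a program for the lanes. -/

section ScanProgram

variable {P : EMParams} {V : ℕ}

/-- The disk begins with the two sorted arrays of endpoints. -/
def HoldsEndpoints (S : IntervalRep V) (D : ℕ → Cell) : Prop :=
  (∀ i < V, D i = .word (S.leftAt i)) ∧ ∀ i < V, D (V + i) = .word (S.rightAt i)

/-- The number of lanes used for `V` intervals. -/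
def leafSize (P : EMParams) (V : ℕ) : ℕ := min P.lanes V

/-- The first `p` left endpoints have been scanned. -/
structure Scanned (D : ℕ → Cell) (S : IntervalRep V) (U p : ℕ) (s : LaneState P) : Prop where
  bdd : s.Bdd U
  scalar : s.scalar = scan S.leftAt S.rightAt p
  disk : s.disk = D

/-- One memory load: lane `j` receives the `j`-th of the next left and of the next right endpoints,
and the scalar, which counts the right endpoints passed, is advanced internally. The left endpoints
are moved aside first, since gathering always overwrites the second component. -/
lemma achieves_scan_round {X : Type} (S : X → IntervalRep V) (D : X → ℕ → Cell) (U : X → ℕ)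
    (hU : ∀ x, 2 * V < U x) (hD : ∀ x, HoldsEndpoints (S x) (D x)) (p k : ℕ) (hk : k ≤ P.lanes)
    (hp : p + k ≤ V) :
    Achieves (P := P) (2 * (k / P.B + 2) + 2) U (fun _ _ => True)
      (fun x => Scanned (D x) (S x) (U x) p) (fun x => Scanned (D x) (S x) (U x) (p + k)) := by
  let M₁ : X → LaneState P → Prop := fun x s => Scanned (D x) (S x) (U x) p s ∧
    ∀ j : Fin P.lanes, (j : ℕ) < k → (s.words j).2.1 = (S x).leftAt (p + j)
  let M₂ : X → LaneState P → Prop := fun x s => Scanned (D x) (S x) (U x) p s ∧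
    ∀ j : Fin P.lanes, (j : ℕ) < k → (s.words j).1 = (S x).leftAt (p + j)
  let M₃ : X → LaneState P → Prop := fun x s => M₂ x s ∧
    ∀ j : Fin P.lanes, (j : ℕ) < k → (s.words j).2.1 = (S x).rightAt (s.scalar + j)
  have h₁ : Achieves (k / P.B + 2) U (fun _ _ => True)
      (fun x => Scanned (D x) (S x) (U x) p) M₁ := by
    refine Achieves.gatherWords _ (fun _ _ j => if (j : ℕ) < k then some (p + j) else none) ?_
    intro x s hs
    refine ⟨hs.bdd, trivial, card_laneBlocks_le (b := p) ?_, ?_, ⟨gatherWords_bdd hs.bdd, hs.scalar,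
      hs.disk⟩, ?_⟩
    · intro j a ha
      split_ifs at ha with h
      cases ha
      omega
    · intro j a ha
      split_ifs at ha with h
      cases ha
      have := hU x
      omega
    · intro j hj
      simp [gatherWords, hj, hs.disk, (hD x).1 (p + j) (by omega), Cell.toNat]
  have h₂ : Achieves 1 U (fun _ _ => True) M₁ M₂ := by
    refine Achieves.compute (fun w _ j => ((w j).2.1, (w j).2.1, (w j).2.2)) (fun _ z => z)
      (fun _ _ j => j) ?_
    intro x s hs
    have hw := hs.1.bdd.words
    have hw' : ∀ j, (s.words j).2.1 < U x ∧ (s.words j).2.1 < U x ∧ (s.words j).2.2 < U x :=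
      fun j => ⟨(hw j).2.1, (hw j).2⟩
    exact ⟨hs.1.bdd, trivial, trivial, hs.1.bdd.scalar, hw',
      ⟨⟨hw', hs.1.bdd.scalar, hs.1.bdd.colours, hs.1.bdd.disk⟩, hs.1.scalar, hs.1.disk⟩, hs.2⟩
  have h₃ : Achieves (k / P.B + 2) U (fun _ _ => True) M₂ M₃ := by
    refine Achieves.gatherWords _ (fun _ z j => if (j : ℕ) < k ∧ z + j < V then some (V + z + j)
      else none) ?_
    intro x s hs
    have hz : s.scalar ≤ p := hs.1.scalar ▸ scan_le _ _ p
    refine ⟨hs.1.bdd, trivial, card_laneBlocks_le (b := V + s.scalar) ?_, ?_,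
      ⟨⟨gatherWords_bdd hs.1.bdd, hs.1.scalar, hs.1.disk⟩, hs.2⟩, ?_⟩
    · intro j a ha
      split_ifs at ha with h
      cases ha
      omega
    · intro j a ha
      split_ifs at ha with h
      cases ha
      have := hU x
      omega
    · intro j hj
      have h1 : s.scalar + j < V := by omega
      simp [gatherWords, hj, h1, hs.1.disk, add_assoc, (hD x).2 (s.scalar + j) h1, Cell.toNat]
  have h₄ : Achieves 1 U (fun _ _ => True) M₃ (fun x => Scanned (D x) (S x) (U x) (p + k)) := by
    refine Achieves.compute (fun w _ => w) (fun w z => z +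
      scan (fun j => if h : j < P.lanes then (w ⟨j, h⟩).1 else 0)
        (fun j => if h : j < P.lanes then (w ⟨j, h⟩).2.1 else 0) k) (fun _ _ j => j) ?_
    intro x s hs
    have hz : s.scalar + scan (fun j => if h : j < P.lanes then (s.words ⟨j, h⟩).1 else 0)
        (fun j => if h : j < P.lanes then (s.words ⟨j, h⟩).2.1 else 0) k =
        scan (S x).leftAt (S x).rightAt (p + k) := by
      rw [scan_add, ← hs.1.1.scalar]
      congr 1
      refine scan_congr (fun j hj => ?_) (fun j hj => ?_)
      · rw [dif_pos (by omega)]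
        exact hs.1.2 _ hj
      · rw [dif_pos (by omega)]
        exact hs.2 _ hj
    have hb : scan (S x).leftAt (S x).rightAt (p + k) < U x := by
      have := hU x
      have := scan_le (S x).leftAt (S x).rightAt (p + k)
      omega
    refine ⟨hs.1.1.bdd, trivial, trivial, hz ▸ hb, hs.1.1.bdd.words,
      ⟨hs.1.1.bdd.words, lt_of_eq_of_lt hz hb, hs.1.1.bdd.colours, hs.1.1.bdd.disk⟩, hz, hs.1.1.disk⟩
  exact (((h₁.trans h₂).trans h₃).trans h₄).mono (by omega)

/-- The number of leaves. -/
def leaves (P : EMParams) (V : ℕ) : ℕ := (V + leafSize P V - 1) / leafSize P V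

lemma leafSize_pos (hV : 0 < V) : 0 < leafSize P V := lt_min P.lanes_pos hV

lemma le_leaves_mul (hV : 0 < V) : V ≤ leaves P V * leafSize P V := by
  have h1 := leafSize_pos (P := P) hV
  have h2 := Nat.div_add_mod (V + leafSize P V - 1) (leafSize P V)
  have h3 := Nat.mod_lt (V + leafSize P V - 1) h1
  rw [mul_comm]
  unfold leaves
  omega

theorem achieves_need {X : Type} (hV : 0 < V) (S : X → IntervalRep V) (D : X → ℕ → Cell)
    (U : X → ℕ) (hU : ∀ x, 2 * V < U x) (hD : ∀ x, HoldsEndpoints (S x) (D x)) :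
    Achieves (P := P) (leaves P V * (2 * (leafSize P V / P.B + 2) + 2) + 1) U (fun _ _ => True)
      (fun x s => s.Bdd (U x) ∧ s.scalar = 0 ∧ s.disk = D x)
      (fun x s => s.Bdd (U x) ∧ s.scalar = (S x).need ∧ s.disk = D x) := by
  set n := leafSize P V with hn
  have hn0 : 0 < n := leafSize_pos hV
  have h₁ := Achieves.loop (P := P) (U := U) (Z := fun _ _ => True)
    (fun q x => Scanned (D x) (S x) (U x) (min V (q * n)))
    (fun _ => 2 * (n / P.B + 2) + 2) (leaves P V) (fun x s hs => ⟨hs.bdd, trivial⟩) (by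
      intro q _
      have hle : min V ((q + 1) * n) = min V (q * n) + (min V ((q + 1) * n) - min V (q * n)) := by
        have : q * n ≤ (q + 1) * n := Nat.mul_le_mul_right _ (by omega)
        omega
      have hk : min V ((q + 1) * n) - min V (q * n) ≤ n := by
        rw [add_mul, one_mul]
        omega
      rw [hle]
      refine (achieves_scan_round S D U hU hD _ _ (hk.trans (min_le_left _ _)) ?_).mono ?_
      · rw [← hle]
        exact min_le_left _ _
      · have := Nat.div_le_div_right (c := P.B) hk
        omega)
  have h₂ : Achieves (P := P) 1 U (fun _ _ => True)
      (fun x => Scanned (D x) (S x) (U x) (min V (leaves P V * n)))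
      (fun x s => s.Bdd (U x) ∧ s.scalar = (S x).need ∧ s.disk = D x) := by
    refine Achieves.compute (fun w _ => w) (fun _ z => V - z) (fun _ _ j => j) ?_
    intro x s hs
    have hb : V - s.scalar < U x := by
      have := hU x
      omega
    refine ⟨hs.bdd, trivial, trivial, hb, hs.bdd.words,
      ⟨hs.bdd.words, hb, hs.bdd.colours, hs.bdd.disk⟩, ?_, hs.disk⟩
    have h3 := hs.scalar
    rw [min_eq_left (le_leaves_mul hV)] at h3
    simp [compute, h3, IntervalRep.need]
  rw [Finset.sum_const, Finset.card_range, smul_eq_mul] at h₁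
  refine (h₁.trans h₂).conseq fun x s hs => ⟨x, rfl, rfl, ?_, fun s' h => h⟩
  exact ⟨hs.1, by simpa [scan] using hs.2.1, hs.2.2⟩

end ScanProgram

/-! ### Lists of messages on disk -/

section Lists

variable {P : EMParams} {V χ : ℕ}

/-- The capacity of the arrays into which the disk is divided. -/
def arrayCap (P : EMParams) (V : ℕ) : ℕ := P.B * (5 * V + 1)

/-- The cell holding the length of the list `ν`. -/
def countCell (P : EMParams) (V ν : ℕ) : ℕ := (3 * ν + 1) * arrayCap P V

/-- The cell holding the target of the message `e` of the list `ν`. -/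
def targetCell (P : EMParams) (V ν e : ℕ) : ℕ := (3 * ν + 2) * arrayCap P V + e

/-- The cell holding the colour of the message `e` of the list `ν`. -/
def colourCell (P : EMParams) (V ν e : ℕ) : ℕ := (3 * ν + 3) * arrayCap P V + e

lemma lt_arrayCap (P : EMParams) (V : ℕ) : 5 * V < arrayCap P V := by
  have := P.B_pos
  unfold arrayCap
  nlinarith

lemma countCell_div (ν : ℕ) : countCell P V ν / arrayCap P V = 3 * ν + 1 :=
  Nat.mul_div_cancel _ ((Nat.zero_le _).trans_lt (lt_arrayCap P V))

lemma targetCell_div (ν : ℕ) {e : ℕ} (h : e ≤ V) :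
    targetCell P V ν e / arrayCap P V = 3 * ν + 2 := by
  have := lt_arrayCap P V
  unfold targetCell
  rw [mul_comm, Nat.mul_add_div (by omega), Nat.div_eq_of_lt (by omega), add_zero]

lemma colourCell_div (ν : ℕ) {e : ℕ} (h : e ≤ V) :
    colourCell P V ν e / arrayCap P V = 3 * ν + 3 := by
  have := lt_arrayCap P V
  unfold colourCell
  rw [mul_comm, Nat.mul_add_div (by omega), Nat.div_eq_of_lt (by omega), add_zero]

lemma div_arrayCap_of_lt {x : ℕ} (h : x < 5 * V) : x / arrayCap P V = 0 :=
  Nat.div_eq_of_lt (h.trans (lt_arrayCap P V))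

lemma cells_lt {U ν e : ℕ} (hU : (3 * ν + 4) * arrayCap P V ≤ U) (h : e ≤ V) :
    countCell P V ν < U ∧ targetCell P V ν e < U ∧ colourCell P V ν e < U := by
  have := lt_arrayCap P V
  unfold countCell targetCell colourCell
  refine ⟨?_, ?_, ?_⟩ <;> nlinarith

/-- The list `ν` on disk is `l`: an entry `i` stands for the message which passes the colour of
interval `i` on to its successor. -/
structure ListAt (P : EMParams) (S : IntervalRep V) (χ : ℕ) (D : ℕ → Cell) (ν : ℕ)
    (l : List ℕ) : Prop where
  nodup : l.Nodup
  lt : ∀ i ∈ l, i < V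
  count : D (countCell P V ν) = .word l.length
  target : ∀ e (h : e < l.length), D (targetCell P V ν e) = .word (S.next χ l[e])
  colour : ∀ e (h : e < l.length), D (colourCell P V ν e) = .colour (S.fifo χ l[e])

lemma length_le_of_nodup {l : List ℕ} (h : l.Nodup) (h' : ∀ i ∈ l, i < V) : l.length ≤ V := by
  rw [← List.toFinset_card_of_nodup h, ← Finset.card_range V]
  exact Finset.card_le_card fun i hi => by simpa using h' i (by simpa using hi)

lemma ListAt.length_le {S : IntervalRep V} {D : ℕ → Cell} {ν : ℕ} {l : List ℕ}
    (h : ListAt P S χ D ν l) : l.length ≤ V := length_le_of_nodup h.nodup h.lt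

/-- The arrays of the list `ν`. -/
def listArrays (ν : ℕ) : Finset ℕ := {3 * ν + 1, 3 * ν + 2, 3 * ν + 3}

/-- Frame rule: a list depends only on its own three arrays. -/
lemma ListAt.congr {S : IntervalRep V} {D D' : ℕ → Cell} {ν : ℕ} {l : List ℕ}
    (h : ListAt P S χ D ν l) (h' : ∀ x, x / arrayCap P V ∈ listArrays ν → D' x = D x) :
    ListAt P S χ D' ν l := by
  have hl := h.length_le
  refine ⟨h.nodup, h.lt, ?_, fun e he => ?_, fun e he => ?_⟩
  · rw [h' _ (by simp [countCell_div, listArrays]), h.count]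
  · rw [h' _ (by simp [targetCell_div ν (he.le.trans hl), listArrays]), h.target e he]
  · rw [h' _ (by simp [colourCell_div ν (he.le.trans hl), listArrays]), h.colour e he]

/-- The input and the first `d` output cells. -/
structure HoldsColours (S : IntervalRep V) (χ d : ℕ) (D : ℕ → Cell) : Prop where
  partner : ∀ i < V, D (2 * V + i) = .word (S.next χ i - χ)
  palette : ∀ i < V, D (3 * V + i) = .colour i
  done : ∀ i < V, i < d → D (4 * V + i) = .colour (S.fifo χ i)

lemma HoldsColours.congr {S : IntervalRep V} {d : ℕ} {D D' : ℕ → Cell} (h : HoldsColours S χ d D)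
    (h' : ∀ x, x / arrayCap P V = 0 → D' x = D x) : HoldsColours S χ d D' := by
  refine ⟨fun i hi => ?_, fun i hi => ?_, fun i hi hd => ?_⟩
  · rw [h' _ (div_arrayCap_of_lt (by omega)), h.partner i hi]
  · rw [h' _ (div_arrayCap_of_lt (by omega)), h.palette i hi]
  · rw [h' _ (div_arrayCap_of_lt (by omega)), h.done i hi hd]

/-- The input, the first `d` output cells, and the lists `L`. -/
structure Store (P : EMParams) (S : IntervalRep V) (χ : ℕ) (L : ℕ → Finset ℕ) (d : ℕ)
    (D : ℕ → Cell) : Prop where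
  base : HoldsColours S χ d D
  lists : ∀ ν, ∃ l : List ℕ, l.toFinset = L ν ∧ ListAt P S χ D ν l

/-- The lane `j` carries the message of interval `i` if `src j = some i`, and no message to any of
the intervals if `src j = none`. -/
def Carries (S : IntervalRep V) (χ : ℕ) (src : Fin P.lanes → Option ℕ) (s : LaneState P) : Prop :=
  ∀ j, (∀ i, src j = some i → i < V ∧ (s.words j).1 = S.next χ i ∧
      s.colours j = .colour (S.fifo χ i)) ∧
    (src j = none → V ≤ (s.words j).1)

/-- An instance of the colouring problem, with a bound for the words. -/
structure Inst (P : EMParams) (V χ : ℕ) where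
  S : IntervalRep V
  fits : S.Fits χ
  U : ℕ
  le_U : 2 * arrayCap P V + χ + V ≤ U

/-- Programs which leave the number `χ` of colours in the scalar register. -/
abbrev Performs {Y : Type} (T : ℕ) (I : Y → Inst P V χ) (Pre Post : Y → LaneState P → Prop) :
    Prop := Achieves T (fun y => (I y).U) (fun _ z => z = χ) Pre Post

/-- Conditions kept by all these programs. -/
structure Good (U χ : ℕ) (s : LaneState P) : Prop where
  bdd : s.Bdd U
  scalar : s.scalar = χ

/-- A part of a list is loaded into the lanes. -/
theorem performs_load {Y : Type} (I : Y → Inst P V χ) (D : Y → ℕ → Cell) (l : Y → List ℕ)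
    (ν off k : ℕ) (hν : ∀ y, (3 * ν + 4) * arrayCap P V ≤ (I y).U)
    (hD : ∀ y, ListAt P (I y).S χ (D y) ν (l y)) :
    Performs (2 * (k / P.B + 2) + 3) I
      (fun y s => Good (I y).U χ s ∧ s.disk = D y)
      (fun y s => Good (I y).U χ s ∧ s.disk = D y ∧
        Carries (I y).S χ (fun j => if (j : ℕ) < k then (l y)[off + j]? else none) s) := by
  let M₁ : Y → LaneState P → Prop := fun y s => (Good (I y).U χ s ∧ s.disk = D y) ∧
    ∀ j, (s.words j).2.1 = (l y).length
  let M₂ : Y → LaneState P → Prop := fun y s => (Good (I y).U χ s ∧ s.disk = D y) ∧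
    ∀ j, (s.words j).2.2 = (l y).length
  let M₃ : Y → LaneState P → Prop := fun y s => M₂ y s ∧
    ∀ j : Fin P.lanes, (j : ℕ) < k → ∀ h : off + j < (l y).length,
      (s.words j).2.1 = (I y).S.next χ (l y)[off + j]
  let M₄ : Y → LaneState P → Prop := fun y s => M₂ y s ∧
    (∀ j : Fin P.lanes, (j : ℕ) < k → ∀ h : off + j < (l y).length,
      (s.words j).1 = (I y).S.next χ (l y)[off + j]) ∧
    (∀ j : Fin P.lanes, ¬ ((j : ℕ) < k ∧ off + j < (l y).length) → (s.words j).1 = V)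
  have hV : ∀ y, V < (I y).U := fun y => by
    have := (I y).le_U
    have := lt_arrayCap P V
    omega
  have h₁ : Performs 1 I (fun y s => Good (I y).U χ s ∧ s.disk = D y) M₁ := by
    refine Achieves.gatherWords _ (fun _ _ _ => some (countCell P V ν)) fun y s hs => ?_
    refine ⟨hs.1.bdd, hs.1.scalar, laneBlocks_subset_singleton (b := countCell P V ν) ?_, ?_,
      ⟨⟨⟨gatherWords_bdd hs.1.bdd, hs.1.scalar⟩, hs.2⟩, ?_⟩⟩
    · intro j x hx
      cases hx
      rfl
    · intro j x hx
      cases hx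
      exact (cells_lt (hν y) (Nat.zero_le _)).1
    · intro j
      simp [gatherWords, hs.2, (hD y).count, Cell.toNat]
  -- The length goes to the third component, which the next gathering leaves intact and may use for
  -- its addresses.
  have h₂ : Performs 1 I M₁ M₂ := by
    refine Achieves.compute (fun w _ j => ((w j).1, (w j).1, (w j).2.1)) (fun _ z => z)
      (fun _ _ j => j) fun y s hs => ?_
    have hw := hs.1.1.bdd.words
    have hw' : ∀ j, (s.words j).1 < (I y).U ∧ (s.words j).1 < (I y).U ∧ (s.words j).2.1 < (I y).U :=
      fun j => ⟨(hw j).1, (hw j).1, (hw j).2.1⟩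
    exact ⟨hs.1.1.bdd, hs.1.1.scalar, hs.1.1.scalar, hs.1.1.bdd.scalar, hw',
      ⟨⟨⟨hw', hs.1.1.bdd.scalar, hs.1.1.bdd.colours, hs.1.1.bdd.disk⟩, hs.1.1.scalar⟩, hs.1.2⟩,
        hs.2⟩
  have h₃ : Performs (k / P.B + 2) I M₂ M₃ := by
    refine Achieves.gatherWords _ (fun w _ j => if (j : ℕ) < k ∧ off + j < (w j).2 then
      some (targetCell P V ν (off + j)) else none) fun y s hs => ?_
    refine ⟨hs.1.1.bdd, hs.1.1.scalar, card_laneBlocks_le (b := targetCell P V ν off) ?_, ?_,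
      ⟨⟨⟨gatherWords_bdd hs.1.1.bdd, hs.1.1.scalar⟩, hs.1.2⟩, hs.2⟩, ?_⟩
    · intro j a ha
      split_ifs at ha with h
      cases ha
      unfold targetCell
      omega
    · intro j a ha
      split_ifs at ha with h
      cases ha
      refine (cells_lt (hν y) ?_).2.1
      have := (hD y).length_le
      have := h.2
      rw [hs.2] at this
      omega
    · intro j hj h
      simp [gatherWords, hj, hs.2, h, hs.1.2, (hD y).target _ h, Cell.toNat]
  -- The target `V` marks a lane without a message.
  have h₄ : Performs 1 I M₃ M₄ := by
    refine Achieves.compute (fun w _ j => (if (j : ℕ) < k ∧ off + j < (w j).2.2 then (w j).2.1 else V,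
      (w j).2.1, (w j).2.2)) (fun _ z => z) (fun _ _ j => j) fun y s hs => ?_
    have hg := hs.1.1.1
    have hw := hg.bdd.words
    have hw' : ∀ j : Fin P.lanes, (if (j : ℕ) < k ∧ off + j < (s.words j).2.2 then (s.words j).2.1
        else V) < (I y).U ∧ (s.words j).2.1 < (I y).U ∧ (s.words j).2.2 < (I y).U := by
      intro j
      refine ⟨?_, (hw j).2⟩
      split_ifs
      · exact (hw j).2.1
      · exact hV y
    refine ⟨hg.bdd, hg.scalar, hg.scalar, hg.bdd.scalar, hw',
      ⟨⟨⟨⟨hw', hg.bdd.scalar, hg.bdd.colours, hg.bdd.disk⟩, hg.scalar⟩, hs.1.1.2⟩, hs.1.2⟩, ?_, ?_⟩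
    · intro j hj h
      have h' : off + j < (s.words j).2.2 := by rw [hs.1.2]; exact h
      simp [compute, hj, h', hs.2 j hj h]
    · intro j h
      have h' : ¬ ((j : ℕ) < k ∧ off + j < (s.words j).2.2) := by rw [hs.1.2]; exact h
      simp only [compute, if_neg h']
  have h₅ : Performs (k / P.B + 2) I M₄ (fun y s => Good (I y).U χ s ∧ s.disk = D y ∧
        Carries (I y).S χ (fun j => if (j : ℕ) < k then (l y)[off + j]? else none) s) := by
    refine Achieves.gatherColours _ (fun w _ j => if (j : ℕ) < k ∧ off + j < (w j).2.2 then
      some (colourCell P V ν (off + j)) else none) fun y s hs => ?_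
    refine ⟨hs.1.1.1.bdd, hs.1.1.1.scalar, card_laneBlocks_le (b := colourCell P V ν off) ?_, ?_,
      ⟨gatherColours_bdd hs.1.1.1.bdd, hs.1.1.1.scalar⟩, hs.1.1.2, ?_⟩
    · intro j a ha
      split_ifs at ha with h
      cases ha
      unfold colourCell
      omega
    · intro j a ha
      split_ifs at ha with h
      cases ha
      refine (cells_lt (hν y) ?_).2.2
      have := (hD y).length_le
      have := h.2
      rw [hs.1.2] at this
      omega
    · intro j
      constructor
      · intro i hi
        beta_reduce at hi
        split_ifs at hi with hj
        obtain ⟨h, rfl⟩ := List.getElem?_eq_some_iff.1 hi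
        refine ⟨(hD y).lt _ (List.getElem_mem h), hs.2.1 j hj h, ?_⟩
        simp [gatherColours, hj, hs.1.2, h, hs.1.1.2, (hD y).colour _ h]
      · intro hj
        refine (hs.2.2 j fun h => ?_).ge
        beta_reduce at hj
        rw [if_pos h.1, List.getElem?_eq_none_iff] at hj
        omega
  exact ((((h₁.trans h₂).trans h₃).trans h₄).trans h₅).mono (by omega)

/-! ### Appending messages to lists -/

/-- The lanes whose messages go to the list `b`. -/
def lanesTo (V : ℕ) (β : ℕ → ℕ) (w : LaneWords P) (b : ℕ) : List (Fin P.lanes) :=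
  (List.finRange P.lanes).filter fun j => (w j).1 < V ∧ β (w j).1 = b

lemma mem_lanesTo {β : ℕ → ℕ} {w : LaneWords P} {b : ℕ} {j : Fin P.lanes} :
    j ∈ lanesTo V β w b ↔ (w j).1 < V ∧ β (w j).1 = b := by simp [lanesTo]

lemma nodup_lanesTo (β : ℕ → ℕ) (w : LaneWords P) (b : ℕ) : (lanesTo V β w b).Nodup :=
  (List.nodup_finRange _).filter _

/-- Messages to the same list go to consecutive cells. The total is therefore paid blockwise, with
two extra blocks per list; this is why a fan-out of about `M / B` is affordable. -/
lemma card_laneBlocks_le_sum {a : Fin P.lanes → Option ℕ} (bs : Finset ℕ) (f n : ℕ → ℕ)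
    (h : ∀ j x, a j = some x → ∃ b ∈ bs, f b ≤ x ∧ x < f b + n b) :
    (laneBlocks a).card ≤ (∑ b ∈ bs, n b) / P.B + 2 * bs.card := by
  classical
  let c : ℕ → Fin P.lanes → Option ℕ := fun b j => (a j).filter fun x => f b ≤ x ∧ x < f b + n b
  have hsub : laneBlocks a ⊆ bs.biUnion fun b => laneBlocks (c b) := by
    intro y hy
    obtain ⟨j, x, hx, rfl⟩ := exists_of_mem_laneBlocks hy
    obtain ⟨b, hb, hbx⟩ := h j x hx
    exact Finset.mem_biUnion.2 ⟨b, hb, mem_laneBlocks (j := j) (by simp [c, hx, hbx])⟩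
  have hsum : ∀ bs : Finset ℕ, ∑ b ∈ bs, (n b / P.B + 2) ≤ (∑ b ∈ bs, n b) / P.B + 2 * bs.card := by
    intro bs
    induction bs using Finset.induction_on with
    | empty => simp
    | insert b bs hb ih =>
      rw [Finset.sum_insert hb, Finset.sum_insert hb, Finset.card_insert_of_notMem hb]
      have := @Nat.div_add_div_le_add_div (n b) (∑ b ∈ bs, n b) P.B
      omega
  refine (Finset.card_le_card hsub).trans (Finset.card_biUnion_le.trans (le_trans ?_ (hsum bs)))
  refine Finset.sum_le_sum fun b _ => card_laneBlocks_le (b := f b) fun j x hx => ?_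
  simpa using (Option.filter_eq_some_iff.1 hx).2

lemma sum_length_lanesTo_le (β : ℕ → ℕ) (w : LaneWords P) (bs : Finset ℕ) (k : ℕ)
    (hk : ∀ j : Fin P.lanes, k ≤ j → V ≤ (w j).1) :
    ∑ b ∈ bs, (lanesTo V β w b).length ≤ k := by
  classical
  have h1 : ∀ b, (lanesTo V β w b).length =
      ((Finset.univ.filter fun j : Fin P.lanes => (j : ℕ) < k).filter
        fun j => (w j).1 < V ∧ β (w j).1 = b).card := by
    intro b
    rw [← List.toFinset_card_of_nodup (nodup_lanesTo β w b)]
    congr 1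
    ext j
    simp only [List.mem_toFinset, mem_lanesTo, Finset.mem_filter, Finset.mem_univ, true_and]
    constructor
    · intro h
      refine ⟨?_, h⟩
      by_contra hj
      have := hk j (by omega)
      omega
    · exact fun h => h.2
  simp only [h1]
  rw [← Finset.card_biUnion]
  · refine (Finset.card_le_card (t := Finset.univ.filter fun j : Fin P.lanes => (j : ℕ) < k) ?_).trans ?_
    · intro j hj
      simp only [Finset.mem_biUnion, Finset.mem_filter] at hj ⊢
      obtain ⟨_, _, h, _⟩ := hj
      exact h
    · rw [← Finset.card_range k]
      refine Finset.card_le_card_of_injOn (fun j : Fin P.lanes => (j : ℕ)) ?_ ?_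
      · intro j hj
        simpa using hj
      · exact Fin.val_injective.injOn
  · intro b _ b' _ hne
    rw [Function.onFun, Finset.disjoint_left]
    intro j hj hj'
    simp only [Finset.mem_filter] at hj hj'
    exact hne (hj.2.2.symm.trans hj'.2.2)

open Classical in
/-- The lists after messages have been sent by the map `β` from targets to lists. -/
noncomputable def appendLists (S : IntervalRep V) (χ : ℕ) (β : ℕ → ℕ) (A : Finset ℕ)
    (L : ℕ → Finset ℕ) : ℕ → Finset ℕ :=
  fun b => L b ∪ A.filter fun i => S.next χ i < V ∧ β (S.next χ i) = b

/-- The messages carried by the lanes. -/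
def carried (src : Fin P.lanes → Option ℕ) : Finset ℕ :=
  Finset.univ.biUnion fun j => (src j).toFinset

lemma mem_carried {src : Fin P.lanes → Option ℕ} {i : ℕ} :
    i ∈ carried src ↔ ∃ j, src j = some i := by
  simp [carried]

section Append

variable {S : IntervalRep V} {β : ℕ → ℕ} {src : Fin P.lanes → Option ℕ} {s : LaneState P}
  {L : ℕ → Finset ℕ}

lemma src_isSome_of_mem_lanesTo (hc : Carries S χ src s) {b : ℕ} {j : Fin P.lanes}
    (hj : j ∈ lanesTo V β s.words b) :
    ∃ i, src j = some i ∧ i < V ∧ (s.words j).1 = S.next χ i ∧ s.colours j = .colour (S.fifo χ i) := by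
  rw [mem_lanesTo] at hj
  cases h : src j with
  | none =>
    have := (hc j).2 h
    omega
  | some i => exact ⟨i, rfl, (hc j).1 i h⟩

/-- Lists are never emptied, so repetitions have to be excluded: a list of distinct intervals has at
most `V` entries and fits into its arrays. Messages with targets from `V` on are dropped, as their
colours are not needed again. -/
lemma appended_list (hc : Carries S χ src s) (hinj : ∀ j j' i, src j = some i → src j' = some i → j = j')
    (hL : ∀ i ∈ carried src, S.next χ i < V → i ∉ L (β (S.next χ i))) {b : ℕ} {l : List ℕ}
    (hl : l.toFinset = L b) (hnd : l.Nodup) (hlt : ∀ i ∈ l, i < V) :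
    (l ++ (lanesTo V β s.words b).map fun j => (src j).getD 0).Nodup ∧
    (∀ i ∈ l ++ (lanesTo V β s.words b).map fun j => (src j).getD 0, i < V) ∧
    (l ++ (lanesTo V β s.words b).map fun j => (src j).getD 0).toFinset =
      appendLists S χ β (carried src) L b := by
  classical
  have hmem : ∀ i, i ∈ ((lanesTo V β s.words b).map fun j => (src j).getD 0) ↔
      i ∈ carried src ∧ S.next χ i < V ∧ β (S.next χ i) = b := by
    intro i
    simp only [List.mem_map, mem_carried]
    constructor
    · rintro ⟨j, hj, rfl⟩
      obtain ⟨i, hi, _, hw, _⟩ := src_isSome_of_mem_lanesTo hc hj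
      rw [mem_lanesTo, hw] at hj
      simp only [hi, Option.getD_some]
      exact ⟨⟨j, hi⟩, hj⟩
    · rintro ⟨⟨j, hj⟩, h⟩
      refine ⟨j, ?_, by simp [hj]⟩
      rw [mem_lanesTo, ((hc j).1 i hj).2.1]
      exact h
  refine ⟨?_, ?_, ?_⟩
  · refine List.Nodup.append hnd ((nodup_lanesTo β s.words b).map_on ?_) ?_
    · intro j hj j' hj' h
      obtain ⟨i, hi, _⟩ := src_isSome_of_mem_lanesTo hc hj
      obtain ⟨i', hi', _⟩ := src_isSome_of_mem_lanesTo hc hj'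
      simp only [hi, hi', Option.getD_some] at h
      exact hinj j j' i hi (h ▸ hi')
    · intro i hi hi'
      obtain ⟨h1, h2, h3⟩ := (hmem i).1 hi'
      refine hL i h1 h2 ?_
      rw [h3, ← hl]
      simpa using hi
  · intro i hi
    rcases List.mem_append.1 hi with h | h
    · exact hlt i h
    · obtain ⟨h1, _⟩ := (hmem i).1 h
      obtain ⟨j, hj⟩ := mem_carried.1 h1
      exact ((hc j).1 i hj).1
  · ext i
    rw [List.mem_toFinset, List.mem_append, hmem, ← List.mem_toFinset, hl]
    simp [appendLists]

end Append

end Lists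

/-! ### Addresses of appended messages and the effect of writing them. -/

section Append

variable {P : EMParams} {V χ : ℕ} {S : IntervalRep V} {β : ℕ → ℕ} {src : Fin P.lanes → Option ℕ}
  {s : LaneState P} {L : ℕ → Finset ℕ} {d : ℕ} {D : ℕ → Cell} {bs : Finset ℕ}

lemma targetCell_inj {ν ν' e e' : ℕ} (he : e ≤ V) (he' : e' ≤ V)
    (h : targetCell P V ν e = targetCell P V ν' e') : ν = ν' ∧ e = e' := by
  have h1 := targetCell_div (P := P) ν he
  rw [h, targetCell_div ν' he'] at h1
  obtain rfl : ν = ν' := by omega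
  unfold targetCell at h
  omega

lemma colourCell_inj {ν ν' e e' : ℕ} (he : e ≤ V) (he' : e' ≤ V)
    (h : colourCell P V ν e = colourCell P V ν' e') : ν = ν' ∧ e = e' := by
  have h1 := colourCell_div (P := P) ν he
  rw [h, colourCell_div ν' he'] at h1
  obtain rfl : ν = ν' := by omega
  unfold colourCell at h
  omega

/-- The position of the message of lane `j` among those to its list. -/
def laneRank (V : ℕ) (β : ℕ → ℕ) (w : LaneWords P) (j : Fin P.lanes) : ℕ :=
  (w j).2.1 + (lanesTo V β w (β (w j).1)).idxOf j

/-- The cells to which targets are sent. -/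
def targetAddr (V : ℕ) (β : ℕ → ℕ) (w : LaneWords P) (j : Fin P.lanes) : Option ℕ :=
  if (w j).1 < V then some (targetCell P V (β (w j).1) (laneRank V β w j)) else none

/-- The cells to which colours are sent. -/
def colourAddr (V : ℕ) (β : ℕ → ℕ) (w : LaneWords P) (j : Fin P.lanes) : Option ℕ :=
  if (w j).1 < V then some (colourCell P V (β (w j).1) (laneRank V β w j)) else none

/-- The cells to which lengths are sent. -/
def countAddr (V : ℕ) (β : ℕ → ℕ) (w : LaneWords P) (j : Fin P.lanes) : Option ℕ :=
  if (w j).1 < V then some (countCell P V (β (w j).1)) else none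

/-- The new lengths. -/
def newCount (V : ℕ) (β : ℕ → ℕ) (w : LaneWords P) (j : Fin P.lanes) : ℕ :=
  (w j).2.1 + (lanesTo V β w (β (w j).1)).length

/-- The lanes know the lengths of the lists to which their messages go. -/
structure ReadyToAppend (S : IntervalRep V) (χ : ℕ) (β : ℕ → ℕ) (bs : Finset ℕ)
    (src : Fin P.lanes → Option ℕ) (L : ℕ → Finset ℕ) (d : ℕ) (D : ℕ → Cell) (s : LaneState P) :
    Prop where
  store : Store P S χ L d D
  disk : s.disk = D
  carries : Carries S χ src s
  inj : ∀ j j' i, src j = some i → src j' = some i → j = j'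
  fresh : ∀ i ∈ carried src, S.next χ i < V → i ∉ L (β (S.next χ i))
  mem : ∀ i ∈ carried src, S.next χ i < V → β (S.next χ i) ∈ bs
  count : ∀ j, (s.words j).1 < V → D (countCell P V (β (s.words j).1)) = .word (s.words j).2.1

variable (h : ReadyToAppend S χ β bs src L d D s)
include h

lemma ReadyToAppend.length_le {b : ℕ} {l : List ℕ} (hl : l.toFinset = L b)
    (hl' : ListAt P S χ D b l) : l.length + (lanesTo V β s.words b).length ≤ V := by
  have h1 := appended_list h.carries h.inj h.fresh hl hl'.nodup hl'.lt
  have h2 := length_le_of_nodup h1.1 h1.2.1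
  simpa using h2

lemma ReadyToAppend.count_eq {j : Fin P.lanes} (hj : (s.words j).1 < V) {l : List ℕ}
    (hl' : ListAt P S χ D (β (s.words j).1) l) : (s.words j).2.1 = l.length := by
  have h1 := h.count j hj
  rw [hl'.count] at h1
  exact (Cell.word.inj h1).symm

lemma ReadyToAppend.laneRank_lt {j : Fin P.lanes} (hj : (s.words j).1 < V) :
    laneRank V β s.words j < newCount V β s.words j ∧ newCount V β s.words j ≤ V := by
  obtain ⟨l, hl, hl'⟩ := h.store.lists (β (s.words j).1)
  have h1 := h.length_le hl hl'
  have h2 := h.count_eq hj hl'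
  have h3 : j ∈ lanesTo V β s.words (β (s.words j).1) := mem_lanesTo.2 ⟨hj, rfl⟩
  have h4 := List.idxOf_lt_length_of_mem h3
  unfold laneRank newCount
  omega

lemma ReadyToAppend.mem_bs {j : Fin P.lanes} (hj : (s.words j).1 < V) :
    β (s.words j).1 ∈ bs := by
  obtain ⟨i, hi, _, hw, _⟩ := src_isSome_of_mem_lanesTo h.carries (mem_lanesTo (β := β).2 ⟨hj, rfl⟩)
  rw [hw]
  exact h.mem i (mem_carried.2 ⟨j, hi⟩) (hw ▸ hj)

lemma ReadyToAppend.targetAddr_div {j : Fin P.lanes} {x : ℕ}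
    (hx : targetAddr V β s.words j = some x) :
    (s.words j).1 < V ∧ x = targetCell P V (β (s.words j).1) (laneRank V β s.words j) ∧
      x / arrayCap P V = 3 * β (s.words j).1 + 2 := by
  unfold targetAddr at hx
  split_ifs at hx with hj
  cases hx
  have := h.laneRank_lt hj
  exact ⟨hj, rfl, targetCell_div _ (by omega)⟩

lemma ReadyToAppend.colourAddr_div {j : Fin P.lanes} {x : ℕ}
    (hx : colourAddr V β s.words j = some x) :
    (s.words j).1 < V ∧ x = colourCell P V (β (s.words j).1) (laneRank V β s.words j) ∧
      x / arrayCap P V = 3 * β (s.words j).1 + 3 := by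
  unfold colourAddr at hx
  split_ifs at hx with hj
  cases hx
  have := h.laneRank_lt hj
  exact ⟨hj, rfl, colourCell_div _ (by omega)⟩

omit h in
lemma countAddr_div {j : Fin P.lanes} {x : ℕ} (hx : countAddr V β s.words j = some x) :
    (s.words j).1 < V ∧ x = countCell P V (β (s.words j).1) ∧
      x / arrayCap P V = 3 * β (s.words j).1 + 1 := by
  unfold countAddr at hx
  split_ifs at hx with hj
  cases hx
  exact ⟨hj, rfl, countCell_div _⟩

lemma ReadyToAppend.rank_inj {j j' : Fin P.lanes} (hj : (s.words j).1 < V)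
    (hj' : (s.words j').1 < V) (hb : β (s.words j).1 = β (s.words j').1)
    (hr : laneRank V β s.words j = laneRank V β s.words j') : j = j' := by
  obtain ⟨l, hl, hl'⟩ := h.store.lists (β (s.words j).1)
  have h1 := h.count_eq hj hl'
  have h2 := h.count_eq hj' (hb ▸ hl')
  unfold laneRank at hr
  rw [h1, h2, Nat.add_left_cancel_iff, ← hb] at hr
  exact (List.idxOf_inj (mem_lanesTo.2 ⟨hj, rfl⟩)).1 hr

/-- The old entries stay in place, the new ones follow in the order of `lanesTo`, and the length is
updated last. Several lanes may write the same length, but they agree on it. -/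
lemma ReadyToAppend.final :
    let s₁ := scatter (targetAddr V β s.words) (fun j => .inl (s.words j).1) s
    let s₂ := scatter (colourAddr V β s.words) .inr s₁
    let s₃ := scatter (countAddr V β s.words) (fun j => .inl (newCount V β s.words j)) s₂
    Store P S χ (appendLists S χ β (carried src) L) d s₃.disk ∧
      ∀ x, (∀ b ∈ bs, x / arrayCap P V ∉ listArrays b) → s₃.disk x = D x := by
  intro s₁ s₂ s₃
  -- Targets, colours and lengths lie in arrays with numbers congruent to `2`, `0` and `1` modulo
  -- `3`, so the three scatterings do not interfere.
  have hT : ∀ x, x / arrayCap P V % 3 ≠ 2 → s₁.disk x = D x := by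
    intro x hx
    rw [← h.disk]
    refine scatter_disk_of_forall_ne fun j hj => hx ?_
    have := (h.targetAddr_div hj).2.2
    omega
  have hC : ∀ x, x / arrayCap P V % 3 ≠ 0 → s₂.disk x = s₁.disk x := by
    intro x hx
    refine scatter_disk_of_forall_ne fun j hj => hx ?_
    have := (h.colourAddr_div hj).2.2
    omega
  have hN : ∀ x, x / arrayCap P V % 3 ≠ 1 → s₃.disk x = s₂.disk x := by
    intro x hx
    refine scatter_disk_of_forall_ne fun j hj => hx ?_
    have := (countAddr_div hj).2.2
    omega
  have hframe : ∀ x, (∀ b ∈ bs, x / arrayCap P V ∉ listArrays b) → s₃.disk x = D x := by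
    intro x hx
    have e1 : s₃.disk x = s₂.disk x := by
      refine scatter_disk_of_forall_ne fun j hj => ?_
      obtain ⟨h1, _, h2⟩ := countAddr_div hj
      exact hx _ (h.mem_bs h1) (by simp [h2, listArrays])
    have e2 : s₂.disk x = s₁.disk x := by
      refine scatter_disk_of_forall_ne fun j hj => ?_
      obtain ⟨h1, _, h2⟩ := h.colourAddr_div hj
      exact hx _ (h.mem_bs h1) (by simp [h2, listArrays])
    have e3 : s₁.disk x = D x := by
      rw [← h.disk]
      refine scatter_disk_of_forall_ne fun j hj => ?_
      obtain ⟨h1, _, h2⟩ := h.targetAddr_div hj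
      exact hx _ (h.mem_bs h1) (by simp [h2, listArrays])
    rw [e1, e2, e3]
  refine ⟨⟨h.store.base.congr (P := P) fun x hx => hframe x fun b _ => ?_, fun b => ?_⟩, hframe⟩
  · simp [hx, listArrays]
  obtain ⟨l, hl, hl'⟩ := h.store.lists b
  obtain ⟨hnd, hlt, hfin⟩ := appended_list h.carries h.inj h.fresh hl hl'.nodup hl'.lt
  have hlen := h.length_le hl hl'
  have hle : l.length ≤ V := by omega
  -- the data of a lane whose message goes to `b`
  have hlane : ∀ {j}, j ∈ lanesTo V β s.words b →
      (s.words j).1 < V ∧ β (s.words j).1 = b ∧ (s.words j).2.1 = l.length ∧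
      ∃ i, src j = some i ∧ (s.words j).1 = S.next χ i ∧ s.colours j = .colour (S.fifo χ i) := by
    intro j hj
    obtain ⟨h1, h2⟩ := mem_lanesTo.1 hj
    obtain ⟨i, hi, _, hw, hcol⟩ := src_isSome_of_mem_lanesTo h.carries hj
    exact ⟨h1, h2, h.count_eq h1 (h2.symm ▸ hl'), i, hi, hw, hcol⟩
  have hrank : ∀ {m} (hm : m < (lanesTo V β s.words b).length),
      laneRank V β s.words (lanesTo V β s.words b)[m] = l.length + m := by
    intro m hm
    have hj := List.getElem_mem hm
    obtain ⟨h1, h2, h3, _⟩ := hlane hj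
    unfold laneRank
    rw [h2, h3, (nodup_lanesTo β s.words b).idxOf_getElem]
  have hge : ∀ {j}, (s.words j).1 < V → β (s.words j).1 = b → l.length ≤ laneRank V β s.words j := by
    intro j h1 h2
    have := (hlane (mem_lanesTo.2 ⟨h1, h2⟩)).2.2.1
    unfold laneRank
    omega
  refine ⟨_, hfin, hnd, hlt, ?_, ?_, ?_⟩
  · rw [List.length_append, List.length_map]
    -- If no lane writes to the list, its length is not written either and must already be right.
    cases hne : lanesTo V β s.words b with
    | nil =>
      have e1 : s₃.disk (countCell P V b) = s₂.disk (countCell P V b) := by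
        refine scatter_disk_of_forall_ne fun j hj => ?_
        obtain ⟨h1, _, h2⟩ := countAddr_div hj
        rw [countCell_div] at h2
        have := mem_lanesTo.2 ⟨h1, show β (s.words j).1 = b by omega⟩
        simp [hne] at this
      have hd := countCell_div (P := P) (V := V) b
      rw [e1, hC _ (by omega), hT _ (by omega), hl'.count]
      simp
    | cons j t =>
      rw [← hne]
      have hj : j ∈ lanesTo V β s.words b := by simp [hne]
      have hv : ∀ {j}, j ∈ lanesTo V β s.words b → newCount V β s.words j =
          l.length + (lanesTo V β s.words b).length := by
        intro j hj
        obtain ⟨h1, h2, h3, _⟩ := hlane hj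
        rw [newCount, h2, h3]
      rw [← hv hj]
      refine scatter_disk_word ?_ fun j' hj' => ?_
      · simp [countAddr, (hlane hj).1, (hlane hj).2.1]
      · obtain ⟨h1, _, h2⟩ := countAddr_div hj'
        rw [countCell_div] at h2
        rw [hv hj, hv (mem_lanesTo.2 ⟨h1, show β (s.words j').1 = b by omega⟩)]
  · intro e he
    have heV : e < V := he.trans_le (length_le_of_nodup hnd hlt)
    have hd := targetCell_div (P := P) b heV.le
    rw [hN _ (by omega), hC _ (by omega)]
    by_cases hel : e < l.length
    · rw [List.getElem_append_left hel, ← hl'.target e hel, ← h.disk]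
      refine scatter_disk_of_forall_ne fun j hj => ?_
      obtain ⟨h1, h2, _⟩ := h.targetAddr_div hj
      obtain ⟨h3, h4⟩ := targetCell_inj heV.le (by have := h.laneRank_lt h1; omega) h2
      have := hge h1 h3.symm
      omega
    · have hm : e - l.length < (lanesTo V β s.words b).length := by
        rw [List.length_append, List.length_map] at he
        omega
      rw [List.getElem_append_right (by omega), List.getElem_map]
      obtain ⟨h1, h2, h3, i, hi, hw, _⟩ := hlane (List.getElem_mem hm)
      simp only [hi, Option.getD_some]
      rw [← hw]
      refine scatter_disk_word (j := (lanesTo V β s.words b)[e - l.length]) ?_ fun j' hj' => ?_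
      · rw [targetAddr, if_pos h1, h2, hrank hm]
        congr 2
        omega
      · obtain ⟨h1', h2', _⟩ := h.targetAddr_div hj'
        obtain ⟨h3', h4'⟩ := targetCell_inj heV.le (by have := h.laneRank_lt h1'; omega) h2'
        rw [h.rank_inj h1 h1' (h2.trans h3') (by rw [hrank hm, ← h4']; omega)]
  · intro e he
    have heV : e < V := he.trans_le (length_le_of_nodup hnd hlt)
    have hd := colourCell_div (P := P) b heV.le
    rw [hN _ (by omega)]
    by_cases hel : e < l.length
    · rw [List.getElem_append_left hel, ← hl'.colour e hel, ← hT _ (by omega)]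
      refine scatter_disk_of_forall_ne fun j hj => ?_
      obtain ⟨h1, h2, _⟩ := h.colourAddr_div hj
      obtain ⟨h3, h4⟩ := colourCell_inj heV.le (by have := h.laneRank_lt h1; omega) h2
      have := hge h1 h3.symm
      omega
    · have hm : e - l.length < (lanesTo V β s.words b).length := by
        rw [List.length_append, List.length_map] at he
        omega
      rw [List.getElem_append_right (by omega), List.getElem_map]
      obtain ⟨h1, h2, h3, i, hi, hw, hcol⟩ := hlane (List.getElem_mem hm)
      simp only [hi, Option.getD_some]
      rw [← hcol]
      refine scatter_disk_colour (j := (lanesTo V β s.words b)[e - l.length]) (s := s₁) ?_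
        fun j' hj' => ?_
      · rw [colourAddr, if_pos h1, h2, hrank hm]
        congr 2
        omega
      · obtain ⟨h1', h2', _⟩ := h.colourAddr_div hj'
        obtain ⟨h3', h4'⟩ := colourCell_inj heV.le (by have := h.laneRank_lt h1'; omega) h2'
        exact (h.rank_inj h1 h1' (h2.trans h3') (by rw [hrank hm, ← h4']; omega)).symm

omit h in
lemma card_laneBlocks_le_card {a : Fin P.lanes → Option ℕ} (bs : Finset ℕ) (f : ℕ → ℕ)
    (h : ∀ j x, a j = some x → ∃ b ∈ bs, x = f b) : (laneBlocks a).card ≤ bs.card := by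
  refine (Finset.card_le_card (t := bs.image fun b => f b / P.B) fun y hy => ?_).trans
    Finset.card_image_le
  obtain ⟨j, x, hx, rfl⟩ := exists_of_mem_laneBlocks hy
  obtain ⟨b, hb, rfl⟩ := h j x hx
  exact Finset.mem_image_of_mem _ hb

omit h in
/-- The messages carried by the lanes are appended to lists. -/
theorem performs_append {Y : Type} (I : Y → Inst P V χ) (L : Y → ℕ → Finset ℕ) (d : Y → ℕ)
    (D : Y → ℕ → Cell) (src : Y → Fin P.lanes → Option ℕ) (β : ℕ → ℕ) (bs : Finset ℕ) (k : ℕ)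
    (hU : ∀ y, ∀ b ∈ bs, (3 * b + 4) * arrayCap P V ≤ (I y).U)
    (hstore : ∀ y, Store P (I y).S χ (L y) (d y) (D y))
    (hinj : ∀ y j j' i, src y j = some i → src y j' = some i → j = j')
    (hfresh : ∀ y, ∀ i ∈ carried (src y), (I y).S.next χ i < V → i ∉ L y (β ((I y).S.next χ i)))
    (hmem : ∀ y, ∀ i ∈ carried (src y), (I y).S.next χ i < V → β ((I y).S.next χ i) ∈ bs)
    (hk : ∀ y (j : Fin P.lanes), k ≤ j → src y j = none) :
    Performs (2 * (k / P.B) + 6 * bs.card) I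
      (fun y s => Good (I y).U χ s ∧ s.disk = D y ∧ Carries (I y).S χ (src y) s)
      (fun y s => Good (I y).U χ s ∧
        Store P (I y).S χ (appendLists (I y).S χ β (carried (src y)) (L y)) (d y) s.disk ∧
        ∀ x, (∀ b ∈ bs, x / arrayCap P V ∉ listArrays b) → s.disk x = D y x) := by
  let M₁ : Y → LaneState P → Prop := fun y s => Good (I y).U χ s ∧
    ReadyToAppend (I y).S χ β bs (src y) (L y) (d y) (D y) s
  let M₂ : Y → LaneState P → Prop := fun y s₁ => Good (I y).U χ s₁ ∧ ∃ s,
    ReadyToAppend (I y).S χ β bs (src y) (L y) (d y) (D y) s ∧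
    s₁ = scatter (targetAddr V β s.words) (fun j => .inl (s.words j).1) s
  let M₃ : Y → LaneState P → Prop := fun y s₂ => Good (I y).U χ s₂ ∧ ∃ s,
    ReadyToAppend (I y).S χ β bs (src y) (L y) (d y) (D y) s ∧
    s₂ = scatter (colourAddr V β s.words) .inr
      (scatter (targetAddr V β s.words) (fun j => .inl (s.words j).1) s)
  have hVU : ∀ y, V < (I y).U := fun y => by
    have := (I y).le_U
    have := lt_arrayCap P V
    omega
  have hkV : ∀ y s, Carries (I y).S χ (src y) s → ∀ j : Fin P.lanes, k ≤ j → V ≤ (s.words j).1 :=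
    fun y s hs j hj => (hs j).2 (hk y j hj)
  have h₁ : Performs bs.card I
      (fun y s => Good (I y).U χ s ∧ s.disk = D y ∧ Carries (I y).S χ (src y) s) M₁ := by
    refine Achieves.gatherWords _ (fun w _ j => if (w j).1 < V then
      some (countCell P V (β (w j).1)) else none) fun y s hs => ?_
    obtain ⟨hg, hD, hc⟩ := hs
    have hbs : ∀ j, (s.words j).1 < V → β (s.words j).1 ∈ bs := by
      intro j hj
      obtain ⟨i, hi, _, hw, _⟩ := src_isSome_of_mem_lanesTo hc (mem_lanesTo (β := β).2 ⟨hj, rfl⟩)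
      rw [hw]
      exact hmem y i (mem_carried.2 ⟨j, hi⟩) (hw ▸ hj)
    refine ⟨hg.bdd, hg.scalar, card_laneBlocks_le_card bs (countCell P V) ?_, ?_,
      ⟨gatherWords_bdd hg.bdd, hg.scalar⟩, hstore y, hD, hc, hinj y, hfresh y, hmem y, ?_⟩
    · intro j x hx
      split_ifs at hx with hj
      cases hx
      exact ⟨_, hbs j hj, rfl⟩
    · intro j x hx
      split_ifs at hx with hj
      cases hx
      exact (cells_lt (hU y _ (hbs j hj)) (Nat.zero_le _)).1
    · intro j hj
      have hj' : (s.words j).1 < V := hj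
      obtain ⟨l, hl, hl'⟩ := (hstore y).lists (β (s.words j).1)
      simp [gatherWords, hj', hD, hl'.count, Cell.toNat]
  -- One count of blocks serves for targets and colours, `f` being either address function.
  have hblocks : ∀ y s, ReadyToAppend (I y).S χ β bs (src y) (L y) (d y) (D y) s → ∀ f : ℕ → ℕ → ℕ,
      (∀ b e, f b e = f b 0 + e) → (laneBlocks fun j : Fin P.lanes => if (s.words j).1 < V then
        some (f (β (s.words j).1) (laneRank V β s.words j)) else none).card ≤
        k / P.B + 2 * bs.card := by
    intro y s hs f hf
    classical
    choose l hl hl' using fun b => hs.store.lists b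
    refine (card_laneBlocks_le_sum bs (fun b => f b (l b).length)
      (fun b => (lanesTo V β s.words b).length) ?_).trans ?_
    · intro j x hx
      split_ifs at hx with hj
      cases hx
      refine ⟨_, hs.mem_bs hj, ?_⟩
      have h1 := hs.count_eq hj (hl' _)
      have h2 := (hs.laneRank_lt hj).1
      rw [hf _ (laneRank V β s.words j), hf _ (l (β (s.words j).1)).length]
      unfold newCount at h2
      unfold laneRank at h2 ⊢
      omega
    · have := sum_length_lanesTo_le β s.words bs k (hkV y s hs.carries)
      have := Nat.div_le_div_right (c := P.B) this
      omega
  have h₂ : Performs (k / P.B + 2 * bs.card) I M₁ M₂ := by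
    refine Achieves.scatter _ (fun w _ => targetAddr V β w) (fun w _ j => .inl (w j).1)
      fun y s hs => ?_
    obtain ⟨hg, hr⟩ := hs
    have hv : ∀ j a n, targetAddr V β s.words j = some a →
        (Sum.inl (s.words j).1 : ℕ ⊕ Fin P.lanes) = .inl n → n < (I y).U := by
      intro j a n hj hn
      cases hn
      exact (hg.bdd.words j).1
    refine ⟨hg.bdd, hg.scalar, hblocks y s hr (targetCell P V) fun b e => rfl, ?_, hv,
      ⟨scatter_bdd hg.bdd hv, hg.scalar⟩, s, hr, rfl⟩
    intro j x hx
    obtain ⟨h1, rfl, _⟩ := hr.targetAddr_div hx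
    exact (cells_lt (hU y _ (hr.mem_bs h1)) (by have := hr.laneRank_lt h1; omega)).2.1
  have h₃ : Performs (k / P.B + 2 * bs.card) I M₂ M₃ := by
    refine Achieves.scatter _ (fun w _ => colourAddr V β w) (fun w _ j => .inr j)
      fun y s₁ hs => ?_
    obtain ⟨hg, s, hr, rfl⟩ := hs
    have hv : ∀ j a n, colourAddr V β s.words j = some a →
        (Sum.inr j : ℕ ⊕ Fin P.lanes) = .inl n → n < (I y).U := by
      intro j a n hj hn
      cases hn
    refine ⟨hg.bdd, hg.scalar, hblocks y s hr (colourCell P V) fun b e => rfl, ?_, hv,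
      ⟨scatter_bdd hg.bdd hv, hg.scalar⟩, s, hr, rfl⟩
    intro j x hx
    obtain ⟨h1, rfl, _⟩ := hr.colourAddr_div hx
    exact (cells_lt (hU y _ (hr.mem_bs h1)) (by have := hr.laneRank_lt h1; omega)).2.2
  have h₄ : Performs bs.card I M₃ (fun y s => Good (I y).U χ s ∧
        Store P (I y).S χ (appendLists (I y).S χ β (carried (src y)) (L y)) (d y) s.disk ∧
        ∀ x, (∀ b ∈ bs, x / arrayCap P V ∉ listArrays b) → s.disk x = D y x) := by
    refine Achieves.scatter _ (fun w _ => countAddr V β w) (fun w _ j => .inl (newCount V β w j))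
      fun y s₂ hs => ?_
    obtain ⟨hg, s, hr, rfl⟩ := hs
    have hv : ∀ j a n, countAddr V β s.words j = some a →
        (Sum.inl (newCount V β s.words j) : ℕ ⊕ Fin P.lanes) = .inl n → n < (I y).U := by
      intro j a n hj hn
      cases hn
      exact (hr.laneRank_lt (countAddr_div hj).1).2.trans_lt (hVU y)
    refine ⟨hg.bdd, hg.scalar, card_laneBlocks_le_card bs (countCell P V) ?_, ?_, hv,
      ⟨scatter_bdd hg.bdd hv, hg.scalar⟩, hr.final⟩
    · intro j x hx
      obtain ⟨h1, rfl, _⟩ := countAddr_div hx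
      exact ⟨_, hr.mem_bs h1, rfl⟩
    · intro j x hx
      obtain ⟨h1, rfl, _⟩ := countAddr_div hx
      exact (cells_lt (hU y _ (hr.mem_bs h1)) (Nat.zero_le _)).1
  exact (((h₁.trans h₂).trans h₃).trans h₄).mono (by omega)

end Append

/-! ### Distributing a whole list, one memory load at a time. -/

section Distribute

variable {P : EMParams} {V χ : ℕ}

lemma appendLists_appendLists (S : IntervalRep V) (β : ℕ → ℕ) (A A' : Finset ℕ)
    (L : ℕ → Finset ℕ) : appendLists S χ β A' (appendLists S χ β A L) =
      appendLists S χ β (A ∪ A') L := by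
  classical
  funext b
  simp only [appendLists, Finset.filter_union, Finset.union_assoc]

lemma disjoint_listArrays {ν b x : ℕ} (hx : x ∈ listArrays ν) (hx' : x ∈ listArrays b) : ν = b := by
  simp only [listArrays, Finset.mem_insert, Finset.mem_singleton] at hx hx'
  omega

lemma mem_take_iff {l : List ℕ} {m i : ℕ} : i ∈ l.take m ↔ ∃ e, e < m ∧ l[e]? = some i := by
  rw [List.mem_iff_getElem?]
  constructor
  · rintro ⟨e, he⟩
    rw [List.getElem?_take] at he
    split_ifs at he with h
    exact ⟨e, h, he⟩
  · rintro ⟨e, h, he⟩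
    exact ⟨e, by rw [List.getElem?_take, if_pos h, he]⟩

lemma getElem?_inj_of_nodup {l : List ℕ} (h : l.Nodup) {e e' i : ℕ} (he : l[e]? = some i)
    (he' : l[e']? = some i) : e = e' := by
  obtain ⟨h1, rfl⟩ := List.getElem?_eq_some_iff.1 he
  obtain ⟨h2, h3⟩ := List.getElem?_eq_some_iff.1 he'
  exact ((List.Nodup.getElem_inj_iff h).1 h3).symm

/-- The messages of the list `ν` are distributed to other lists. -/
theorem performs_distribute {Y : Type} (I : Y → Inst P V χ) (L : Y → ℕ → Finset ℕ) (d : Y → ℕ)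
    (ν : ℕ) (β : ℕ → ℕ) (bs : Finset ℕ) (n Q : ℕ) (hn : n ≤ P.lanes)
    (hU : ∀ y, ∀ b ∈ bs, (3 * b + 4) * arrayCap P V ≤ (I y).U)
    (hν : ∀ y, (3 * ν + 4) * arrayCap P V ≤ (I y).U) (hνbs : ν ∉ bs)
    (hmem : ∀ y, ∀ i ∈ L y ν, (I y).S.next χ i < V →
      β ((I y).S.next χ i) ∈ bs ∧ i ∉ L y (β ((I y).S.next χ i)))
    (hQ : ∀ y, (L y ν).card ≤ Q * n) :
    Performs (Q * (4 * (n / P.B) + 6 * bs.card + 7)) I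
      (fun y s => Good (I y).U χ s ∧ Store P (I y).S χ (L y) (d y) s.disk)
      (fun y s => Good (I y).U χ s ∧
        Store P (I y).S χ (appendLists (I y).S χ β (L y ν) (L y)) (d y) s.disk) := by
  classical
  -- The set of messages does not determine the order in which they are stored, so the list itself
  -- is carried along as a ghost.
  let Inv : ℕ → Y × List ℕ → LaneState P → Prop := fun q z s =>
    Good (I z.1).U χ s ∧ ListAt P (I z.1).S χ s.disk ν z.2 ∧ z.2.toFinset = L z.1 ν ∧
    Store P (I z.1).S χ (appendLists (I z.1).S χ β (z.2.take (q * n)).toFinset (L z.1))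
      (d z.1) s.disk
  have key : Performs (∑ q ∈ Finset.range Q, (4 * (n / P.B) + 6 * bs.card + 7))
      (fun z : Y × List ℕ => I z.1) (Inv 0) (Inv Q) := by
    refine Achieves.loop Inv _ Q (fun z s hs => ⟨hs.1.bdd, hs.1.scalar⟩) fun q _ => ?_
    -- For a single round the disk at its beginning is a ghost as well.
    let G := { z : (Y × List ℕ) × (ℕ → Cell) //
      ListAt P (I z.1.1).S χ z.2 ν z.1.2 ∧ z.1.2.toFinset = L z.1.1 ν ∧
      Store P (I z.1.1).S χ (appendLists (I z.1.1).S χ β (z.1.2.take (q * n)).toFinset (L z.1.1))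
        (d z.1.1) z.2 }
    let src : G → Fin P.lanes → Option ℕ := fun z j =>
      if (j : ℕ) < n then z.1.1.2[q * n + j]? else none
    have hsrc : ∀ (z : G) j i, src z j = some i → (j : ℕ) < n ∧ z.1.1.2[q * n + j]? = some i := by
      intro z j i h
      simp only [src] at h
      split_ifs at h with hj
      exact ⟨hj, h⟩
    have hcar : ∀ (z : G) i, i ∈ carried (src z) ↔
        ∃ e, q * n ≤ e ∧ e < (q + 1) * n ∧ z.1.1.2[e]? = some i := by
      intro z i
      rw [mem_carried, add_mul, one_mul]
      constructor
      · rintro ⟨j, hj⟩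
        obtain ⟨h1, h2⟩ := hsrc z j i hj
        exact ⟨_, by omega, by omega, h2⟩
      · rintro ⟨e, h1, h2, h3⟩
        refine ⟨⟨e - q * n, by omega⟩, ?_⟩
        simp only [src]
        rw [if_pos (by omega), show q * n + (e - q * n) = e by omega, h3]
    have hL : ∀ (z : G) i, i ∈ carried (src z) → i ∈ L z.1.1.1 ν := by
      intro z i hi
      obtain ⟨e, _, _, h⟩ := (hcar z i).1 hi
      rw [← z.2.2.1, List.mem_toFinset]
      exact List.mem_of_getElem? h
    have h1 := performs_load (fun z : G => I z.1.1.1) (fun z => z.1.2) (fun z => z.1.1.2) ν (q * n) n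
      (fun z => hν _) (fun z => z.2.1)
    have h2 := performs_append (fun z : G => I z.1.1.1)
      (fun z => appendLists (I z.1.1.1).S χ β (z.1.1.2.take (q * n)).toFinset (L z.1.1.1))
      (fun z => d z.1.1.1) (fun z => z.1.2) src β bs n (fun z => hU _) (fun z => z.2.2.2)
      (by
        intro z j j' i hj hj'
        have := getElem?_inj_of_nodup z.2.1.nodup (hsrc z j i hj).2 (hsrc z j' i hj').2
        exact Fin.ext (by omega))
      (by
        intro z i hi hlt hmem'
        simp only [appendLists, Finset.mem_union, Finset.mem_filter, List.mem_toFinset] at hmem'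
        rcases hmem' with h | h
        · exact (hmem _ i (hL z i hi) hlt).2 h
        · obtain ⟨e, he, he'⟩ := mem_take_iff.1 h.1
          obtain ⟨e', h3, _, h4⟩ := (hcar z i).1 hi
          have := getElem?_inj_of_nodup z.2.1.nodup he' h4
          omega)
      (fun z i hi hlt => (hmem _ i (hL z i hi) hlt).1)
      (by
        intro z j hj
        simp only [src]
        rw [if_neg (by omega)])
    refine ((h1.trans h2).mono (T' := 4 * (n / P.B) + 6 * bs.card + 7) (by omega)).conseq ?_
    rintro ⟨y, l⟩ s ⟨hg, hl, hL', hst⟩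
    refine ⟨⟨((y, l), s.disk), hl, hL', hst⟩, rfl, rfl, ⟨hg, rfl⟩, ?_⟩
    rintro s' ⟨hg', hst', hfr⟩
    refine ⟨hg', hl.congr fun x hx => hfr x fun b hb hxb => hνbs ?_, hL', ?_⟩
    · rwa [disjoint_listArrays hx hxb]
    · rw [appendLists_appendLists] at hst'
      convert hst' using 2
      ext i
      rw [Finset.mem_union, hcar, List.mem_toFinset, List.mem_toFinset, mem_take_iff, mem_take_iff]
      constructor
      · rintro ⟨e, he, h⟩
        by_cases hlt : e < q * n
        · exact .inl ⟨e, hlt, h⟩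
        · exact .inr ⟨e, by omega, he, h⟩
      · rintro (⟨e, he, h⟩ | ⟨e, _, he, h⟩)
        · exact ⟨e, by rw [add_mul, one_mul]; omega, h⟩
        · exact ⟨e, he, h⟩
  rw [Finset.sum_const, Finset.card_range, smul_eq_mul] at key
  refine key.conseq fun y s hs => ?_
  obtain ⟨l, hl, hl'⟩ := hs.2.lists ν
  refine ⟨(y, l), rfl, rfl, ⟨hs.1, hl', hl, ?_⟩, fun s' hs' => ⟨hs'.1, ?_⟩⟩
  · convert hs.2 using 1
    funext b
    simp [appendLists]
  · have := hs'.2.2.2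
    rwa [List.take_of_length_le, hl] at this
    rw [← List.toFinset_card_of_nodup hl'.nodup, hl]
    exact hQ y

/-! ### Processing a leaf -/

/-- The lane `p'` passes its colour on to the lane `p`. -/
def LaneStep (χ start k : ℕ) (w : LaneWords P) (p' p : Fin P.lanes) : Prop :=
  (p' : ℕ) < k ∧ (w p').2.1 + χ = start + p

open Classical in
/-- The lane where the colour of lane `p` comes from. -/
noncomputable def laneRoot (χ start k : ℕ) (w : LaneWords P) (p : Fin P.lanes) : Fin P.lanes :=
  if h : ∃ q, Relation.ReflTransGen (LaneStep χ start k w) q p ∧ ¬ ∃ q', LaneStep χ start k w q' q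
  then h.choose else p

/-- Within a leaf, colours run along chains of increasing lanes. Going back from `p` one reaches a
lane without predecessor in the leaf, whose colour comes from the palette or from a message sent
before the leaf. -/
lemma laneRoot_spec {S : IntervalRep V} (hS : S.Fits χ) {start k : ℕ} (hk : start + k ≤ V)
    {w : LaneWords P}
    (hw : ∀ p : Fin P.lanes, (p : ℕ) < k → (w p).2.1 + χ = S.next χ (start + p)) {p : Fin P.lanes}
    (hp : (p : ℕ) < k) : (laneRoot χ start k w p : ℕ) < k ∧
      S.fifo χ (start + laneRoot χ start k w p) = S.fifo χ (start + p) ∧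
      (χ ≤ start + laneRoot χ start k w p → S.prev χ (start + laneRoot χ start k w p) < start) := by
  have hstep : ∀ {p' p : Fin P.lanes}, (p : ℕ) < k → LaneStep χ start k w p' p →
      p' < p ∧ S.fifo χ (start + p') = S.fifo χ (start + p) := by
    rintro p' p hp ⟨h1, h2⟩
    rw [hw p' h1] at h2
    have h3 := hS.lt_next (i := start + p') (by omega)
    have h4 := hS.fifo_next (i := start + p') (by omega) (by omega)
    rw [h2] at h4
    exact ⟨by rw [Fin.lt_def]; omega, h4.symm⟩
  have hex : ∀ m, ∀ p : Fin P.lanes, (p : ℕ) = m → (p : ℕ) < k → ∃ q,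
      Relation.ReflTransGen (LaneStep χ start k w) q p ∧ ¬ ∃ q', LaneStep χ start k w q' q := by
    intro m
    induction m using Nat.strong_induction_on with
    | _ m ih =>
      intro p hm hp
      by_cases h : ∃ q', LaneStep χ start k w q' p
      · obtain ⟨q', hq'⟩ := h
        have := (hstep hp hq').1
        obtain ⟨q, h1, h2⟩ := ih q' (by rw [Fin.lt_def] at this; omega) q' rfl hq'.1
        exact ⟨q, h1.tail hq', h2⟩
      · exact ⟨p, .refl, h⟩
  have hroot : Relation.ReflTransGen (LaneStep χ start k w) (laneRoot χ start k w p) p ∧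
      ¬ ∃ q', LaneStep χ start k w q' (laneRoot χ start k w p) := by
    have h := hex p p rfl hp
    rw [laneRoot, dif_pos h]
    exact h.choose_spec
  generalize laneRoot χ start k w p = q at hroot ⊢
  obtain ⟨h1, h2⟩ := hroot
  have hall : ∀ c, Relation.ReflTransGen (LaneStep χ start k w) c p →
      (c : ℕ) < k ∧ S.fifo χ (start + c) = S.fifo χ (start + p) := by
    intro c hc
    induction hc using Relation.ReflTransGen.head_induction_on with
    | refl => exact ⟨hp, rfl⟩
    | head h _ ih => exact ⟨h.1, (hstep ih.1 h).2.trans ih.2⟩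
  have h3 := hall q h1
  refine ⟨h3.1, h3.2, fun hχ => ?_⟩
  by_contra! hge
  have h4 := h3.1
  have h5 := hS.prev_lt (i := start + q) (by omega) hχ
  refine h2 ⟨⟨S.prev χ (start + q) - start, by have := q.2; omega⟩, by simp only; omega, ?_⟩
  rw [hw _ (by simp only; omega)]
  simp only
  rw [show start + (S.prev χ (start + q) - start) = S.prev χ (start + q) by omega,
    IntervalRep.next_prev (by omega) hχ]

/-- The messages sent by the intervals from `a` to `e - 1` to targets from `e` on. -/
def outgoing (S : IntervalRep V) (χ a e : ℕ) : Finset ℕ :=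
  (Finset.range V).filter fun i => a ≤ i ∧ i < e ∧ e ≤ S.next χ i

/-- The messages sent by the intervals before `a` to targets from `b` to `e - 1`. -/
def incoming (S : IntervalRep V) (χ a b e : ℕ) : Finset ℕ :=
  (Finset.range V).filter fun i => i < a ∧ b ≤ S.next χ i ∧ S.next χ i < e ∧ S.next χ i < V

lemma mem_outgoing {S : IntervalRep V} {a e i : ℕ} :
    i ∈ outgoing S χ a e ↔ i < V ∧ a ≤ i ∧ i < e ∧ e ≤ S.next χ i := by
  simp [outgoing]

lemma mem_incoming {S : IntervalRep V} {a b e i : ℕ} :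
    i ∈ incoming S χ a b e ↔ i < V ∧ i < a ∧ b ≤ S.next χ i ∧ S.next χ i < e ∧ S.next χ i < V := by
  simp [incoming]

/-- Distinct messages have distinct targets, by `next_inj`. In particular the messages to a leaf fit
into the lanes at once. -/
lemma card_incoming_le (S : IntervalRep V) (a b e : ℕ) :
    (incoming S χ a b e).card ≤ min e V - b := by
  rw [← Nat.card_Ico]
  refine Finset.card_le_card_of_injOn (S.next χ) (fun i hi => ?_) fun i hi j hj h => ?_
  · have := mem_incoming.1 hi
    simp only [Finset.coe_Ico, Set.mem_Ico]
    omega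
  · exact IntervalRep.next_inj (mem_incoming.1 hi).1 (mem_incoming.1 hj).1 h

lemma Store.scatter_output {S : IntervalRep V} {L : ℕ → Finset ℕ} {a e : ℕ} {D D' : ℕ → Cell}
    (h : Store P S χ L a D) (h₁ : ∀ i < V, a ≤ i → i < e → D' (4 * V + i) = .colour (S.fifo χ i))
    (h₂ : ∀ x, ¬ (4 * V + a ≤ x ∧ x < 5 * V) → D' x = D x) : Store P S χ L e D' := by
  refine ⟨⟨fun i hi => ?_, fun i hi => ?_, fun i hi he => ?_⟩, fun ν => ?_⟩
  · rw [h₂ _ (by omega), h.base.partner i hi]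
  · rw [h₂ _ (by omega), h.base.palette i hi]
  · by_cases ha : a ≤ i
    · exact h₁ i hi ha he
    · rw [h₂ _ (by omega), h.base.done i hi (by omega)]
  · obtain ⟨l, hl, hl'⟩ := h.lists ν
    refine ⟨l, hl, hl'.congr fun x hx => h₂ x fun hlt => ?_⟩
    rw [div_arrayCap_of_lt hlt.2] at hx
    simp [listArrays] at hx

open Classical in
/-- The lane holding the message to lane `p`. -/
noncomputable def messageLane (start : ℕ) (w : LaneWords P) (p : Fin P.lanes) : Fin P.lanes :=
  if h : ∃ j, (w j).1 = start + p then h.choose else p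

/-- The intervals from `start` to `start + n - 1` are coloured. -/
theorem performs_leaf {Y : Type} (I : Y → Inst P V χ) (L : Y → ℕ → Finset ℕ)
    (start n νin νout : ℕ) (hn : n ≤ P.lanes) (hstart : start < V)
    (hin : ∀ y, (3 * νin + 4) * arrayCap P V ≤ (I y).U)
    (hout : ∀ y, (3 * νout + 4) * arrayCap P V ≤ (I y).U)
    (hLin : ∀ y, L y νin = incoming (I y).S χ start start (start + n))
    (hLout : ∀ y, ∀ i ∈ L y νout, i < start) :
    Performs (7 * (n / P.B) + 21) I
      (fun y s => Good (I y).U χ s ∧ Store P (I y).S χ (L y) start s.disk)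
      (fun y s => Good (I y).U χ s ∧ Store P (I y).S χ (appendLists (I y).S χ (fun _ => νout)
        (outgoing (I y).S χ start (start + n)) (L y)) (start + n) s.disk) := by
  classical
  -- The last leaf may be incomplete.
  obtain ⟨k, hkdef⟩ : ∃ k, k = min n (V - start) := ⟨_, rfl⟩
  have hkn : k ≤ n := by omega
  have hkV : start + k ≤ V := by omega
  have hkdiv : k / P.B ≤ n / P.B := Nat.div_le_div_right hkn
  let G := { z : Y × List ℕ × (ℕ → Cell) // z.2.1.toFinset = L z.1 νin ∧
    ListAt P (I z.1).S χ z.2.2 νin z.2.1 ∧ Store P (I z.1).S χ (L z.1) start z.2.2 }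
  let J : G → Inst P V χ := fun z => I z.1.1
  let D : G → ℕ → Cell := fun z => z.1.2.2
  have hVU : ∀ z : G, 2 * arrayCap P V + χ + V ≤ (J z).U ∧ 5 * V < arrayCap P V := fun z =>
    ⟨(J z).le_U, lt_arrayCap P V⟩
  have hpal : ∀ (z : G) i, i < V → D z (3 * V + i) = .colour i := fun z => z.2.2.2.base.palette
  have hpar : ∀ (z : G) i, i < V → D z (2 * V + i) = .word ((J z).S.next χ i - χ) := fun z =>
    z.2.2.2.base.partner
  have hlin : ∀ z : G, z.1.2.1.toFinset = incoming (J z).S χ start start (start + n) := fun z =>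
    z.2.1.trans (hLin _)
  have h₁ := performs_load J D (fun z => z.1.2.1) νin 0 n (fun z => hin _) (fun z => z.2.2.1)
  -- the colours of the messages are moved to the lanes of their targets
  let M₂ : G → LaneState P → Prop := fun z s => Good (J z).U χ s ∧ s.disk = D z ∧
    ∀ p : Fin P.lanes, (p : ℕ) < k → χ ≤ start + p → (J z).S.prev χ (start + p) < start →
      s.colours p = .colour ((J z).S.fifo χ (start + p))
  have h₂ : Performs 1 J (fun z s => Good (J z).U χ s ∧ s.disk = D z ∧ Carries (J z).S χ
      (fun j => if (j : ℕ) < n then z.1.2.1[0 + (j : ℕ)]? else none) s) M₂ := by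
    refine Achieves.compute (fun w _ => w) (fun _ z => z) (fun w _ p => messageLane start w p)
      fun z s hs => ?_
    obtain ⟨hg, hD, hc⟩ := hs
    refine ⟨hg.bdd, hg.scalar, hg.scalar, hg.bdd.scalar, hg.bdd.words,
      ⟨⟨hg.bdd.words, hg.bdd.scalar, fun j => hg.bdd.colours _, hg.bdd.disk⟩, hg.scalar⟩, hD, ?_⟩
    intro p hp hχ hprev
    have hnp := IntervalRep.next_prev (S := (J z).S) (c := χ) (i := start + p) (by omega) hχ
    have hpV := IntervalRep.prev_lt_card (S := (J z).S) (c := χ) (i := start + p) (by omega)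
    have hmem : (J z).S.prev χ (start + p) ∈ z.1.2.1 := by
      rw [← List.mem_toFinset, hlin, mem_incoming]
      exact ⟨hpV, hprev, by omega⟩
    obtain ⟨e, he, heq⟩ := List.getElem_of_mem hmem
    have hlen : z.1.2.1.length ≤ n := by
      rw [← List.toFinset_card_of_nodup z.2.2.1.nodup, hlin]
      refine (card_incoming_le _ _ _ _).trans (by omega)
    have hex : ∃ j : Fin P.lanes, (s.words j).1 = start + p := by
      refine ⟨⟨e, by omega⟩, ?_⟩
      have := ((hc ⟨e, by omega⟩).1 ((J z).S.prev χ (start + p)) (by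
        simp only [zero_add]
        rw [if_pos (by omega), List.getElem?_eq_getElem he, heq])).2.1
      rw [this, hnp]
    -- Lanes without a message hold words from `V` on, so a lane found in this way does carry a
    -- message to interval `start + p`, and its colour is determined.
    have hj : (s.words (messageLane start s.words p)).1 = start + p := by
      rw [messageLane, dif_pos hex]
      exact hex.choose_spec
    show s.colours (messageLane start s.words p) = _
    generalize messageLane start s.words p = j at hj
    cases hsrc : (if (j : ℕ) < n then z.1.2.1[0 + (j : ℕ)]? else none) with
    | none =>
      have := (hc j).2 hsrc
      omega
    | some i =>
      obtain ⟨h1, h2, h3⟩ := (hc j).1 i hsrc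
      rw [h3, ← (J z).fits.fifo_next h1 (by omega), ← h2, hj]
  -- the first colours are taken from the palette
  let M₃ : G → LaneState P → Prop := fun z s => Good (J z).U χ s ∧ s.disk = D z ∧
    ∀ p : Fin P.lanes, (p : ℕ) < k → (χ ≤ start + p → (J z).S.prev χ (start + p) < start) →
      s.colours p = .colour ((J z).S.fifo χ (start + p))
  have h₃ : Performs (k / P.B + 2) J M₂ M₃ := by
    refine Achieves.gatherColours _ (fun _ _ p => if (p : ℕ) < k ∧ start + p < χ then
      some (3 * V + start + p) else none) fun z s hs => ?_
    obtain ⟨hg, hD, hc⟩ := hs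
    refine ⟨hg.bdd, hg.scalar, card_laneBlocks_le (b := 3 * V + start) ?_, ?_,
      ⟨gatherColours_bdd hg.bdd, hg.scalar⟩, hD, ?_⟩
    · intro j a ha
      split_ifs at ha with h
      cases ha
      omega
    · intro j a ha
      split_ifs at ha with h
      cases ha
      have := hVU z
      omega
    · intro p hp h
      by_cases hχ : χ ≤ start + p
      · have : ¬ ((p : ℕ) < k ∧ start + p < χ) := by omega
        simp only [gatherColours, if_neg this]
        exact hc p hp hχ (h hχ)
      · have : ((p : ℕ) < k ∧ start + p < χ) := by omega
        simp only [gatherColours, if_pos this]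
        rw [hD, add_assoc, hpal _ _ (by omega), IntervalRep.fifo_of_lt (by omega)]
  let M₄ : G → LaneState P → Prop := fun z s => M₃ z s ∧
    ∀ p : Fin P.lanes, (p : ℕ) < k → (s.words p).2.1 + χ = (J z).S.next χ (start + p)
  have h₄ : Performs (k / P.B + 2) J M₃ M₄ := by
    refine Achieves.gatherWords _ (fun _ _ p => if (p : ℕ) < k then
      some (2 * V + start + p) else none) fun z s hs => ?_
    obtain ⟨hg, hD, hc⟩ := hs
    refine ⟨hg.bdd, hg.scalar, card_laneBlocks_le (b := 2 * V + start) ?_, ?_,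
      ⟨⟨gatherWords_bdd hg.bdd, hg.scalar⟩, hD, hc⟩, ?_⟩
    · intro j a ha
      split_ifs at ha with h
      cases ha
      omega
    · intro j a ha
      split_ifs at ha with h
      cases ha
      have := hVU z
      omega
    · intro p hp
      simp only [gatherWords, if_pos hp]
      rw [hD, add_assoc, hpar _ _ (by omega)]
      exact Nat.sub_add_cancel (IntervalRep.le_next (by omega))
  -- the colours are passed on within the leaf
  let src : G → Fin P.lanes → Option ℕ := fun z p =>
    if (p : ℕ) < k ∧ start + n ≤ (J z).S.next χ (start + p) then some (start + p) else none
  let M₅ : G → LaneState P → Prop := fun z s => Good (J z).U χ s ∧ s.disk = D z ∧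
    (∀ p : Fin P.lanes, (p : ℕ) < k → s.colours p = .colour ((J z).S.fifo χ (start + p))) ∧
    Carries (J z).S χ (src z) s
  have h₅ : Performs 1 J M₄ M₅ := by
    -- Only messages to targets behind the leaf are to be sent on; all other lanes are marked by
    -- `V`. At the same time every lane fetches the colour of its root.
    refine Achieves.compute (fun w _ p => (if (p : ℕ) < k ∧ start + n ≤ (w p).2.1 + χ then
      (w p).2.1 + χ else V, (w p).2.1, (w p).2.2)) (fun _ z => z)
      (fun w _ p => laneRoot χ start k w p) fun z s hs => ?_
    obtain ⟨⟨hg, hD, hc⟩, hw⟩ := hs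
    have hb : ∀ p : Fin P.lanes, (if (p : ℕ) < k ∧ start + n ≤ (s.words p).2.1 + χ then
        (s.words p).2.1 + χ else V) < (J z).U ∧ (s.words p).2.1 < (J z).U ∧
        (s.words p).2.2 < (J z).U := by
      intro p
      refine ⟨?_, (hg.bdd.words p).2⟩
      have := hVU z
      split_ifs with h
      · rw [hw p h.1]
        have := IntervalRep.next_lt_add (S := (J z).S) (c := χ) (i := start + p) (by omega)
        omega
      · omega
    have hcol : ∀ p : Fin P.lanes, (p : ℕ) < k →
        s.colours (laneRoot χ start k s.words p) = .colour ((J z).S.fifo χ (start + p)) := by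
      intro p hp
      obtain ⟨r1, r2, r3⟩ := laneRoot_spec (J z).fits hkV hw hp
      rw [hc _ r1 r3, r2]
    refine ⟨hg.bdd, hg.scalar, hg.scalar, hg.bdd.scalar, hb,
      ⟨⟨hb, hg.bdd.scalar, fun j => hg.bdd.colours _, hg.bdd.disk⟩, hg.scalar⟩, hD, hcol, ?_⟩
    intro p
    constructor
    · intro i hi
      simp only [src] at hi
      split_ifs at hi with h
      cases hi
      refine ⟨by omega, ?_, hcol p h.1⟩
      simp only [compute, hw p h.1, if_pos h]
    · intro hp
      simp only [src] at hp
      split_ifs at hp with h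
      have h' : ¬ ((p : ℕ) < k ∧ start + n ≤ (s.words p).2.1 + χ) := by
        intro h'
        rw [hw p h'.1] at h'
        exact h h'
      simp only [compute, if_neg h']
      exact le_rfl
  let M₆ : G → LaneState P → Prop := fun z s => Good (J z).U χ s ∧
    Store P (J z).S χ (L z.1.1) (start + n) s.disk ∧ Carries (J z).S χ (src z) s
  have h₆ : Performs (k / P.B + 2) J M₅ M₆ := by
    refine Achieves.scatter _ (fun _ _ p => if (p : ℕ) < k then some (4 * V + start + p) else none)
      (fun _ _ p => .inr p) fun z s hs => ?_
    obtain ⟨hg, hD, hc, hcar⟩ := hs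
    have hval : ∀ (j : Fin P.lanes) (a n : ℕ), (if (j : ℕ) < k then some (4 * V + start + j)
        else none) = some a → (Sum.inr j : ℕ ⊕ Fin P.lanes) = .inl n → n < (J z).U := by
      intro j a n _ h
      cases h
    refine ⟨hg.bdd, hg.scalar, card_laneBlocks_le (b := 4 * V + start) ?_, ?_, hval,
      ⟨scatter_bdd hg.bdd hval, hg.scalar⟩, ?_, hcar⟩
    · intro j a ha
      split_ifs at ha with h
      cases ha
      omega
    · intro j a ha
      split_ifs at ha with h
      cases ha
      have := hVU z
      omega
    · refine z.2.2.2.scatter_output (fun i hi ha he => ?_) fun x hx => ?_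
      · have h1 : i - start < P.lanes := by omega
        have h2 : i - start < k := by omega
        rw [scatter_disk_colour (j := ⟨i - start, h1⟩), hc _ h2]
        · simp only [Nat.add_sub_cancel' ha]; rfl
        · simp only [if_pos h2]
          congr 1
          omega
        · intro j' hj'
          split_ifs at hj' with h
          refine Fin.ext ?_
          simp only [Option.some.injEq] at hj' ⊢
          omega
      · rw [scatter_disk_of_forall_ne, hD]
        intro j hj
        split_ifs at hj with h
        cases hj
        omega
  have hsrc : ∀ (z : G) (j : Fin P.lanes) (i : ℕ), src z j = some i → i = start + j ∧ (j : ℕ) < k ∧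
      start + n ≤ (J z).S.next χ i := by
    intro z j i h
    simp only [src] at h
    split_ifs at h with hj
    cases h
    exact ⟨rfl, hj⟩
  have hcarried : ∀ z : G, carried (src z) = outgoing (J z).S χ start (start + n) := by
    intro z
    ext i
    rw [mem_carried, mem_outgoing]
    constructor
    · rintro ⟨j, hj⟩
      obtain ⟨h1, h2, h3⟩ := hsrc z j i hj
      omega
    · rintro ⟨h1, h2, h3, h4⟩
      refine ⟨⟨i - start, by omega⟩, ?_⟩
      simp only [src, Nat.add_sub_cancel' h2]
      rw [if_pos ⟨by omega, h4⟩]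
  let G' := { z : G × (ℕ → Cell) // Store P (J z.1).S χ (L z.1.1.1) (start + n) z.2 }
  have h₇ := performs_append (fun z : G' => J z.1.1) (fun z => L z.1.1.1.1) (fun _ => start + n)
    (fun z => z.1.2) (fun z => src z.1.1) (fun _ => νout) {νout} k
    (by
      intro z b hb
      rw [Finset.mem_singleton.1 hb]
      exact hout _)
    (fun z => z.2)
    (by
      intro z j j' i hj hj'
      exact Fin.ext (by have := (hsrc _ j i hj).1; have := (hsrc _ j' i hj').1; omega))
    (by
      intro z i hi _ hmem
      obtain ⟨j, hj⟩ := mem_carried.1 hi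
      have := (hsrc _ j i hj).1
      have := hLout _ i hmem
      omega)
    (fun z i _ _ => Finset.mem_singleton_self _)
    (by
      intro z j hj
      simp only [src]
      rw [if_neg (by omega)])
  rw [Finset.card_singleton] at h₇
  have h₇' : Performs (2 * (k / P.B) + 6 * 1) J M₆ (fun z s => Good (J z).U χ s ∧
      Store P (J z).S χ (appendLists (J z).S χ (fun _ => νout)
        (outgoing (J z).S χ start (start + n)) (L z.1.1)) (start + n) s.disk) := by
    refine h₇.conseq ?_
    rintro z s ⟨hg, hst, hcar⟩
    refine ⟨⟨(z, s.disk), hst⟩, rfl, rfl, ⟨hg, rfl, hcar⟩, ?_⟩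
    rintro s' ⟨hg', hst', _⟩
    rw [← hcarried]
    exact ⟨hg', hst'⟩
  have hall := (((((h₁.trans h₂).trans h₃).trans h₄).trans h₅).trans h₆).trans h₇'
  refine (hall.mono (T' := 7 * (n / P.B) + 21) (by omega)).conseq ?_
  rintro y s ⟨hg, hst⟩
  obtain ⟨l, hl, hl'⟩ := hst.lists νin
  exact ⟨⟨(y, l, s.disk), hl, hl', hst⟩, rfl, rfl, ⟨hg, rfl⟩, fun s' hs' => hs'⟩

end Distribute

/-! ### Colouring by recursive distribution -/

section Recursion

variable {P : EMParams} {V χ : ℕ}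

/-- The list of messages to the node `idx` of level `h`. -/
def inName (h idx : ℕ) : ℕ := Nat.pair h (2 * idx)

/-- The list of messages leaving the node `idx` of level `h`. -/
def outName (h idx : ℕ) : ℕ := Nat.pair h (2 * idx + 1)

/-- The number of intervals in a node of level `h`: a leaf has `n` intervals, any other node has
`F` children. -/
def nodeSize (n F h : ℕ) : ℕ := n * F ^ h

/-- The level of the node to which the list `ν` belongs. -/
def level (ν : ℕ) : ℕ := ν.unpair.1

/-- The first interval of the node to which the list `ν` belongs. -/
def nodeStart (n F ν : ℕ) : ℕ := ν.unpair.2 / 2 * nodeSize n F (level ν)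

@[simp] lemma level_inName (h idx : ℕ) : level (inName h idx) = h := by simp [level, inName]

@[simp] lemma level_outName (h idx : ℕ) : level (outName h idx) = h := by simp [level, outName]

@[simp] lemma nodeStart_inName (n F h idx : ℕ) :
    nodeStart n F (inName h idx) = idx * nodeSize n F h := by
  simp [nodeStart, inName, level]

@[simp] lemma nodeStart_outName (n F h idx : ℕ) :
    nodeStart n F (outName h idx) = idx * nodeSize n F h := by
  have : (2 * idx + 1) / 2 = idx := by omega
  simp [nodeStart, outName, level, this]

@[simp] lemma inName_inj {h idx h' idx' : ℕ} :
    inName h idx = inName h' idx' ↔ h = h' ∧ idx = idx' := by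
  simp only [inName, Nat.pair_eq_pair]
  omega

@[simp] lemma outName_inj {h idx h' idx' : ℕ} :
    outName h idx = outName h' idx' ↔ h = h' ∧ idx = idx' := by
  simp only [outName, Nat.pair_eq_pair]
  omega

@[simp] lemma inName_ne_outName (h idx h' idx' : ℕ) : inName h idx ≠ outName h' idx' := by
  simp only [inName, outName, ne_eq, Nat.pair_eq_pair]
  omega

@[simp] lemma outName_ne_inName (h idx h' idx' : ℕ) : outName h idx ≠ inName h' idx' :=
  (inName_ne_outName _ _ _ _).symm

lemma nodeSize_pos {n F : ℕ} (hn : 0 < n) (hF : 2 ≤ F) (h : ℕ) : 0 < nodeSize n F h :=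
  Nat.mul_pos hn (Nat.pow_pos (by omega))

lemma nodeSize_succ (n F h : ℕ) : nodeSize n F (h + 1) = F * nodeSize n F h := by
  unfold nodeSize
  ring

/-- The number of leaves of the node `idx` of level `h` which are among the first `A` leaves. -/
def activeLeaves (F A h idx : ℕ) : ℕ := min ((idx + 1) * F ^ h) A - min (idx * F ^ h) A

lemma sum_activeLeaves (F A h a q : ℕ) :
    ∑ j ∈ Finset.range q, activeLeaves F A h (a + j) =
      min ((a + q) * F ^ h) A - min (a * F ^ h) A := by
  induction q with
  | zero => simp
  | succ q ih =>
    rw [Finset.sum_range_succ, ih, activeLeaves]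
    have h1 : a * F ^ h ≤ (a + q) * F ^ h := Nat.mul_le_mul_right _ (by omega)
    have h2 : (a + q) * F ^ h ≤ (a + q + 1) * F ^ h := Nat.mul_le_mul_right _ (by omega)
    rw [← add_assoc]
    omega

lemma sum_activeLeaves_children (F A h idx : ℕ) :
    ∑ j ∈ Finset.range F, activeLeaves F A h (idx * F + j) = activeLeaves F A (h + 1) idx := by
  rw [sum_activeLeaves, activeLeaves]
  congr 2 <;> ring_nf

/-- The active leaves of a node cover its intervals, so that many memory loads suffice for its
incoming as well as its outgoing messages. Charging by active leaves avoids paying for the parts of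
nodes beyond `V`. -/
lemma min_sub_le_activeLeaves {n F A : ℕ} (hA : V ≤ A * n) (h idx : ℕ) :
    min ((idx + 1) * nodeSize n F h) V - idx * nodeSize n F h ≤ activeLeaves F A h idx * n := by
  have h1 : (idx + 1) * nodeSize n F h = (idx + 1) * F ^ h * n := by
    unfold nodeSize
    ring
  have h2 : idx * nodeSize n F h = idx * F ^ h * n := by
    unfold nodeSize
    ring
  rw [h1, h2, activeLeaves, Nat.sub_mul]
  have h3 : min ((idx + 1) * F ^ h) A * n = min ((idx + 1) * F ^ h * n) (A * n) :=
    (min_mul_of_nonneg _ _ (Nat.zero_le n))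
  have h4 : min (idx * F ^ h) A * n = min (idx * F ^ h * n) (A * n) :=
    (min_mul_of_nonneg _ _ (Nat.zero_le n))
  omega

/-- The lists when the node `idx` of level `h` is entered. -/
structure Ready (S : IntervalRep V) (χ n F h idx : ℕ) (L : ℕ → Finset ℕ) : Prop where
  inList : L (inName h idx) = incoming S χ (idx * nodeSize n F h) (idx * nodeSize n F h)
    ((idx + 1) * nodeSize n F h)
  outList : ∀ i ∈ L (outName h idx), i < idx * nodeSize n F h
  empty : ∀ ν, level ν < h → idx * nodeSize n F h ≤ nodeStart n F ν → L ν = ∅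

/-- How the lists have changed when the node `idx` of level `h` is left. -/
structure Left (S : IntervalRep V) (χ n F h idx : ℕ) (L L' : ℕ → Finset ℕ) : Prop where
  outList : ∀ i, i ∈ L' (outName h idx) ↔ i ∈ L (outName h idx) ∨
    (i ∈ outgoing S χ (idx * nodeSize n F h) ((idx + 1) * nodeSize n F h) ∧ S.next χ i < V)
  same : ∀ ν, h ≤ level ν → ν ≠ outName h idx → L' ν = L ν
  empty : ∀ ν, level ν < h → (idx + 1) * nodeSize n F h ≤ nodeStart n F ν → L' ν = ∅

/-- The lists after the first `q` children of the node `idx` of level `h + 1`. -/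
structure Between (S : IntervalRep V) (χ n F h idx q : ℕ) (L L' : ℕ → Finset ℕ) : Prop where
  inList : ∀ c, idx * F + q ≤ c → c < (idx + 1) * F → L' (inName h c) =
    incoming S χ ((idx * F + q) * nodeSize n F h) (c * nodeSize n F h) ((c + 1) * nodeSize n F h)
  outList : ∀ i, i ∈ L' (outName (h + 1) idx) ↔ i ∈ L (outName (h + 1) idx) ∨ (i < V ∧
    idx * nodeSize n F (h + 1) ≤ i ∧ i < (idx * F + q) * nodeSize n F h ∧
    (idx + 1) * nodeSize n F (h + 1) ≤ S.next χ i ∧ S.next χ i < V)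
  same : ∀ ν, h < level ν → ν ≠ outName (h + 1) idx → L' ν = L ν
  empty : ∀ ν, level ν ≤ h → (idx * F + q) * nodeSize n F h ≤ nodeStart n F ν →
    (∀ c, idx * F + q ≤ c → c < (idx + 1) * F → ν ≠ inName h c) → L' ν = ∅

/-- Where messages go in the node `idx` of level `h + 1`. -/
def route (n F h idx τ : ℕ) : ℕ :=
  if τ < (idx + 1) * nodeSize n F (h + 1) then inName h (τ / nodeSize n F h) else outName (h + 1) idx

/-- The lists to which messages go in the node `idx` of level `h + 1`. -/
def routes (F h idx : ℕ) : Finset ℕ :=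
  insert (outName (h + 1) idx) ((Finset.range F).image fun j => inName h (idx * F + j))

lemma card_routes_le (F h idx : ℕ) : (routes F h idx).card ≤ F + 1 := by
  refine (Finset.card_insert_le _ _).trans (Nat.add_le_add_right ?_ 1)
  exact Finset.card_image_le.trans (Finset.card_range F).le

lemma mem_appendLists {S : IntervalRep V} {β : ℕ → ℕ} {A : Finset ℕ} {L : ℕ → Finset ℕ} {b i : ℕ} :
    i ∈ appendLists S χ β A L b ↔ i ∈ L b ∨ i ∈ A ∧ S.next χ i < V ∧ β (S.next χ i) = b := by
  simp [appendLists]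

/-! ### The lists while one inner node is processed. -/

section Node

variable {n F h idx : ℕ} (hn : 0 < n) (hF : 2 ≤ F)
include hn hF

lemma route_mem {τ : ℕ} (hτ : idx * nodeSize n F (h + 1) ≤ τ) : route n F h idx τ ∈ routes F h idx := by
  have hs := nodeSize_pos hn hF h
  unfold route routes
  split_ifs with hlt
  · refine Finset.mem_insert_of_mem (Finset.mem_image.2 ⟨τ / nodeSize n F h - idx * F, ?_, ?_⟩)
    · rw [nodeSize_succ, ← mul_assoc] at hlt
      have := (Nat.div_lt_iff_lt_mul hs).2 hlt
      rw [add_mul, one_mul] at this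
      rw [Finset.mem_range]
      omega
    · rw [nodeSize_succ, ← mul_assoc] at hτ
      have := (Nat.le_div_iff_mul_le hs).2 hτ
      simp only [inName_inj, true_and]
      omega
  · exact Finset.mem_insert_self _ _

lemma route_eq_inName_iff {τ c : ℕ} : route n F h idx τ = inName h c ↔
    τ < (idx + 1) * nodeSize n F (h + 1) ∧ c * nodeSize n F h ≤ τ ∧ τ < (c + 1) * nodeSize n F h := by
  have hs := nodeSize_pos hn hF h
  unfold route
  split_ifs with hlt
  · rw [inName_inj, ← Nat.le_div_iff_mul_le hs, ← Nat.div_lt_iff_lt_mul hs]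
    omega
  · simp [hlt]

omit hn hF in
lemma route_eq_outName_iff {τ : ℕ} : route n F h idx τ = outName (h + 1) idx ↔
    (idx + 1) * nodeSize n F (h + 1) ≤ τ := by
  unfold route
  split_ifs with hlt
  · simp [hlt]
  · simpa using hlt

omit hn hF in
lemma route_cases (τ : ℕ) : (∃ c, route n F h idx τ = inName h c) ∨
    route n F h idx τ = outName (h + 1) idx := by
  unfold route
  split_ifs with hlt
  · exact .inl ⟨_, rfl⟩
  · exact .inr rfl

lemma child_lt {τ c : ℕ} (h₁ : τ < (idx + 1) * nodeSize n F (h + 1)) (h₂ : c * nodeSize n F h ≤ τ) :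
    c < (idx + 1) * F := by
  have hs := nodeSize_pos hn hF h
  rw [nodeSize_succ, ← mul_assoc] at h₁
  exact lt_of_mul_lt_mul_right (h₂.trans_lt h₁) hs.le

/-- The incoming messages are split according to the child that contains the target. The lists of
the children were empty before, so nothing else is in them. -/
lemma Ready.between {S : IntervalRep V} {L : ℕ → Finset ℕ} (hL : Ready S χ n F (h + 1) idx L) :
    Between S χ n F h idx 0 L (appendLists S χ (route n F h idx) (L (inName (h + 1) idx)) L) := by
  have hs := nodeSize_pos hn hF h
  have ha : idx * nodeSize n F (h + 1) = (idx * F + 0) * nodeSize n F h := by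
    rw [nodeSize_succ]
    ring
  refine ⟨fun c hc hc' => ?_, fun i => ?_, fun ν hν hne => ?_, fun ν hν hst hne => ?_⟩
  · have he : L (inName h c) = ∅ := by
      refine hL.empty _ (by simp) ?_
      rw [nodeStart_inName, ha]
      exact Nat.mul_le_mul_right _ hc
    have h1 : (idx * F + 0) * nodeSize n F h ≤ c * nodeSize n F h := Nat.mul_le_mul_right _ hc
    have h2 : (c + 1) * nodeSize n F h ≤ (idx + 1) * nodeSize n F (h + 1) := by
      rw [nodeSize_succ, ← mul_assoc]
      exact Nat.mul_le_mul_right _ hc'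
    ext i
    rw [mem_appendLists, he, hL.inList, mem_incoming, mem_incoming, route_eq_inName_iff hn hF, ha]
    simp only [Finset.notMem_empty, false_or]
    omega
  · rw [mem_appendLists, hL.inList, mem_incoming, route_eq_outName_iff, ha]
    refine or_congr_right ?_
    omega
  · ext i
    rw [mem_appendLists]
    refine or_iff_left fun hi => ?_
    rcases route_cases (n := n) (F := F) (h := h) (idx := idx) (S.next χ i) with ⟨c, hc⟩ | hc
    · rw [hi.2.2] at hc
      rw [hc] at hν
      simp at hν
    · exact hne (hi.2.2.symm.trans hc)
  · ext i
    rw [mem_appendLists, hL.empty ν (by omega) (ha ▸ hst), hL.inList, mem_incoming]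
    simp only [Finset.notMem_empty, false_or, iff_false]
    rintro ⟨hi, -, hb⟩
    rcases route_cases (n := n) (F := F) (h := h) (idx := idx) (S.next χ i) with ⟨c, hc⟩ | hc
    · have h3 := (route_eq_inName_iff hn hF).1 hc
      rw [hb] at hc
      rw [hc, nodeStart_inName] at hst
      exact hne c (Nat.le_of_mul_le_mul_right hst hs) (child_lt hn hF h3.1 h3.2.1) hc
    · rw [hb] at hc
      rw [hc] at hν
      simp at hν

omit hn hF in
lemma Between.out_eq_empty {S : IntervalRep V} {L L' : ℕ → Finset ℕ} {q : ℕ}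
    (hL : Between S χ n F h idx q L L') : L' (outName h (idx * F + q)) = ∅ :=
  hL.empty _ (by simp) (by simp) (by simp)

omit hn hF in
lemma Between.ready {S : IntervalRep V} {L L' : ℕ → Finset ℕ} {q : ℕ}
    (hL : Between S χ n F h idx q L L') (hq : q < F) : Ready S χ n F h (idx * F + q) L' := by
  refine ⟨hL.inList _ le_rfl (by rw [add_mul]; omega), ?_, fun ν hν hst => ?_⟩
  · simp [hL.out_eq_empty]
  · refine hL.empty ν hν.le hst fun c _ _ hc => ?_
    rw [hc] at hν
    simp at hν

omit hn hF in
lemma Between.mem_out {S : IntervalRep V} {L L' L'' : ℕ → Finset ℕ} {q : ℕ}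
    (hL : Between S χ n F h idx q L L') (hL' : Left S χ n F h (idx * F + q) L' L'') {i : ℕ} :
    i ∈ L'' (outName h (idx * F + q)) ↔ (i < V ∧ (idx * F + q) * nodeSize n F h ≤ i ∧
      i < (idx * F + q + 1) * nodeSize n F h ∧ (idx * F + q + 1) * nodeSize n F h ≤ S.next χ i) ∧
      S.next χ i < V := by
  rw [hL'.outList, hL.out_eq_empty, mem_outgoing]
  simp

/-- The lists of later children and the outgoing list of the node still contain only messages sent
before child `q` begins, whereas `i` lies in child `q`. -/
lemma Between.notMem {S : IntervalRep V} {L L' L'' : ℕ → Finset ℕ} {q : ℕ}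
    (h₀ : Ready S χ n F (h + 1) idx L) (hL : Between S χ n F h idx q L L')
    (hL' : Left S χ n F h (idx * F + q) L' L'') (i : ℕ)
    (hi : i ∈ L'' (outName h (idx * F + q))) :
    i ∉ L'' (route n F h idx (S.next χ i)) := by
  have ha : idx * nodeSize n F (h + 1) ≤ (idx * F + q) * nodeSize n F h := by
    rw [nodeSize_succ, ← mul_assoc]
    exact Nat.mul_le_mul_right _ (by omega)
  have hs := nodeSize_pos hn hF h
  rw [hL.mem_out hL'] at hi
  rcases route_cases (n := n) (F := F) (h := h) (idx := idx) (S.next χ i) with ⟨c, hc⟩ | hc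
  · have h3 := (route_eq_inName_iff hn hF).1 hc
    have h4 : idx * F + q + 1 < c + 1 :=
      lt_of_mul_lt_mul_right (hi.1.2.2.2.trans_lt h3.2.2) hs.le
    rw [hc, hL'.same _ (by simp) (by simp), hL.inList c (by omega) (child_lt hn hF h3.1 h3.2.1),
      mem_incoming]
    omega
  · rw [hc, hL'.same _ (by simp) (by simp), hL.outList]
    rintro (h5 | h5)
    · have := h₀.outList i h5
      omega
    · omega

/-- Messages from before child `q` and messages from child `q` together are the messages from before
child `q + 1`. -/
lemma Between.succ {S : IntervalRep V} {L L' L'' : ℕ → Finset ℕ} {q : ℕ}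
    (hL : Between S χ n F h idx q L L') (hq : q < F) (hL' : Left S χ n F h (idx * F + q) L' L'') :
    Between S χ n F h idx (q + 1) L
      (appendLists S χ (route n F h idx) (L'' (outName h (idx * F + q))) L'') := by
  have hs := nodeSize_pos hn hF h
  have ha : idx * nodeSize n F (h + 1) ≤ (idx * F + q) * nodeSize n F h := by
    rw [nodeSize_succ, ← mul_assoc]
    exact Nat.mul_le_mul_right _ (by omega)
  have hb : (idx * F + q) * nodeSize n F h ≤ (idx * F + q + 1) * nodeSize n F h :=
    Nat.mul_le_mul_right _ (by omega)
  have he : (idx * F + q + 1) * nodeSize n F h ≤ (idx + 1) * nodeSize n F (h + 1) := by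
    rw [nodeSize_succ, ← mul_assoc]
    exact Nat.mul_le_mul_right _ (by rw [add_mul]; omega)
  refine ⟨fun c hc hc' => ?_, fun i => ?_, fun ν hν hne => ?_, fun ν hν hst hne => ?_⟩
  · have h1 : (idx * F + q + 1) * nodeSize n F h ≤ c * nodeSize n F h := Nat.mul_le_mul_right _ hc
    have h2 : (c + 1) * nodeSize n F h ≤ (idx + 1) * nodeSize n F (h + 1) := by
      rw [nodeSize_succ, ← mul_assoc]
      exact Nat.mul_le_mul_right _ hc'
    ext i
    rw [mem_appendLists, hL'.same _ (by simp) (by simp), hL.inList c (by omega) hc', hL.mem_out hL',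
      mem_incoming, mem_incoming, route_eq_inName_iff hn hF, ← add_assoc]
    omega
  · rw [mem_appendLists, hL'.same _ (by simp) (by simp), hL.outList, hL.mem_out hL',
      route_eq_outName_iff, or_assoc, ← add_assoc]
    refine or_congr_right ?_
    omega
  · have h1 : L'' ν = L ν := by
      rw [hL'.same ν hν.le fun hc => ?_, hL.same ν hν hne]
      rw [hc] at hν
      simp at hν
    ext i
    rw [mem_appendLists, h1]
    refine or_iff_left fun hi => ?_
    rcases route_cases (n := n) (F := F) (h := h) (idx := idx) (S.next χ i) with ⟨c, hc⟩ | hc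
    · rw [hi.2.2] at hc
      rw [hc] at hν
      simp at hν
    · exact hne (hi.2.2.symm.trans hc)
  · rw [← add_assoc] at hst hne
    have hlt : (idx * F + q) * nodeSize n F h < (idx * F + q + 1) * nodeSize n F h :=
      Nat.mul_lt_mul_of_pos_right (by omega) hs
    have h1 : L'' ν = ∅ := by
      rcases hν.lt_or_eq with h | h
      · exact hL'.empty ν h hst
      · rw [hL'.same ν h.ge]
        · refine hL.empty ν hν (hb.trans hst) fun c hc hc' hν' => ?_
          rw [hν', nodeStart_inName] at hst
          exact hne c (Nat.le_of_mul_le_mul_right hst hs) hc' hν'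
        · intro hc
          rw [hc, nodeStart_outName] at hst
          omega
    ext i
    rw [mem_appendLists, h1, hL.mem_out hL']
    simp only [Finset.notMem_empty, false_or, iff_false]
    rintro ⟨hi, -, hb⟩
    rcases route_cases (n := n) (F := F) (h := h) (idx := idx) (S.next χ i) with ⟨c, hc⟩ | hc
    · have h3 := (route_eq_inName_iff hn hF).1 hc
      rw [hb] at hc
      rw [hc, nodeStart_inName] at hst
      exact hne c (Nat.le_of_mul_le_mul_right hst hs) (child_lt hn hF h3.1 h3.2.1) hc
    · rw [hb] at hc
      rw [hc] at hν
      simp at hν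

omit hn hF in
lemma Between.left {S : IntervalRep V} {L L' : ℕ → Finset ℕ} (hL : Between S χ n F h idx F L L') :
    Left S χ n F (h + 1) idx L L' := by
  have hb : (idx * F + F) * nodeSize n F h = (idx + 1) * nodeSize n F (h + 1) := by
    rw [nodeSize_succ]
    ring
  refine ⟨fun i => ?_, fun ν hν hne => hL.same ν hν hne, fun ν hν hst => ?_⟩
  · rw [hL.outList, mem_outgoing, hb]
    refine or_congr_right ?_
    omega
  · refine hL.empty ν (by omega) (hb ▸ hst) fun c hc hc' => ?_
    rw [add_mul] at hc'
    omega

end Node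

lemma Store.mono {S : IntervalRep V} {L : ℕ → Finset ℕ} {d e : ℕ} {D : ℕ → Cell}
    (h : Store P S χ L d D) (hd : V ≤ d) : Store P S χ L e D :=
  ⟨⟨h.base.partner, h.base.palette, fun i hi _ => h.base.done i hi (hi.trans_le hd)⟩, h.lists⟩

/-- The number of transfers charged to a leaf, on each level. -/
def leafCost (P : EMParams) (n F : ℕ) : ℕ := 7 * (n / P.B) + 6 * F + 21

/-- The addresses of all lists are bounded. -/
def NamesBelow (P : EMParams) (V F U : ℕ) : Prop :=
  ∀ h idx, h ≤ V → idx < V + F → (3 * inName h idx + 4) * arrayCap P V ≤ U ∧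
    (3 * outName h idx + 4) * arrayCap P V ≤ U

/-- A level adds two distributions, one of the incoming list of the node and one of the outgoing
lists of its children, each paid by the active leaves below: `(2 * h + 1) + 1 + 1 = 2 * (h + 1) +
1`. The ghost type is quantified inside the induction because the lists in force at a child become
ghosts when the induction hypothesis is applied. -/
theorem performs_node {n F A : ℕ} (hn : 0 < n) (hnl : n ≤ P.lanes) (hF : 2 ≤ F) (hA : V ≤ A * n)
    (h : ℕ) (hh : h ≤ V) : ∀ (idx : ℕ) {Y : Type}
    (I : Y → Inst P V χ) (L : Y → ℕ → Finset ℕ) (_ : ∀ y, NamesBelow P V F (I y).U)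
    (_ : ∀ y, Ready (I y).S χ n F h idx (L y)),
    Performs (leafCost P n F * (2 * h + 1) * activeLeaves F A h idx) I
      (fun y s => Good (I y).U χ s ∧ Store P (I y).S χ (L y) (idx * nodeSize n F h) s.disk)
      (fun y s => Good (I y).U χ s ∧ ∃ L', Left (I y).S χ n F h idx (L y) L' ∧
        Store P (I y).S χ L' ((idx + 1) * nodeSize n F h) s.disk) := by
  induction h with
  | zero =>
    intro idx Y I L hU hL
    have hsz : nodeSize n F 0 = n := by simp [nodeSize]
    by_cases hst : idx * nodeSize n F 0 < V
    · have hidx : idx < V := by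
        rw [hsz] at hst
        exact (Nat.le_mul_of_pos_right _ hn).trans_lt hst
      have hact : activeLeaves F A 0 idx = 1 := by
        have : idx < A := by
          by_contra! h
          rw [hsz] at hst
          have := Nat.mul_le_mul_right n h
          omega
        simp only [activeLeaves, pow_zero, mul_one]
        omega
      refine ((performs_leaf I L (idx * nodeSize n F 0) n (inName 0 idx) (outName 0 idx) hnl hst
        (fun y => (hU y 0 idx hh (by omega)).1) (fun y => (hU y 0 idx hh (by omega)).2)
        (fun y => ?_) (fun y => (hL y).outList)).mono ?_).conseq fun y s hs =>
          ⟨y, rfl, rfl, hs, fun s' hs' => ⟨hs'.1, appendLists (I y).S χ (fun _ => outName 0 idx)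
            (outgoing (I y).S χ (idx * nodeSize n F 0) (idx * nodeSize n F 0 + n)) (L y), ?_, ?_⟩⟩
      · rw [(hL y).inList]
        congr 1
        rw [hsz]
        ring
      · rw [hact, leafCost]
        omega
      · have he : (idx + 1) * nodeSize n F 0 = idx * nodeSize n F 0 + n := by
          rw [hsz]
          ring
        refine ⟨fun i => ?_, fun ν _ hne => ?_, fun ν hν => absurd hν (Nat.not_lt_zero _)⟩
        · rw [mem_appendLists, he]
          simp
        · ext i
          rw [mem_appendLists]
          exact or_iff_left fun h => hne h.2.2.symm
      · have he : (idx + 1) * nodeSize n F 0 = idx * nodeSize n F 0 + n := by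
          rw [hsz]
          ring
        rw [he]
        exact hs'.2
    · refine (Achieves.skip (Pre := fun y s => Good (I y).U χ s ∧
        Store P (I y).S χ (L y) (idx * nodeSize n F 0) s.disk) fun y s hs =>
          ⟨hs.1.bdd, hs.1.scalar, hs.1, L y, ?_, hs.2.mono (by omega)⟩).mono (Nat.zero_le _)
      refine ⟨fun i => (or_iff_left fun h => ?_).symm, fun ν _ _ => rfl,
        fun ν hν => absurd hν (Nat.not_lt_zero _)⟩
      have := mem_outgoing.1 h.1
      omega
  | succ h ih =>
    intro idx Y I L hU hL
    -- A node beyond the last interval is skipped without any operation.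
    by_cases hst : idx * nodeSize n F (h + 1) < V
    swap
    · refine (Achieves.skip (Pre := fun y s => Good (I y).U χ s ∧
        Store P (I y).S χ (L y) (idx * nodeSize n F (h + 1)) s.disk) fun y s hs =>
          ⟨hs.1.bdd, hs.1.scalar, hs.1, L y, ?_, hs.2.mono (by omega)⟩).mono (Nat.zero_le _)
      refine ⟨fun i => (or_iff_left fun h => ?_).symm, fun ν _ _ => rfl, fun ν hν hs' => ?_⟩
      · have := mem_outgoing.1 h.1
        omega
      · refine (hL y).empty ν hν (le_trans (Nat.mul_le_mul_right _ (by omega)) hs')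
    have hs := nodeSize_pos hn hF h
    have hidx : idx * F < V := by
      rw [nodeSize_succ, ← mul_assoc] at hst
      exact (Nat.le_mul_of_pos_right _ hs).trans_lt hst
    have hidx' : idx < V := (Nat.le_mul_of_pos_right _ (by omega)).trans_lt hidx
    have hbs : ∀ y, ∀ b ∈ routes F h idx, (3 * b + 4) * arrayCap P V ≤ (I y).U := by
      intro y b hb
      simp only [routes, Finset.mem_insert, Finset.mem_image, Finset.mem_range] at hb
      rcases hb with rfl | ⟨j, hj, rfl⟩
      · exact (hU y _ _ hh (by omega)).2
      · exact (hU y _ _ (by omega) (by omega)).1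
    have hcard := card_routes_le F h idx
    have hcost : 4 * (n / P.B) + 6 * (routes F h idx).card + 7 ≤ leafCost P n F := by
      unfold leafCost
      omega
    let Inv : ℕ → Y → LaneState P → Prop := fun q y s => Good (I y).U χ s ∧ ∃ L',
      Between (I y).S χ n F h idx q (L y) L' ∧
      Store P (I y).S χ L' ((idx * F + q) * nodeSize n F h) s.disk
    have ha : idx * nodeSize n F (h + 1) = (idx * F + 0) * nodeSize n F h := by
      rw [nodeSize_succ]
      ring
    have hb : (idx * F + F) * nodeSize n F h = (idx + 1) * nodeSize n F (h + 1) := by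
      rw [nodeSize_succ]
      ring
    have h₁ : Performs (activeLeaves F A (h + 1) idx * leafCost P n F) I
        (fun y s => Good (I y).U χ s ∧
          Store P (I y).S χ (L y) (idx * nodeSize n F (h + 1)) s.disk) (Inv 0) := by
      refine ((performs_distribute I L (fun _ => idx * nodeSize n F (h + 1)) (inName (h + 1) idx)
        (route n F h idx) (routes F h idx) n (activeLeaves F A (h + 1) idx) hnl hbs
        (fun y => (hU y _ _ hh (by omega)).1) ?_ ?_ ?_).mono
          (Nat.mul_le_mul_left _ hcost)).conseq fun y s hs =>
          ⟨y, rfl, rfl, hs, fun s' hs' => ⟨hs'.1, _, (hL y).between hn hF, ha ▸ hs'.2⟩⟩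
      · simp [routes]
      · intro y i hi _
        rw [(hL y).inList, mem_incoming] at hi
        refine ⟨route_mem hn hF hi.2.2.1, ?_⟩
        rcases route_cases (n := n) (F := F) (h := h) (idx := idx) ((I y).S.next χ i) with
          ⟨c, hc⟩ | hc
        · rw [hc, (hL y).empty _ (by simp)]
          · simp
          · have h3 := (route_eq_inName_iff hn hF).1 hc
            rw [nodeStart_inName, ha]
            refine Nat.mul_le_mul_right _ ?_
            have := lt_of_mul_lt_mul_right ((ha ▸ hi.2.2.1).trans_lt h3.2.2) hs.le
            omega
        · rw [route_eq_outName_iff] at hc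
          omega
      · intro y
        rw [(hL y).inList]
        -- The list is bounded through its targets, which lie in the node.
        exact (card_incoming_le _ _ _ _).trans (min_sub_le_activeLeaves hA _ _)
    have h₂ : Performs (∑ q ∈ Finset.range F,
        leafCost P n F * (2 * h + 2) * activeLeaves F A h (idx * F + q)) I (Inv 0) (Inv F) := by
      refine Achieves.loop Inv _ F (fun y s hs => ⟨hs.1.bdd, hs.1.scalar⟩) fun q hq => ?_
      let G := { z : Y × (ℕ → Finset ℕ) // Between (I z.1).S χ n F h idx q (L z.1) z.2 }
      have g₁ := ih (by omega) (idx * F + q) (fun z : G => I z.1.1) (fun z => z.1.2)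
        (fun z => hU z.1.1) fun z => z.2.ready hq
      let G' := { z : G × (ℕ → Finset ℕ) //
        Left (I z.1.1.1).S χ n F h (idx * F + q) z.1.1.2 z.2 }
      have g₂ := performs_distribute (fun z : G' => I z.1.1.1.1) (fun z => z.1.2)
        (fun _ => (idx * F + q + 1) * nodeSize n F h) (outName h (idx * F + q))
        (route n F h idx) (routes F h idx) n (activeLeaves F A h (idx * F + q)) hnl
        (fun z => hbs z.1.1.1.1) (fun z => (hU z.1.1.1.1 _ _ (by omega) (by omega)).2)
        (by simp [routes]) (fun z i hi _ => ⟨?_, z.1.1.2.notMem hn hF (hL _) z.2 i hi⟩)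
        (fun z => ?_)
      · refine (((g₁.conseq (Y := Y) (U' := fun y => (I y).U) (Z' := fun _ z => z = χ)
          (Pre' := Inv q) (Post' := fun y s => Good (I y).U χ s ∧ ∃ z : G', z.1.1.1.1 = y ∧
            Store P (I y).S χ z.1.2 ((idx * F + q + 1) * nodeSize n F h) s.disk) ?_).trans
          (g₂.conseq (Y := Y) (U' := fun y => (I y).U) (Z' := fun _ z => z = χ)
          (Post' := Inv (q + 1)) ?_)).mono ?_)
        · rintro y s ⟨hs, L', hL', hst'⟩
          exact ⟨⟨(y, L'), hL'⟩, rfl, rfl, ⟨hs, hst'⟩,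
            fun s' ⟨hs', L'', hL'', hst''⟩ => ⟨hs', ⟨(⟨(y, L'), hL'⟩, L''), hL''⟩, rfl, hst''⟩⟩
        · rintro y s ⟨hs, z, rfl, hst'⟩
          exact ⟨z, rfl, rfl, ⟨hs, hst'⟩,
            fun s' hs' => ⟨hs'.1, _, z.1.1.2.succ hn hF hq z.2, hs'.2⟩⟩
        · calc _ ≤ leafCost P n F * (2 * h + 1) * activeLeaves F A h (idx * F + q) +
              activeLeaves F A h (idx * F + q) * leafCost P n F :=
                Nat.add_le_add_left (Nat.mul_le_mul_left _ hcost) _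
            _ = _ := by ring
      · have h1 := (z.1.1.2.mem_out z.2).1 hi
        refine route_mem hn hF ?_
        rw [ha]
        have h2 : (idx * F + 0) * nodeSize n F h ≤ (idx * F + q + 1) * nodeSize n F h :=
          Nat.mul_le_mul_right _ (by omega)
        omega
      -- The outgoing list of a child is bounded through its senders, which lie in the child.
      · refine le_trans ?_ (min_sub_le_activeLeaves hA h (idx * F + q))
        rw [← Nat.card_Ico]
        refine Finset.card_le_card fun i hi => ?_
        have h1 := (z.1.1.2.mem_out z.2).1 hi
        rw [Finset.mem_Ico]
        omega
    rw [← Finset.mul_sum, sum_activeLeaves_children] at h₂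
    refine ((h₁.trans h₂).mono (by apply le_of_eq; ring)).conseq fun y s hs =>
      ⟨y, rfl, rfl, hs, ?_⟩
    rintro s' ⟨hs', L', hL', hst'⟩
    exact ⟨hs', L', hL'.left, hb ▸ hst'⟩

end Recursion

/-! ### The sequence of nodes of the highest level. -/

section TopLevel

variable {P : EMParams} {V χ : ℕ}

/-- The lists when the node `q` of the highest level is entered. -/
structure TopReady (S : IntervalRep V) (χ n F h q : ℕ) (L : ℕ → Finset ℕ) : Prop where
  ready : Ready S χ n F h q L
  outList : L (outName h q) =
    incoming S χ (q * nodeSize n F h) ((q + 1) * nodeSize n F h) V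
  later : ∀ ν, level ν = h → (q + 1) * nodeSize n F h ≤ nodeStart n F ν → L ν = ∅

/-- Where messages go after the node `q` of the highest level. -/
def topRoute (n F h q τ : ℕ) : ℕ :=
  if τ < (q + 1 + 1) * nodeSize n F h then inName h (q + 1) else outName h (q + 1)

lemma topReady_empty (S : IntervalRep V) (n F h : ℕ) : TopReady S χ n F h 0 fun _ => ∅ := by
  refine ⟨⟨?_, ?_, fun _ _ _ => rfl⟩, ?_, fun _ _ _ => rfl⟩
  · ext i
    simp [mem_incoming]
  · simp
  · ext i
    simp [mem_incoming]

/-- The outgoing list already held the earlier messages that pass over the whole node, and the node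
has added its own. The result is everything that crosses its end, except messages without a target.
-/
lemma mem_top_out {S : IntervalRep V} {n F h q : ℕ} {L L' : ℕ → Finset ℕ}
    (hL : TopReady S χ n F h q L) (hL' : Left S χ n F h q L L') {i : ℕ} : i ∈ L' (outName h q) ↔
      i < V ∧ i < (q + 1) * nodeSize n F h ∧ (q + 1) * nodeSize n F h ≤ S.next χ i ∧
        S.next χ i < V := by
  have h1 : q * nodeSize n F h ≤ (q + 1) * nodeSize n F h := Nat.mul_le_mul_right _ (by omega)
  rw [hL'.outList, hL.outList, mem_incoming, mem_outgoing]
  omega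

lemma TopReady.succ {S : IntervalRep V} {n F h q : ℕ} {L L' : ℕ → Finset ℕ} (hn : 0 < n)
    (hF : 2 ≤ F) (hL : TopReady S χ n F h q L) (hL' : Left S χ n F h q L L') :
    TopReady S χ n F h (q + 1) (appendLists S χ (topRoute n F h q) (L' (outName h q)) L') := by
  have hs := nodeSize_pos hn hF h
  have h1 : (q + 1) * nodeSize n F h < (q + 1 + 1) * nodeSize n F h :=
    Nat.mul_lt_mul_of_pos_right (by omega) hs
  have h2 : q * nodeSize n F h < (q + 1) * nodeSize n F h :=
    Nat.mul_lt_mul_of_pos_right (by omega) hs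
  have h3 : L' (inName h (q + 1)) = ∅ := by
    rw [hL'.same _ (by simp) (by simp)]
    exact hL.later _ (by simp) (by simp)
  have h4 : L' (outName h (q + 1)) = ∅ := by
    rw [hL'.same _ (by simp) (by simp)]
    exact hL.later _ (by simp) (by simp)
  have h5 : ∀ i, i ∈ appendLists S χ (topRoute n F h q) (L' (outName h q)) L' (outName h (q + 1)) ↔
      i < V ∧ i < (q + 1) * nodeSize n F h ∧ (q + 1 + 1) * nodeSize n F h ≤ S.next χ i ∧
        S.next χ i < V := by
    intro i
    rw [mem_appendLists, h4, mem_top_out hL hL', topRoute]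
    split_ifs with hlt
    · simp only [Finset.notMem_empty, inName_ne_outName, and_false, or_self, false_iff]
      omega
    · simp only [Finset.notMem_empty, and_true, false_or]
      omega
  refine ⟨⟨?_, fun i hi => ?_, fun ν hν hst => ?_⟩, ?_, fun ν hν hst => ?_⟩
  · ext i
    rw [mem_appendLists, h3, mem_top_out hL hL', mem_incoming, topRoute]
    split_ifs with hlt
    · simp only [Finset.notMem_empty, and_true, false_or]
      omega
    · simp only [Finset.notMem_empty, outName_ne_inName, and_false, or_self, false_iff]
      omega
  · exact ((h5 i).1 hi).2.1
  · ext i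
    rw [mem_appendLists, hL'.empty ν hν hst, topRoute]
    simp only [Finset.notMem_empty, false_or, iff_false]
    rintro ⟨-, -, hb⟩
    split_ifs at hb <;> simp [← hb] at hν
  · ext i
    rw [h5, mem_incoming]
    omega
  · have hne : ∀ ν', level ν' = h → nodeStart n F ν' < (q + 1 + 1) * nodeSize n F h → ν ≠ ν' := by
      rintro ν' - h6 rfl
      omega
    ext i
    rw [mem_appendLists, hL'.same ν hν.ge (hne _ (by simp) (by simpa using h2.trans h1)),
      hL.later ν hν (h1.le.trans hst), topRoute]
    simp only [Finset.notMem_empty, false_or, iff_false]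
    rintro ⟨-, -, hb⟩
    split_ifs at hb
    · exact hne _ (by simp) (by simpa using h1) hb.symm
    · exact hne _ (by simp) (by simpa using h1) hb.symm

/-- A message may be handed on through many nodes of the highest level, but only `χ` at a time cross
a boundary, and a node has at least `χ` intervals. So handing on costs no more than one further pass
over each node. -/
theorem performs_colouring {n F A h : ℕ} (hn : 0 < n) (hnl : n ≤ P.lanes) (hF : 2 ≤ F)
    (hA : V ≤ A * n) (hAV : A ≤ V) (hh : h ≤ V) (hχ : χ ≤ nodeSize n F h) {Y : Type}
    (I : Y → Inst P V χ) (hU : ∀ y, NamesBelow P V F (I y).U) :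
    Performs (leafCost P n F * (2 * h + 2) * A) I
      (fun y s => Good (I y).U χ s ∧ Store P (I y).S χ (fun _ => ∅) 0 s.disk)
      (fun y s => ∀ i < V, s.disk (4 * V + i) = .colour ((I y).S.fifo χ i)) := by
  have hs := nodeSize_pos hn hF h
  let Inv : ℕ → Y → LaneState P → Prop := fun q y s => Good (I y).U χ s ∧ ∃ L,
    TopReady (I y).S χ n F h q L ∧ Store P (I y).S χ L (q * nodeSize n F h) s.disk
  -- No more nodes than leaves are needed, and the sum over the nodes telescopes to at most `A`
  -- leaves.
  have key : Performs (∑ q ∈ Finset.range A,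
      leafCost P n F * (2 * h + 2) * activeLeaves F A h (0 + q)) I (Inv 0) (Inv A) := by
    refine Achieves.loop Inv _ A (fun y s hs => ⟨hs.1.bdd, hs.1.scalar⟩) fun q hq => ?_
    rw [zero_add]
    let G := { z : Y × (ℕ → Finset ℕ) // TopReady (I z.1).S χ n F h q z.2 }
    have g₁ := performs_node hn hnl hF hA h hh q (fun z : G => I z.1.1) (fun z => z.1.2)
      (fun z => hU z.1.1) fun z => z.2.ready
    let G' := { z : G × (ℕ → Finset ℕ) // Left (I z.1.1.1).S χ n F h q z.1.1.2 z.2 }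
    have hbs : ∀ τ, topRoute n F h q τ ∈ ({inName h (q + 1), outName h (q + 1)} : Finset ℕ) := by
      intro τ
      unfold topRoute
      split_ifs <;> simp
    have hcard : ({inName h (q + 1), outName h (q + 1)} : Finset ℕ).card ≤ 2 := Finset.card_le_two
    have g₂ := performs_distribute (fun z : G' => I z.1.1.1.1) (fun z => z.1.2)
      (fun _ => (q + 1) * nodeSize n F h) (outName h q) (topRoute n F h q)
      {inName h (q + 1), outName h (q + 1)} n (activeLeaves F A h q) hnl
      (fun z b hb => ?_) (fun z => (hU z.1.1.1.1 _ _ hh (by omega)).2)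
      (by simp) (fun z i hi _ => ⟨hbs _, ?_⟩) (fun z => ?_)
    · refine (((g₁.conseq (Y := Y) (U' := fun y => (I y).U) (Z' := fun _ z => z = χ)
        (Pre' := Inv q) (Post' := fun y s => Good (I y).U χ s ∧ ∃ z : G', z.1.1.1.1 = y ∧
          Store P (I y).S χ z.1.2 ((q + 1) * nodeSize n F h) s.disk) ?_).trans
        (g₂.conseq (Y := Y) (U' := fun y => (I y).U) (Z' := fun _ z => z = χ)
        (Post' := Inv (q + 1)) ?_)).mono ?_)
      · rintro y s ⟨hs, L, hL, hst⟩
        exact ⟨⟨(y, L), hL⟩, rfl, rfl, ⟨hs, hst⟩,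
          fun s' ⟨hs', L', hL', hst'⟩ => ⟨hs', ⟨(⟨(y, L), hL⟩, L'), hL'⟩, rfl, hst'⟩⟩
      · rintro y s ⟨hs, z, rfl, hst⟩
        exact ⟨z, rfl, rfl, ⟨hs, hst⟩, fun s' hs' => ⟨hs'.1, _, z.1.1.2.succ hn hF z.2, hs'.2⟩⟩
      · have h6 : 4 * (n / P.B) + 6 * ({inName h (q + 1), outName h (q + 1)} : Finset ℕ).card + 7 ≤
            leafCost P n F := by
          unfold leafCost
          omega
        calc _ ≤ leafCost P n F * (2 * h + 1) * activeLeaves F A h q +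
              activeLeaves F A h q * leafCost P n F := Nat.add_le_add_left (Nat.mul_le_mul_left _ h6) _
          _ = _ := by ring
    · simp only [Finset.mem_insert, Finset.mem_singleton] at hb
      rcases hb with rfl | rfl
      · exact (hU z.1.1.1.1 _ _ hh (by omega)).1
      · exact (hU z.1.1.1.1 _ _ hh (by omega)).2
    · have h3 : ∀ ν, level ν = h → nodeStart n F ν = (q + 1) * nodeSize n F h → z.1.2 ν = ∅ := by
        intro ν hν hst
        rw [z.2.same ν hν.ge, z.1.1.2.later ν hν hst.ge]
        rintro rfl
        rw [nodeStart_outName] at hst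
        have := Nat.eq_of_mul_eq_mul_right hs hst
        omega
      unfold topRoute
      split_ifs
      · rw [h3 _ (by simp) (by simp)]
        simp
      · rw [h3 _ (by simp) (by simp)]
        simp
    -- If the node reaches beyond `V`, nothing leaves it; otherwise it is complete and its active
    -- leaves hold `nodeSize n F h ≥ χ` intervals.
    · by_cases hlt : (q + 1) * nodeSize n F h ≤ V
      · have h1 : (z.1.2 (outName h q)).card ≤ χ := by
          refine (I z.1.1.1.1).fits.card_crossing_le (t := (q + 1) * nodeSize n F h) _
            (fun i hi => ?_) hlt
          have := (mem_top_out z.1.1.2 z.2).1 hi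
          exact ⟨this.1, this.2.1, this.2.2.1⟩
        have h2 := min_sub_le_activeLeaves hA h q (F := F)
        rw [min_eq_left hlt, ← Nat.sub_mul, Nat.add_sub_cancel_left, one_mul] at h2
        exact (h1.trans hχ).trans h2
      · rw [Finset.card_eq_zero.2]
        · exact Nat.zero_le _
        · ext i
          rw [mem_top_out z.1.1.2 z.2]
          simp only [Finset.notMem_empty, iff_false]
          omega
  rw [← Finset.mul_sum, sum_activeLeaves] at key
  refine (key.mono (Nat.mul_le_mul_left _ ?_)).conseq fun y s hs => ⟨y, rfl, rfl, ?_, ?_⟩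
  · omega
  · exact ⟨hs.1, _, topReady_empty _ _ _ _, by simpa using hs.2⟩
  · rintro s' ⟨-, L, -, hst⟩ i hi
    refine hst.base.done i hi (hi.trans_le (hA.trans (Nat.mul_le_mul_left _ ?_)))
    exact Nat.le_mul_of_pos_right _ (Nat.pow_pos (by omega))

end TopLevel

/-! ### The upper bounds -/

section Costs

variable {P : EMParams} {V z N : ℕ}

/-- The number of children of a node. -/
def fan (P : EMParams) (V z : ℕ) : ℕ := if z ≤ leafSize P V then 2 else P.M / P.B

/-- The number of levels above the leaves. -/
def height (P : EMParams) (V z : ℕ) : ℕ :=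
  Nat.clog (fan P V z) ((z + leafSize P V - 1) / leafSize P V)

lemma two_le_fan : 2 ≤ fan P V z := by
  unfold fan
  split_ifs
  · exact le_rfl
  · exact (Nat.le_div_iff_mul_le P.B_pos).2 P.two_mul_le

lemma fan_le : fan P V z ≤ P.M := by
  unfold fan
  have := P.two_mul_le
  have := P.B_pos
  split_ifs
  · omega
  · exact Nat.div_le_self _ _

lemma le_nodeSize_height (hV : 0 < V) :
    z ≤ nodeSize (leafSize P V) (fan P V z) (height P V z) := by
  have hn := leafSize_pos (P := P) hV
  have h1 := Nat.le_pow_clog (b := fan P V z) two_le_fan ((z + leafSize P V - 1) / leafSize P V)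
  have h2 := Nat.div_add_mod (z + leafSize P V - 1) (leafSize P V)
  have h3 := Nat.mod_lt (z + leafSize P V - 1) hn
  have h4 := Nat.mul_le_mul_left (leafSize P V) h1
  unfold nodeSize height
  omega

/-- The height is minimal: with one level less, a node would be too small to hold `z` intervals. -/
lemma nodeSize_lt_of_height_eq (hV : 0 < V) {h : ℕ} (hh : height P V z = h + 1) :
    nodeSize (leafSize P V) (fan P V z) h < z := by
  have hn := leafSize_pos (P := P) hV
  have h1 : 1 < (z + leafSize P V - 1) / leafSize P V := by
    by_contra! hle
    rw [height, Nat.clog_of_right_le_one hle] at hh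
    omega
  have h2 := Nat.pow_pred_clog_lt_self (b := fan P V z) two_le_fan h1
  rw [← height, hh, Nat.pred_succ] at h2
  have h3 := Nat.mul_le_of_le_div _ _ _ (Nat.succ_le_of_lt h2)
  rw [Nat.succ_mul, mul_comm] at h3
  unfold nodeSize
  omega

lemma height_le (hV : 0 < V) (hz : z ≤ V) : height P V z ≤ V := by
  rcases h : height P V z with _ | h'
  · exact Nat.zero_le _
  · have h1 := nodeSize_lt_of_height_eq hV h
    have h2 : h' < fan P V z ^ h' := Nat.lt_pow_self two_le_fan
    have h3 : fan P V z ^ h' ≤ nodeSize (leafSize P V) (fan P V z) h' :=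
      Nat.le_mul_of_pos_left _ (leafSize_pos hV)
    omega

lemma leaves_le_card (hV : 0 < V) : leaves P V ≤ V := by
  have hn := leafSize_pos (P := P) hV
  refine (Nat.div_le_iff_le_mul_add_pred hn).2 ?_
  have := Nat.mul_le_mul_left V (Nat.succ_le_of_lt hn)
  rw [mul_comm V (leafSize P V)] at this
  omega

lemma leaves_mul_leafSize_le (hV : 0 < V) : leaves P V * leafSize P V ≤ 2 * V := by
  have h1 := Nat.div_mul_le_self (V + leafSize P V - 1) (leafSize P V)
  have h2 : leafSize P V ≤ V := min_le_right _ _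
  unfold leaves
  omega

/-- Either there is a single leaf, or every leaf has `P.lanes` intervals of capacity, which is at
least half a block. -/
lemma leaves_le (hV : 0 < V) (hN : V ≤ N * P.B) (hN' : 0 < N) : leaves P V ≤ 4 * N := by
  have hB := P.B_pos
  rcases le_or_gt V P.lanes with h | h
  · have h1 : leafSize P V = V := min_eq_right h
    have h2 : leaves P V = 1 := by
      rw [leaves, h1]
      exact Nat.div_eq_of_lt_le (by omega) (by omega)
    omega
  · have h1 : leafSize P V = P.lanes := min_eq_left h.le
    have h2 := leaves_mul_leafSize_le (P := P) hV
    have h3 := P.le_four_mul_lanes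
    have h4 := P.two_mul_le
    rw [h1] at h2
    have h5 : leaves P V * (2 * P.B) ≤ leaves P V * (4 * P.lanes) :=
      Nat.mul_le_mul_left _ (by omega)
    refine Nat.le_of_mul_le_mul_right (c := P.B) ?_ hB
    nlinarith

lemma leaves_mul_div_le (hV : 0 < V) (hN : V ≤ N * P.B) :
    leaves P V * (leafSize P V / P.B) ≤ 2 * N := by
  refine Nat.le_of_mul_le_mul_right (c := P.B) ?_ P.B_pos
  have h1 := leaves_mul_leafSize_le (P := P) hV
  have h2 := Nat.mul_le_mul_left (leaves P V) (Nat.div_mul_le_self (leafSize P V) P.B)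
  rw [mul_assoc, mul_assoc]
  omega

lemma leafSize_eq_lanes (hz : z ≤ V) (h : leafSize P V < z) : leafSize P V = P.lanes := by
  unfold leafSize at h ⊢
  omega

/-- The fan-out enters the cost once per leaf. `M / B` is affordable when leaves fill the lanes, for
then a leaf has about `M / B` blocks; for `z ≤ leafSize P V` this may fail, but no branching is
needed and `fan` is `2`. -/
lemma fan_mul_leaves_le (hV : 0 < V) (hz : z ≤ V) (hN : V ≤ N * P.B) (hN' : 0 < N) :
    fan P V z * leaves P V ≤ 8 * N := by
  have h1 := leaves_le hV hN hN'
  rcases le_or_gt z (leafSize P V) with h | h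
  · rw [fan, if_pos h]
    omega
  · rw [fan, if_neg (by omega)]
    refine Nat.le_of_mul_le_mul_right (c := P.B) ?_ P.B_pos
    have h2 := Nat.div_mul_le_self P.M P.B
    have h3 := P.le_four_mul_lanes
    have h4 := leaves_mul_leafSize_le (P := P) hV
    rw [leafSize_eq_lanes hz h] at h4
    have h5 : leaves P V * (P.M / P.B * P.B) ≤ leaves P V * (4 * P.lanes) :=
      Nat.mul_le_mul_left _ (h2.trans h3)
    nlinarith

/-- The constant is `7 * 2 + 6 * 8 + 21 * 4`. -/
lemma leafCost_mul_leaves_le (hV : 0 < V) (hz : z ≤ V) (hN : V ≤ N * P.B) (hN' : 0 < N) :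
    leafCost P (leafSize P V) (fan P V z) * leaves P V ≤ 146 * N := by
  have h1 := leaves_le hV hN hN'
  have h2 := leaves_mul_div_le hV hN
  have h3 := fan_mul_leaves_le hV hz hN hN'
  unfold leafCost
  nlinarith

lemma scan_cost_le (hV : 0 < V) (hN : V ≤ N * P.B) (hN' : 0 < N) :
    leaves P V * (2 * (leafSize P V / P.B + 2) + 2) + 1 ≤ 29 * N := by
  have h1 := leaves_le hV hN hN'
  have h2 := leaves_mul_div_le hV hN
  nlinarith

lemma two_mul_height_le (hV : 0 < V) (hz : z ≤ V) : (2 * height P V z + 2 : ℝ) ≤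
    10 * max 1 (Real.logb ((P.M : ℝ) / P.B) ((z : ℝ) / P.B)) := by
  have hB : (0 : ℝ) < P.B := by exact_mod_cast P.B_pos
  have hm1 := le_max_left 1 (Real.logb ((P.M : ℝ) / P.B) ((z : ℝ) / P.B))
  have hm2 := le_max_right 1 (Real.logb ((P.M : ℝ) / P.B) ((z : ℝ) / P.B))
  -- Heights `0` and `1` are paid by the maximum with `1`; two levels are given away to absorb
  -- rounding.
  rcases h : height P V z with _ | _ | k
  · norm_num
    linarith
  · norm_num
    linarith
  · have hlt := nodeSize_lt_of_height_eq hV h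
    have hnz : leafSize P V < z := (Nat.le_mul_of_pos_right _
      (Nat.pow_pos (by have := two_le_fan (P := P) (V := V) (z := z); omega))).trans_lt hlt
    have hn := leafSize_eq_lanes hz hnz
    obtain ⟨F, hF⟩ : ∃ F, F = P.M / P.B := ⟨_, rfl⟩
    have hfan : fan P V z = F := by rw [fan, if_neg (by omega), hF]
    have hF2 : 2 ≤ F := hfan ▸ two_le_fan
    rw [hfan, hn, nodeSize, pow_succ] at hlt
    -- A block is at most two lanefuls, and the spare factor `F` absorbs the `2`.
    have h1 : P.B * F ^ k ≤ z := by
      have h2 := P.le_four_mul_lanes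
      have h3 := P.two_mul_le
      have h4 : P.B * F ^ k ≤ 2 * P.lanes * F ^ k := Nat.mul_le_mul_right _ (by omega)
      have h5 : P.lanes * F ^ k * 2 ≤ P.lanes * F ^ k * F := Nat.mul_le_mul_left _ hF2
      nlinarith
    have h6 : ((F : ℝ)) ^ k ≤ (z : ℝ) / P.B := by
      rw [le_div_iff₀ hB, mul_comm]
      exact_mod_cast h1
    have h7 : (1 : ℝ) < (P.M : ℝ) / P.B := by
      rw [lt_div_iff₀ hB]
      have := P.two_mul_le
      have := P.B_pos
      rw [one_mul]
      exact_mod_cast (by omega : P.B < P.M)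
    -- Rounding `M / B` down costs at most a factor `2` in the logarithm, because `F + 1 ≤ F ^ 2`.
    have h8 : (P.M : ℝ) / P.B ≤ (F : ℝ) ^ 2 := by
      rw [div_le_iff₀ hB]
      have h9 : P.M < (F + 1) * P.B := by
        rw [hF, ← Nat.div_lt_iff_lt_mul P.B_pos]
        exact Nat.lt_succ_self _
      have h10 : (F + 1) * P.B ≤ F ^ 2 * P.B := Nat.mul_le_mul_right _ (by nlinarith)
      exact_mod_cast h9.le.trans h10
    have hF0 : (0 : ℝ) < F := by exact_mod_cast (by omega : 0 < F)
    have h11 := Real.logb_le_logb_of_le h7 (pow_pos hF0 k) h6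
    have h12 := Real.logb_le_logb_of_le h7 (by positivity) h8
    rw [Real.logb_self_eq_one h7, Real.logb_pow] at h12
    rw [Real.logb_pow] at h11
    push_cast at h12 ⊢
    have hk : (0 : ℝ) ≤ k := Nat.cast_nonneg k
    nlinarith

end Costs

/-! ### Sizes of words, addresses and programs, and the initial disk. -/

section Bounds

variable {P : EMParams} {V : ℕ}

/-- The base of the word limit. -/
def wordBase (P : EMParams) (S : IntervalRep V) : ℕ := V + P.M + Finset.univ.sup S.right + 2

lemma right_lt_wordBase (S : IntervalRep V) (i : Fin V) : S.right i < wordBase P S := by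
  have := Finset.le_sup (f := S.right) (Finset.mem_univ i)
  unfold wordBase
  omega

lemma left_lt_wordBase (S : IntervalRep V) (i : Fin V) : S.left i < wordBase P S :=
  (S.left_lt i).trans (right_lt_wordBase S _)

lemma pair_le_sq (a b m : ℕ) (ha : a < m) (hb : b < m) : Nat.pair a b < m * m :=
  (Nat.pair_lt_max_add_one_sq a b).trans_le (by
    rw [pow_two]
    exact Nat.mul_le_mul (by omega) (by omega))

lemma arrayCap_le (S : IntervalRep V) : arrayCap P V ≤ 5 * wordBase P S ^ 2 := by
  have h1 := P.two_mul_le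
  have h2 : P.B ≤ wordBase P S := by
    unfold wordBase
    omega
  have h3 : 5 * V + 1 ≤ 5 * wordBase P S := by
    unfold wordBase
    omega
  calc arrayCap P V ≤ wordBase P S * (5 * wordBase P S) := Nat.mul_le_mul h2 h3
    _ = _ := by ring

lemma four_le_wordBase (S : IntervalRep V) : 4 ≤ wordBase P S := by
  have h1 := P.two_mul_le
  have h2 := P.B_pos
  unfold wordBase
  omega

/-- With `b` the base, names of lists are pairs of numbers below `2 * b` and arrays have at most `5
* b ^ 2` cells, so addresses are at most `80 * b ^ 4`; `80 ≤ b ^ 4` because `4 ≤ b`. -/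
lemma namesBelow (S : IntervalRep V) {F : ℕ} (hF : F ≤ P.M) :
    NamesBelow P V F (wordBase P S ^ 8) := by
  have hb := four_le_wordBase (P := P) S
  have hle : V + P.M + 2 ≤ wordBase P S := by
    unfold wordBase
    omega
  have hcap := arrayCap_le (P := P) S
  set b := wordBase P S with hbdef
  have key : ∀ ν, ν < 2 * b * (2 * b) → (3 * ν + 4) * arrayCap P V ≤ b ^ 8 := by
    intro ν hν
    have h1 : 3 * ν + 4 ≤ 12 * b ^ 2 + 4 := by nlinarith
    have h2 : (4 : ℕ) ^ 4 ≤ b ^ 4 := Nat.pow_le_pow_left hb 4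
    have h3 : 4 ≤ 4 * b ^ 2 := by nlinarith
    calc (3 * ν + 4) * arrayCap P V ≤ (16 * b ^ 2) * (5 * b ^ 2) :=
          Nat.mul_le_mul (by omega) hcap
      _ = 80 * b ^ 4 := by ring
      _ ≤ b ^ 4 * b ^ 4 := Nat.mul_le_mul_right _ (by omega)
      _ = b ^ 8 := by ring
  intro h idx hh hidx
  exact ⟨key _ (pair_le_sq _ _ _ (by omega) (by omega)), key _ (pair_le_sq _ _ _ (by omega) (by omega))⟩

/-- A crude bound is enough, since it only keeps the program counter within the word limit. -/
lemma total_cost_lt (hV : 0 < V) (S : IntervalRep V) {F h : ℕ} (hF : F ≤ P.M) (hh : h ≤ V) :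
    2 * ((leaves P V * (2 * (leafSize P V / P.B + 2) + 2) + 1) +
      leafCost P (leafSize P V) F * (2 * h + 2) * leaves P V) < wordBase P S ^ 40 := by
  have hb := four_le_wordBase (P := P) S
  have hle : V + P.M + 2 ≤ wordBase P S := by
    unfold wordBase
    omega
  set b := wordBase P S with hbdef
  have h1 : leafSize P V / P.B ≤ b :=
    (Nat.div_le_self _ _).trans ((min_le_right _ _).trans (by omega))
  have h2 : leaves P V ≤ b := (leaves_le_card hV).trans (by omega)
  have h3 : leaves P V * (2 * (leafSize P V / P.B + 2) + 2) ≤ b * (4 * b) :=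
    Nat.mul_le_mul h2 (by omega)
  have h4 : leafCost P (leafSize P V) F * (2 * h + 2) * leaves P V ≤ (19 * b) * (2 * b) * b := by
    refine Nat.mul_le_mul (Nat.mul_le_mul ?_ (by omega)) h2
    unfold leafCost
    omega
  have h5 : b * (4 * b) ≤ b ^ 3 := by
    have := Nat.mul_le_mul_left (b * b) hb
    nlinarith
  have h6 : 0 < b ^ 3 := by positivity
  have h7 : (4 : ℕ) ^ 37 ≤ b ^ 37 := Nat.pow_le_pow_left hb 37
  calc _ ≤ 2 * ((b ^ 3 + b ^ 3) + 38 * b ^ 3) := by nlinarith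
    _ = 80 * b ^ 3 := by ring
    _ < 4 ^ 37 * b ^ 3 := Nat.mul_lt_mul_of_pos_right (by norm_num) h6
    _ ≤ b ^ 37 * b ^ 3 := Nat.mul_le_mul_right _ h7
    _ = b ^ 40 := by ring

lemma storeArray_of_mem {s : ℕ} {f : Fin V → Cell} {rest : ℕ → Cell} {i : ℕ} (hi : i < V) :
    storeArray s f rest (s + i) = f ⟨i, hi⟩ := by
  have h : s ≤ s + i ∧ s + i < s + V := by omega
  simp [storeArray, hi]

lemma storeArray_of_notMem {s : ℕ} {f : Fin V → Cell} {rest : ℕ → Cell} {x : ℕ}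
    (hx : ¬ (s ≤ x ∧ x < s + V)) : storeArray s f rest x = rest x := dif_neg hx

lemma storeArray_word_lt {s U : ℕ} {f : Fin V → Cell} {rest : ℕ → Cell}
    (hf : ∀ i n, f i = .word n → n < U) (hr : ∀ x n, rest x = .word n → n < U) :
    ∀ x n, storeArray s f rest x = .word n → n < U := by
  intro x n h
  unfold storeArray at h
  split_ifs at h
  · exact hf _ _ h
  · exact hr _ _ h

lemma startState_bdd {U : ℕ} (hU : 0 < U) {D : ℕ → Cell} (hD : ∀ x n, D x = .word n → n < U) :
    (Compile.startState P D).Bdd U := by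
  refine ⟨fun _ => ⟨hU, hU, hU⟩, hU, fun j n h => ?_, hD⟩
  cases h
  exact hU

lemma wordBase_le_pow (S : IntervalRep V) {k : ℕ} (hk : k ≠ 0) :
    wordBase P S ≤ wordBase P S ^ k := Nat.le_self_pow hk _

lemma endpointDisk_bdd (S : IntervalRep V) :
    (Compile.startState P (endpointDisk S)).Bdd (wordBase P S ^ 8) := by
  have h0 := four_le_wordBase (P := P) S
  have hb := wordBase_le_pow (P := P) S (k := 8) (by norm_num)
  refine startState_bdd (by omega) (storeArray_word_lt (fun i n h => ?_)
    (storeArray_word_lt (fun i n h => ?_) fun x n h => ?_)) <;> cases h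
  · exact (left_lt_wordBase S i).trans_le hb
  · exact (right_lt_wordBase S i).trans_le hb
  · omega

lemma colouringDisk_bdd (S : IntervalRep V) :
    (Compile.startState P (colouringDisk S)).Bdd (wordBase P S ^ 8) := by
  have h0 := four_le_wordBase (P := P) S
  have hb := wordBase_le_pow (P := P) S (k := 8) (by norm_num)
  refine startState_bdd (by omega) (storeArray_word_lt (fun i n h => ?_)
    (storeArray_word_lt (fun i n h => ?_) (storeArray_word_lt (fun i n h => ?_)
      (storeArray_word_lt (fun i n h => ?_) fun x n h => ?_)))) <;> cases h
  · exact (left_lt_wordBase S i).trans_le hb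
  · exact (right_lt_wordBase S i).trans_le hb
  · refine lt_of_lt_of_le ?_ hb
    have := (S.partner i).2
    unfold wordBase
    omega
  · omega

lemma holdsEndpoints_storeArray (S : IntervalRep V) (rest : ℕ → Cell) :
    HoldsEndpoints S (storeArray 0 (fun i => .word (S.left i))
      (storeArray V (fun i => .word (S.right i)) rest)) := by
  refine ⟨fun i hi => ?_, fun i hi => ?_⟩
  · have := storeArray_of_mem (s := 0) (f := fun i => Cell.word (S.left i))
      (rest := storeArray V (fun i => .word (S.right i)) rest) hi
    rw [zero_add] at this
    rw [this, IntervalRep.leftAt, dif_pos hi]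
  · rw [storeArray_of_notMem (by omega), storeArray_of_mem hi, IntervalRep.rightAt, dif_pos hi]

/-- All lists are empty without any initialisation: the cells for their lengths lie behind the input
and hold the word `0`. -/
lemma store_colouringDisk (S : IntervalRep V) (χ : ℕ) :
    Store P S χ (fun _ => ∅) 0 (colouringDisk S) := by
  refine ⟨⟨fun i hi => ?_, fun i hi => ?_, fun i _ h => absurd h (Nat.not_lt_zero _)⟩,
    fun ν => ⟨[], rfl, List.nodup_nil, by simp, ?_, by simp, by simp⟩⟩
  · rw [colouringDisk, storeArray_of_notMem (by omega), storeArray_of_notMem (by omega),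
      storeArray_of_mem hi, IntervalRep.next_eq hi, Nat.add_sub_cancel]
  · rw [colouringDisk, storeArray_of_notMem (by omega), storeArray_of_notMem (by omega),
      storeArray_of_notMem (by omega), storeArray_of_mem hi]
  · have h1 := lt_arrayCap P V
    have h2 : arrayCap P V ≤ countCell P V ν := Nat.le_mul_of_pos_left _ (by omega)
    rw [colouringDisk, storeArray_of_notMem (by omega), storeArray_of_notMem (by omega),
      storeArray_of_notMem (by omega), storeArray_of_notMem (by omega)]
    rfl

end Bounds

/-- Programs for all inputs, the second depending on the scalar computed by the first, make up a
machine. -/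
theorem exists_machine (P : EMParams) (D : ∀ V, IntervalRep V → ℕ → Cell) (T₁ : ℕ → ℕ)
    (T₂ : ℕ → ℕ → ℕ) (Post : ∀ V, IntervalRep V → LaneState P → Prop)
    (h₁ : ∀ V, 0 < V → Achieves (T₁ V) (fun S : IntervalRep V => wordBase P S ^ 8) (fun _ _ => True)
      (fun S s => s = Compile.startState P (D V S))
      fun S s => s.Bdd (wordBase P S ^ 8) ∧ s.scalar = S.need ∧ s.disk = D V S)
    (h₂ : ∀ V z, 0 < V → z ≤ V → Achieves (T₂ V z)
      (fun S : {S : IntervalRep V // S.need = z} => wordBase P S.1 ^ 8) (fun _ z' => z' = z)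
      (fun S s => s.Bdd (wordBase P S.1 ^ 8) ∧ s.scalar = z ∧ s.disk = D V S.1)
      fun S s => Post V S.1 s) :
    ∃ A : Machine P 4, ∀ (V : ℕ) (S : IntervalRep V), 0 < V →
      2 * (T₁ V + T₂ V S.need) < wordLimit P S 40 → ∃ t c' s,
        HaltsIn A (wordLimit P S 40) (startConfig P 4 V (D V S)) t c' ∧
        t ≤ 2 * (T₁ V + T₂ V S.need) ∧ Post V S s ∧ c'.disk = s.disk := by
  choose! p₁ hp₁ H₁ using h₁
  choose! p₂ hp₂ H₂ using h₂
  refine ⟨Compile.machine p₁ p₂, fun V S hV hlt => ?_⟩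
  obtain ⟨s₁, hr₁, -, hz₁, hd₁⟩ := H₁ V hV S _ rfl
  obtain ⟨s₂, hr₂, hs₂⟩ := H₂ V S.need hV S.need_le ⟨S, rfl⟩ s₁ ⟨hr₁.last.1, hz₁, hd₁⟩
  have hl₁ := hp₁ V hV
  have hl₂ := hp₂ V S.need hV S.need_le
  have hW : wordLimit P S 40 = wordBase P S ^ 40 := rfl
  have h0 := four_le_wordBase (P := P) S
  replace hr₂ : Run (wordBase P S ^ 8) (fun z => z = s₁.scalar) (p₂ V s₁.scalar) s₁ s₂ :=
    hz₁.symm ▸ hr₂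
  -- The fourth power comes from packing three lane words into one.
  have hU : (wordBase P S ^ 8) ^ 4 ≤ wordLimit P S 40 := by
    rw [hW, ← pow_mul]
    exact Nat.pow_le_pow_right (by omega) (by norm_num)
  have hVW : V < wordLimit P S 40 := by
    rw [hW]
    refine lt_of_lt_of_le ?_ (wordBase_le_pow S (by norm_num))
    unfold wordBase
    omega
  obtain ⟨c', hc', hd⟩ := Compile.machine_halts p₁ p₂ hU hVW hr₁ hr₂ (by
    rw [hz₁]
    omega)
  exact ⟨_, c', s₂, hc', by rw [hz₁]; omega, hs₂, hd⟩

lemma achieves_need_from_start {P : EMParams} {V : ℕ} (hV : 0 < V) (D : IntervalRep V → ℕ → Cell)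
    (hD : ∀ S, HoldsEndpoints S (D S))
    (hD' : ∀ S, (Compile.startState P (D S)).Bdd (wordBase P S ^ 8)) :
    Achieves (leaves P V * (2 * (leafSize P V / P.B + 2) + 2) + 1)
      (fun S : IntervalRep V => wordBase P S ^ 8) (fun _ _ => True)
      (fun S s => s = Compile.startState P (D S))
      fun S s => s.Bdd (wordBase P S ^ 8) ∧ s.scalar = S.need ∧ s.disk = D S := by
  refine (achieves_need hV (fun S : IntervalRep V => S) D (fun S => wordBase P S ^ 8) (fun S => ?_)
    hD).conseq fun S s hs => ⟨S, rfl, rfl, ?_, fun s' h => h⟩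
  · have h0 := four_le_wordBase (P := P) S
    calc 2 * V < 4 * wordBase P S := by
          unfold wordBase
          omega
      _ ≤ wordBase P S * wordBase P S := Nat.mul_le_mul_right _ h0
      _ = wordBase P S ^ 2 := (pow_two _).symm
      _ ≤ wordBase P S ^ 8 := Nat.pow_le_pow_right (by omega) (by norm_num)
  · subst hs
    exact ⟨hD' S, rfl, rfl⟩

lemma le_ceil_mul (P : EMParams) (V : ℕ) : V ≤ ⌈(V : ℝ) / P.B⌉₊ * P.B := by
  have hB : (0 : ℝ) < P.B := by exact_mod_cast P.B_pos
  have := Nat.le_ceil ((V : ℝ) / P.B)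
  rw [div_le_iff₀ hB] at this
  exact_mod_cast this

lemma ceil_pos (P : EMParams) {V : ℕ} (hV : 0 < V) : 0 < ⌈(V : ℝ) / P.B⌉₊ := by
  have hB : (0 : ℝ) < P.B := by exact_mod_cast P.B_pos
  have hV' : (0 : ℝ) < V := by exact_mod_cast hV
  exact Nat.ceil_pos.2 (by positivity)

/-- The clique number can be computed in linear time. -/
theorem exists_machine_findsCliqueNumber (P : EMParams) : ∃ A : Machine P 4,
    ∀ (V : ℕ) (S : IntervalRep V), 0 < V → ∃ t : ℕ,
      FindsCliqueNumberIn A (wordLimit P S 40) S t ∧ (t : ℝ) ≤ 60 * scanBound P V := by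
  obtain ⟨A, hA⟩ := exists_machine P (fun V S => endpointDisk S)
    (fun V => leaves P V * (2 * (leafSize P V / P.B + 2) + 2) + 1) (fun _ _ => 1)
    (fun V S s => s.disk (2 * V) = .word S.need)
    (fun V hV => achieves_need_from_start hV _ (fun S => holdsEndpoints_storeArray S _)
      endpointDisk_bdd) (by
      intro V z hV hz
      -- The second program is chosen after the scan and has the number `z` built in, so it only has
      -- to write it.
      refine Achieves.scatter 1 (fun _ _ j => if (j : ℕ) = 0 then some (2 * V) else none)
        (fun _ _ _ => .inl z) fun S s hs => ⟨hs.1, hs.2.1, ?_, fun j a ha => ?_, fun j a n _ hn => ?_, ?_⟩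
      · refine laneBlocks_subset_singleton (b := 2 * V) fun j x hx => ?_
        split_ifs at hx
        cases hx
        rfl
      · split_ifs at ha
        cases ha
        calc 2 * V < 4 * wordBase P S.1 := by
              unfold wordBase
              omega
          _ ≤ wordBase P S.1 * wordBase P S.1 := Nat.mul_le_mul_right _ (four_le_wordBase _)
          _ = wordBase P S.1 ^ 2 := (pow_two _).symm
          _ ≤ wordBase P S.1 ^ 8 := Nat.pow_le_pow_right
              (by have := four_le_wordBase (P := P) S.1; omega) (by norm_num)
      · cases hn
        have := hs.1.scalar
        rwa [hs.2.1] at this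
      · rw [S.2]
        exact scatter_disk_word (j := ⟨0, P.lanes_pos⟩) (if_pos rfl) fun _ _ => rfl)
  refine ⟨A, fun V S hV => ?_⟩
  have hN := scan_cost_le hV (le_ceil_mul P V) (ceil_pos P hV)
  obtain ⟨t, c', s, hc', ht, hs, hd⟩ := hA V S hV (by
    refine lt_of_le_of_lt (Nat.mul_le_mul_left 2 (Nat.add_le_add_left ?_ _))
      (total_cost_lt hV S (F := 0) (h := 0) (Nat.zero_le _) (Nat.zero_le _))
    refine Nat.succ_le_of_lt (Nat.mul_pos (Nat.mul_pos ?_ (by norm_num)) ?_)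
    · unfold leafCost
      omega
    · have := le_leaves_mul (P := P) hV
      exact Nat.pos_of_mul_pos_right (hV.trans_le this))
  obtain ⟨h1, h2⟩ := S.need_spec hV
  refine ⟨t, ⟨c', S.need, hc', by rw [hd, hs], h2.symm, h1.symm⟩, ?_⟩
  have h3 := ceil_pos P hV
  have h4 : t ≤ 60 * ⌈(V : ℝ) / P.B⌉₊ := by omega
  unfold scanBound
  exact_mod_cast h4

/-- An optimal colouring can be computed within the bound. -/
theorem exists_machine_colours (P : EMParams) : ∃ A : Machine P 4,
    ∀ (V χ : ℕ) (S : IntervalRep V), 0 < V → S.graph.chromaticNumber = (χ : ℕ∞) → ∃ t : ℕ,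
      ColoursIn A (wordLimit P S 40) S t ∧ (t : ℝ) ≤ 3000 * colouringBound P V χ := by
  obtain ⟨A, hA⟩ := exists_machine P (fun V S => colouringDisk S)
    (fun V => leaves P V * (2 * (leafSize P V / P.B + 2) + 2) + 1)
    (fun V z => leafCost P (leafSize P V) (fan P V z) * (2 * height P V z + 2) * leaves P V)
    (fun V S s => ∀ i < V, s.disk (4 * V + i) = .colour (S.fifo S.need i))
    (fun V hV => achieves_need_from_start hV _ (fun S => holdsEndpoints_storeArray S _)
      colouringDisk_bdd) (by
      intro V z hV hz
      let I : {S : IntervalRep V // S.need = z} → Inst P V z := fun S =>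
        { S := S.1
          fits := by
            obtain ⟨S, rfl⟩ := S
            exact S.fits_need
          U := wordBase P S.1 ^ 8
          le_U := by
            have h0 := four_le_wordBase (P := P) S.1
            have h1 := arrayCap_le (P := P) S.1
            have h2 : z + V ≤ 2 * wordBase P S.1 := by
              unfold wordBase
              omega
            calc 2 * arrayCap P V + z + V ≤ 10 * wordBase P S.1 ^ 2 + 2 * wordBase P S.1 := by omega
              _ ≤ 12 * wordBase P S.1 ^ 2 := by nlinarith
              _ ≤ 4 ^ 6 * wordBase P S.1 ^ 2 := Nat.mul_le_mul_right _ (by norm_num)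
              _ ≤ wordBase P S.1 ^ 6 * wordBase P S.1 ^ 2 :=
                Nat.mul_le_mul_right _ (Nat.pow_le_pow_left h0 6)
              _ = _ := by ring }
      refine (performs_colouring (leafSize_pos hV) (min_le_left _ _) two_le_fan (le_leaves_mul hV)
        (leaves_le_card hV) (height_le hV hz) (le_nodeSize_height hV) I
        fun S => namesBelow S.1 fan_le).conseq fun S s hs => ⟨S, rfl, rfl, ⟨⟨hs.1, hs.2.1⟩, ?_⟩, ?_⟩
      · rw [hs.2.2]
        exact store_colouringDisk S.1 z
      · intro s' hs' i hi
        rw [hs' i hi, S.2])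
  refine ⟨A, fun V χ S hV hχ => ?_⟩
  obtain ⟨h1, h2⟩ := S.need_spec hV
  have hz : S.need = χ := by
    rw [h1] at hχ
    exact_mod_cast hχ
  obtain ⟨t, c', s, hc', ht, hs, hd⟩ := hA V S hV
    (total_cost_lt hV S fan_le (height_le hV S.need_le))
  refine ⟨t, ⟨c', S.fits_need.coloring, hc', fun i => by rw [hd, hs i i.2]; rfl, ?_⟩, ?_⟩
  · rw [S.fits_need.ncard_range_coloring S.need_le, h1]
  · have h3 := two_mul_height_le (P := P) hV S.need_le
    have h4 := scan_cost_le hV (le_ceil_mul P V) (ceil_pos P hV)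
    have h5 := leafCost_mul_leaves_le hV S.need_le (le_ceil_mul P V) (ceil_pos P hV)
    have hm := le_max_left 1 (Real.logb ((P.M : ℝ) / P.B) ((χ : ℝ) / P.B))
    unfold colouringBound scanBound
    rw [hz] at *
    set m := max 1 (Real.logb ((P.M : ℝ) / P.B) ((χ : ℝ) / P.B))
    set N := ⌈(V : ℝ) / P.B⌉₊
    -- With two transfers per operation and the factor `10` for the levels, the total is at most
    -- `(58 + 2920) * N * m`.
    have h6 : t ≤ 2 * (29 * N + 146 * N * (2 * height P V χ + 2)) := by
      refine ht.trans (Nat.mul_le_mul_left _ (Nat.add_le_add h4 ?_))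
      calc _ = leafCost P (leafSize P V) (fan P V χ) * leaves P V * (2 * height P V χ + 2) := by ring
        _ ≤ _ := Nat.mul_le_mul_right _ h5
    have h7 : (t : ℝ) ≤ 2 * (29 * N + 146 * N * (2 * height P V χ + 2)) := by exact_mod_cast h6
    have hN0 : (0 : ℝ) ≤ N := Nat.cast_nonneg N
    have h8 : (N : ℝ) * (2 * height P V χ + 2) ≤ N * (10 * m) := mul_le_mul_of_nonneg_left h3 hN0
    have h9 : (N : ℝ) * 1 ≤ N * m := mul_le_mul_of_nonneg_left hm hN0
    nlinarith

/-! ### Interval representations which force a permutation of the colours -/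

namespace IntervalRep

variable {V χ k : ℕ}

/-- In an optimal colouring, a clique whose size is the chromatic number has all the colours. -/
lemma image_eq_range_of_clique {S : IntervalRep V} (f : S.graph.Coloring ℕ)
    (hf : ((Set.range f).ncard : ℕ∞) = χ) (C : Finset (Fin V)) (hC : S.graph.IsClique (C : Set (Fin V)))
    (hcard : χ ≤ C.card) : (f '' C : Set ℕ) = Set.range f := by
  refine Set.eq_of_subset_of_ncard_le (Set.image_subset_range _ _) ?_ (Set.finite_range f)
  have h1 : (Set.range f).ncard = χ := by exact_mod_cast hf
  have h2 : Set.InjOn f (C : Set (Fin V)) := fun i hi j hj h => by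
    by_contra hne
    exact f.valid (hC hi hj hne) h
  rw [h1, h2.ncard_image, Set.ncard_coe_finset]
  exact hcard

/-- A colour set free is the only one available to the next interval. -/
lemma coloring_eq_of_tight {S : IntervalRep V} (f : S.graph.Coloring ℕ)
    (hf : ((Set.range f).ncard : ℕ∞) = χ) (hχ : 0 < χ) {i q : Fin V}
    (hq : (q : ℕ) = S.partner i + χ) (h₁ : ∀ j p : Fin V, (j : ℕ) + 1 = p + χ → S.left j < S.right p) :
    f q = f i := by
  classical
  have hqV := q.2
  let j : Fin V := ⟨S.partner i + χ - 1, by omega⟩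
  let p : Fin V := ⟨S.partner i + 1, by omega⟩
  have hj : (j : ℕ) + 1 = S.partner i + χ := by
    simp only [j]
    omega
  have hqp : (q : ℕ) + 1 = p + χ := by
    simp only [p]
    omega
  have hC₁ : S.graph.IsClique ↑(Finset.univ.filter fun l => l ≤ j ∧ S.partner i ≤ S.partner l) := by
    simpa using isClique_of_lt (h₁ j _ hj)
  have h2 := image_eq_range_of_clique f hf _ hC₁ (card_clique_ge hj)
  have h3 : f q ∈ Set.range f := ⟨q, rfl⟩
  rw [← h2] at h3
  obtain ⟨l, hl, hlq⟩ := h3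
  simp only [Finset.coe_filter, Finset.mem_univ, true_and, Set.mem_ofPred_eq] at hl
  by_cases hli : l = i
  · rw [← hlq, hli]
  -- Every other member of the clique outlasts the right endpoint in question and still meets
  -- interval `q`.
  · exfalso
    have h4 : S.partner i < S.partner l :=
      lt_of_le_of_ne hl.2 fun h => hli (S.partner.injective h.symm)
    have h5 : l < q := by
      have := hl.1
      rw [Fin.le_def] at this
      rw [Fin.lt_def]
      omega
    have h6 : S.graph.Adj l q := by
      rw [adj_iff_of_lt h5]
      refine (h₁ q p hqp).trans_le (S.right_strictMono.monotone ?_)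
      rw [Fin.le_def]
      exact h4
    exact f.valid h6 hlq

/-- The interval of rank `a` in block `j`. -/
def blockEmb (h : k * χ ≤ V) : Fin k × Fin χ ↪ Fin V where
  toFun x := ⟨x.1 * χ + x.2, by
    have h1 := x.1.2
    have h2 := x.2.2
    have h3 : (x.1 + 1 : ℕ) * χ ≤ k * χ := Nat.mul_le_mul_right _ h1
    rw [add_mul, one_mul] at h3
    omega⟩
  inj' x y hxy := by
    have h : (x.1 : ℕ) * χ + x.2 = y.1 * χ + y.2 := congrArg Fin.val hxy
    have h1 := x.2.2
    have h2 := y.2.2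
    have h3 : (x.1 : ℕ) = y.1 := by
      have hx : ((x.1 : ℕ) * χ + x.2) / χ = x.1 := by
        rw [mul_comm, Nat.mul_add_div (by omega), Nat.div_eq_of_lt h1, add_zero]
      have hy : ((y.1 : ℕ) * χ + y.2) / χ = y.1 := by
        rw [mul_comm, Nat.mul_add_div (by omega), Nat.div_eq_of_lt h2, add_zero]
      rw [← hx, ← hy, h]
    rw [h3] at h
    exact Prod.ext (Fin.ext h3) (Fin.ext (by omega))

lemma blockEmb_val (h : k * χ ≤ V) (x : Fin k × Fin χ) : (blockEmb h x : ℕ) = x.1 * χ + x.2 := rfl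

/-- Left endpoints `2 i`, right endpoints `2 (i + χ) - 1`, and in each of the first `k` blocks of
`χ` intervals the right endpoints are permuted. -/
noncomputable def shuffled (hχ : 0 < χ) (h : k * χ ≤ V) (τ : Fin k → Equiv.Perm (Fin χ)) :
    IntervalRep V where
  left i := 2 * i
  right i := 2 * (i + χ) - 1
  partner := Equiv.Perm.viaEmbedding (Equiv.prodCongrRight τ) (blockEmb h)
  left_strictMono i j hij := by
    rw [Fin.lt_def] at hij
    simp only
    omega
  right_strictMono i j hij := by
    rw [Fin.lt_def] at hij
    simp only
    omega
  left_ne_right i j := by omega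
  left_lt i := by
    by_cases hi : i ∈ Set.range (blockEmb h)
    · obtain ⟨x, rfl⟩ := hi
      rw [Equiv.Perm.viaEmbedding_apply]
      have h1 := x.2.2
      have h2 : (Equiv.prodCongrRight τ x).1 = x.1 := rfl
      simp only [blockEmb_val, h2]
      omega
    · rw [Equiv.Perm.viaEmbedding_apply_of_notMem _ _ _ hi]
      omega

lemma shuffled_partner (hχ : 0 < χ) (h : k * χ ≤ V) (τ : Fin k → Equiv.Perm (Fin χ)) (j : Fin k)
    (a : Fin χ) : ((shuffled hχ h τ).partner (blockEmb h (j, a)) : ℕ) = j * χ + τ j a := by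
  simp only [shuffled]
  rw [Equiv.Perm.viaEmbedding_apply]
  rfl

/-- The right endpoint of rank `p` lies just between the left endpoints `2 * (p + χ - 1)` and `2 *
(p + χ)`. The endpoints are the same for all permutations; only the partners vary. -/
lemma shuffled_tight (hχ : 0 < χ) (h : k * χ ≤ V) (τ : Fin k → Equiv.Perm (Fin χ)) (j p : Fin V)
    (hj : (j : ℕ) + 1 = p + χ) : (shuffled hχ h τ).left j < (shuffled hχ h τ).right p := by
  simp only [shuffled]
  omega

lemma shuffled_fits (hχ : 0 < χ) (h : k * χ ≤ V) (τ : Fin k → Equiv.Perm (Fin χ)) :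
    (shuffled hχ h τ).Fits χ := by
  intro i j hij
  simp only [shuffled]
  omega

lemma shuffled_chromaticNumber (hχ : 0 < χ) (hV : χ ≤ V) (h : k * χ ≤ V)
    (τ : Fin k → Equiv.Perm (Fin χ)) : (shuffled hχ h τ).graph.chromaticNumber = χ := by
  refine ((shuffled_fits hχ h τ).chromaticNumber_eq (i := ⟨0, by omega⟩) (j := ⟨χ - 1, by omega⟩)
    ?_ ?_).1
  · simp only
    omega
  · exact shuffled_tight hχ h τ _ _ (by simp only; omega)

/-- An optimal colouring of `shuffled`, in blocks. -/
lemma shuffled_coloring (hχ : 0 < χ) (hV : (k + 1) * χ ≤ V) (h : k * χ ≤ V)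
    (τ : Fin k → Equiv.Perm (Fin χ)) (f : (shuffled hχ h τ).graph.Coloring ℕ)
    (hf : ((Set.range f).ncard : ℕ∞) = (shuffled hχ h τ).graph.chromaticNumber) :
    (∀ (j : Fin k) (a : Fin χ),
      f (blockEmb hV (j.succ, τ j a)) = f (blockEmb hV (j.castSucc, a))) ∧
    Function.Injective fun a => f (blockEmb hV (0, a)) := by
  have hχV : χ ≤ V := le_trans (Nat.le_mul_of_pos_left _ (Nat.succ_pos k)) hV
  rw [shuffled_chromaticNumber hχ hχV] at hf
  refine ⟨fun j a => ?_, fun a b hab => ?_⟩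
  · have h1 : blockEmb hV (j.castSucc, a) = blockEmb h (j, a) := rfl
    rw [h1]
    refine coloring_eq_of_tight f hf hχ ?_ (shuffled_tight hχ h τ)
    rw [shuffled_partner]
    rw [blockEmb_val]
    simp only [Fin.val_succ]
    ring
  · by_contra hne
    have h0 : ∀ c : Fin χ, blockEmb hV (0, c) ∈ {l | l ≤ (⟨χ - 1, by omega⟩ : Fin V) ∧
        (⟨0, by omega⟩ : Fin V) ≤ (shuffled hχ h τ).partner l} := by
      intro c
      have := c.2
      refine ⟨?_, ?_⟩ <;> rw [Fin.le_def]
      · rw [blockEmb_val]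
        simp only [Fin.val_zero, zero_mul, zero_add]
        omega
      · exact Nat.zero_le _
    refine f.valid (isClique_of_lt (shuffled_tight hχ h τ _ _ ?_) (h0 a) (h0 b) fun he => hne ?_) hab
    · simp only
      omega
    · simpa using (blockEmb hV).injective he

end IntervalRep

/-- Iterating the forced equations, a colouring is injective on every block. -/
lemma injective_of_shift {χ k : ℕ} {α : Type*} {g : Fin (k + 1) × Fin χ → α}
    {τ : Fin k → Equiv.Perm (Fin χ)} (h : ∀ j a, g (j.succ, τ j a) = g (j.castSucc, a))
    (h₀ : Function.Injective fun a => g (0, a)) (j : Fin (k + 1)) :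
    Function.Injective fun a => g (j, a) := by
  induction j using Fin.induction with
  | zero => exact h₀
  | succ j ih =>
    intro a b hab
    have h1 : ∀ c, g (j.succ, c) = g (j.castSucc, (τ j).symm c) := fun c => by
      rw [← h, Equiv.apply_symm_apply]
    simp only [h1] at hab
    exact (τ j).symm.injective (ih hab)

/-- The permutations can be recovered from a relabelled colouring. -/
lemma shift_injective {χ k : ℕ} {α : Type*} {g : Fin (k + 1) × Fin χ → α}
    {τ τ' : Fin k → Equiv.Perm (Fin χ)} (h : ∀ j a, g (j.succ, τ j a) = g (j.castSucc, a))
    (h' : ∀ j a, g (j.succ, τ' j a) = g (j.castSucc, a))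
    (h₀ : Function.Injective fun a => g (0, a)) : τ = τ' := by
  funext j
  ext1 a
  exact injective_of_shift h h₀ j.succ ((h j a).trans (h' j a).symm)

/-! ### Every output block has to be transferred. -/

section WrittenBlocks

variable {P : EMParams} {r : ℕ}

lemma Command.exec_disk (d : Command P r) (c : Config P r) {x : ℕ}
    (hx : x / P.B ≠ d.transfer.block) : (d.exec c).disk x = c.disk x := by
  cases hd : d.transfer with
  | read a => simp [Command.exec, Transfer.exec, hd]
  | write a =>
    rw [hd] at hx
    simp only [Command.exec, Transfer.exec, hd]
    exact if_neg hx

/-- In `t` transfers at most `t` blocks are written. -/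
lemma HaltsIn.exists_blocks {A : Machine P r} {W t : ℕ} {c c' : Config P r} (h : HaltsIn A W c t c') :
    ∃ bs : Finset ℕ, bs.card ≤ t ∧ ∀ x, x / P.B ∉ bs → c'.disk x = c.disk x := by
  classical
  induction h with
  | halt c _ _ => exact ⟨∅, by simp, fun _ _ => rfl⟩
  | step c c' d t _ _ _ _ ih =>
    obtain ⟨bs, hbs, h⟩ := ih
    refine ⟨insert d.transfer.block bs, (Finset.card_insert_le _ _).trans (by omega), fun x hx => ?_⟩
    rw [Finset.mem_insert, not_or] at hx
    rw [h x hx.2, d.exec_disk c hx.1]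

/-- The output has to be written. -/
lemma ColoursIn.scan_le {V W t : ℕ} {A : Machine P r} {S : IntervalRep V} (h : ColoursIn A W S t) :
    scanBound P V ≤ t := by
  classical
  obtain ⟨c', f, hc, hf, -⟩ := h
  obtain ⟨bs, hbs, hx⟩ := hc.exists_blocks
  have hmem : ∀ i < V, (4 * V + i) / P.B ∈ bs := by
    intro i hi
    -- At the start an output cell holds a word, at the end a colour.
    by_contra hn
    have h1 := hx _ hn
    rw [hf ⟨i, hi⟩] at h1
    simp only [startConfig] at h1
    rw [colouringDisk, storeArray_of_notMem (by omega), storeArray_of_notMem (by omega),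
      storeArray_of_notMem (by omega), storeArray_of_notMem (by omega)] at h1
    cases h1
  have hcard : V ≤ bs.card * P.B := by
    have h1 : (Finset.Ico (4 * V) (5 * V)).card ≤ (bs.biUnion fun b =>
        Finset.Ico (b * P.B) (b * P.B + P.B)).card := by
      refine Finset.card_le_card fun x hx => ?_
      rw [Finset.mem_Ico] at hx
      have h2 := hmem (x - 4 * V) (by omega)
      rw [Nat.add_sub_cancel' hx.1] at h2
      refine Finset.mem_biUnion.2 ⟨_, h2, ?_⟩
      have h3 := Nat.div_add_mod x P.B
      have h4 := Nat.mod_lt x P.B_pos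
      rw [Finset.mem_Ico, mul_comm]
      omega
    have h2 := Finset.card_biUnion_le_card_mul bs (fun b =>
        Finset.Ico (b * P.B) (b * P.B + P.B)) P.B (fun b _ => by simp)
    rw [Nat.card_Ico] at h1
    omega
  unfold scanBound
  have hB : (0 : ℝ) < P.B := by exact_mod_cast P.B_pos
  have h3 : ⌈(V : ℝ) / P.B⌉₊ ≤ t := by
    refine Nat.ceil_le.2 ((div_le_iff₀ hB).2 ?_)
    exact_mod_cast hcard.trans (Nat.mul_le_mul_right _ hbs)
  exact_mod_cast h3

end WrittenBlocks

/-! ### Counting the reachable arrangements of colours -/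

section Traces

variable {P : EMParams} {r : ℕ} {ρ : ℕ → ℕ} {m T : ℕ}

/-- The colour in a cell, relabelled by `ρ`. -/
def Cell.colours (ρ : ℕ → ℕ) : Cell → Finset ℕ
  | .word _ => ∅
  | .colour c => {ρ c}

lemma Cell.card_colours_le (c : Cell) : (c.colours ρ).card ≤ 1 := by
  cases c <;> simp [Cell.colours]

/-- The colours in main memory. -/
def memColours (ρ : ℕ → ℕ) {M : ℕ} (mem : Fin M → Cell) : Finset ℕ :=
  Finset.univ.biUnion fun j => (mem j).colours ρ

/-- The colours in a disk block. -/
def blockColours (P : EMParams) (ρ : ℕ → ℕ) (disk : ℕ → Cell) (a : ℕ) : Finset ℕ :=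
  (Finset.range P.B).biUnion fun j => (disk (a * P.B + j)).colours ρ

lemma mem_memColours {M : ℕ} {mem : Fin M → Cell} {z : ℕ} :
    z ∈ memColours ρ mem ↔ ∃ j, z ∈ (mem j).colours ρ := by
  simp [memColours]

lemma mem_blockColours {disk : ℕ → Cell} {a z : ℕ} :
    z ∈ blockColours P ρ disk a ↔ ∃ x, x / P.B = a ∧ z ∈ (disk x).colours ρ := by
  simp only [blockColours, Finset.mem_biUnion, Finset.mem_range]
  constructor
  · rintro ⟨j, hj, h⟩
    refine ⟨_, ?_, h⟩
    rw [mul_comm, Nat.mul_add_div P.B_pos, Nat.div_eq_of_lt hj, add_zero]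
  · rintro ⟨x, rfl, h⟩
    refine ⟨x % P.B, Nat.mod_lt _ P.B_pos, ?_⟩
    rwa [mul_comm, Nat.div_add_mod]

lemma card_memColours_le {M : ℕ} (mem : Fin M → Cell) : (memColours ρ mem).card ≤ M := by
  refine (Finset.card_biUnion_le_card_mul _ _ 1 fun j _ => Cell.card_colours_le _).trans ?_
  simp

lemma card_blockColours_le (disk : ℕ → Cell) (a : ℕ) : (blockColours P ρ disk a).card ≤ P.B := by
  refine (Finset.card_biUnion_le_card_mul _ _ 1 fun j _ => Cell.card_colours_le _).trans ?_
  simp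

/-- The subsets with at most `b` elements. -/
def smallSubsets (b : ℕ) (Z : Finset ℕ) : Finset (Finset ℕ) := Z.powerset.filter fun Y => Y.card ≤ b

lemma mem_smallSubsets {b : ℕ} {Z Y : Finset ℕ} : Y ∈ smallSubsets b Z ↔ Y ⊆ Z ∧ Y.card ≤ b := by
  simp [smallSubsets]

/-- The colours in main memory (or more), and the colours in all versions of all blocks. -/
abbrev Versions : Type := Finset ℕ × (ℕ → Finset ℕ)

open Classical in
/-- What one transfer can lead to: a version is read and at most `B` colours are dropped, or a new
version, with number `m + s`, is written. -/
noncomputable def successors (P : EMParams) (m T s : ℕ) (x : Versions) : Finset Versions :=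
  (((Finset.range (m + T + 1)).biUnion fun i =>
      (smallSubsets P.B (x.1 ∪ x.2 i)).image fun D => ((x.1 ∪ x.2 i) \ D, x.2)) ∪
    (smallSubsets P.B x.1).image fun Y => (x.1, Function.update x.2 (m + s) Y)).filter
      fun y => y.1.card ≤ P.M

open Classical in
/-- What `s` transfers can lead to. -/
noncomputable def reachable (P : EMParams) (m T : ℕ) (v : ℕ → Finset ℕ) : ℕ → Finset Versions
  | 0 => {(∅, v)}
  | s + 1 => (reachable P m T v s).biUnion (successors P m T s)

lemma mem_successors {s : ℕ} {x y : Versions} : y ∈ successors P m T s x ↔ y.1.card ≤ P.M ∧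
    ((∃ i D, i ≤ m + T ∧ D ⊆ x.1 ∪ x.2 i ∧ D.card ≤ P.B ∧ y = ((x.1 ∪ x.2 i) \ D, x.2)) ∨
      ∃ Y, Y ⊆ x.1 ∧ Y.card ≤ P.B ∧ y = (x.1, Function.update x.2 (m + s) Y)) := by
  simp only [successors, Finset.mem_filter, Finset.mem_union, Finset.mem_biUnion, Finset.mem_range,
    Finset.mem_image, mem_smallSubsets]
  rw [and_comm]
  refine and_congr_right fun _ => or_congr ⟨?_, ?_⟩ ⟨?_, ?_⟩
  · rintro ⟨i, hi, D, hD, rfl⟩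
    exact ⟨i, D, by omega, hD.1, hD.2, rfl⟩
  · rintro ⟨i, D, hi, h1, h2, rfl⟩
    exact ⟨i, by omega, D, ⟨h1, h2⟩, rfl⟩
  · rintro ⟨Y, hY, rfl⟩
    exact ⟨Y, hY.1, hY.2, rfl⟩
  · rintro ⟨Y, h1, h2, rfl⟩
    exact ⟨Y, ⟨h1, h2⟩, rfl⟩

/-! ### Counting and simulating transfers by sets of colours. -/

section Reachable

variable {v : ℕ → Finset ℕ} {s : ℕ}

lemma card_le_of_mem_reachable (hv : ∀ i, (v i).card ≤ P.B) {x : Versions}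
    (hx : x ∈ reachable P m T v s) : x.1.card ≤ P.M ∧ ∀ i, (x.2 i).card ≤ P.B := by
  classical
  induction s generalizing x with
  | zero =>
    rw [reachable, Finset.mem_singleton] at hx
    subst hx
    exact ⟨by simp, hv⟩
  | succ s ih =>
    rw [reachable, Finset.mem_biUnion] at hx
    obtain ⟨y, hy, hxy⟩ := hx
    obtain ⟨h1, ⟨i, D, -, -, -, rfl⟩ | ⟨Y, -, hY, rfl⟩⟩ := mem_successors.1 hxy
    · exact ⟨h1, (ih hy).2⟩
    · refine ⟨h1, fun i => ?_⟩
      rcases eq_or_ne i (m + s) with rfl | h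
      · simpa using hY
      · simpa [h] using (ih hy).2 i

lemma eq_empty_of_mem_reachable (hv : ∀ i, m ≤ i → v i = ∅) {x : Versions}
    (hx : x ∈ reachable P m T v s) {i : ℕ} (hi : m + s ≤ i) : x.2 i = ∅ := by
  classical
  induction s generalizing x with
  | zero =>
    rw [reachable, Finset.mem_singleton] at hx
    subst hx
    exact hv i hi
  | succ s ih =>
    rw [reachable, Finset.mem_biUnion] at hx
    obtain ⟨y, hy, hxy⟩ := hx
    obtain ⟨h1, ⟨i, D, -, -, -, rfl⟩ | ⟨Y, -, hY, rfl⟩⟩ := mem_successors.1 hxy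
    · exact ih (x := y) hy (by omega)
    · have h2 : i ≠ m + s := by omega
      simpa [h2] using ih hy (by omega)

/-- A read has `m + T + 1` choices of a version and `N` choices of the colours dropped, a write has
`N` choices of the colours written. Words are not recorded, so their size is irrelevant. -/
lemma card_reachable_le {N : ℕ} (hN : ∀ Z : Finset ℕ, Z.card ≤ 2 * P.M → (smallSubsets P.B Z).card ≤ N)
    (hv : ∀ i, (v i).card ≤ P.B) (s : ℕ) :
    (reachable P m T v s).card ≤ ((m + T + 2) * N) ^ s := by
  classical
  induction s with
  | zero => simp [reachable]
  | succ s ih =>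
    rw [reachable, pow_succ]
    refine (Finset.card_biUnion_le_card_mul _ _ ((m + T + 2) * N) fun x hx => ?_).trans
      (Nat.mul_le_mul_right _ ih)
    obtain ⟨h1, h2⟩ := card_le_of_mem_reachable hv hx
    have h3 := P.two_mul_le
    refine (Finset.card_filter_le _ _).trans ((Finset.card_union_le _ _).trans ?_)
    have h4 := Finset.card_biUnion_le_card_mul (Finset.range (m + T + 1)) (fun i =>
      (smallSubsets P.B (x.1 ∪ x.2 i)).image fun D => ((x.1 ∪ x.2 i) \ D, x.2)) N fun i _ =>
        Finset.card_image_le.trans (hN _ ((Finset.card_union_le _ _).trans (by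
          have := h2 i
          omega)))
    rw [Finset.card_range] at h4
    have h5 := (Finset.card_image_le (s := smallSubsets P.B x.1)
      (f := fun Y => (x.1, Function.update x.2 (m + s) Y))).trans (hN x.1 (by omega))
    calc _ ≤ (m + T + 1) * N + N := Nat.add_le_add h4 h5
      _ = _ := by ring

/-- Version `m + T` is always empty, and reading it changes nothing. Runs of different lengths can
so be padded to the same `T`. -/
lemma mem_reachable_succ (hvB : ∀ i, (v i).card ≤ P.B) (hv : ∀ i, m ≤ i → v i = ∅) (hs : s ≤ T)
    {x : Versions} (hx : x ∈ reachable P m T v s) : x ∈ reachable P m T v (s + 1) := by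
  classical
  rw [reachable, Finset.mem_biUnion]
  refine ⟨x, hx, mem_successors.2 ⟨(card_le_of_mem_reachable hvB hx).1,
    .inl ⟨m + T, ∅, le_rfl, by simp, by simp, ?_⟩⟩⟩
  rw [eq_empty_of_mem_reachable hv hx (by omega)]
  simp

lemma mem_reachable_of_le (hvB : ∀ i, (v i).card ≤ P.B) (hv : ∀ i, m ≤ i → v i = ∅) (hs : s ≤ T)
    {x : Versions} (hx : x ∈ reachable P m T v s) : x ∈ reachable P m T v T := by
  obtain ⟨u, rfl⟩ := Nat.exists_eq_add_of_le hs
  have key : ∀ w, w ≤ u → x ∈ reachable P m (s + u) v (s + w) := by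
    intro w
    induction w with
    | zero => exact fun _ => hx
    | succ w ih =>
      intro hw
      have h1 : s + w ≤ s + u := by omega
      exact mem_reachable_succ hvB hv h1 (ih (by omega))
  exact key u le_rfl

/-- The versions `x` account for all the colours in the configuration `c`, where block `a` is in the
version `loc a`. -/
structure Simulates (ρ : ℕ → ℕ) (m T s : ℕ) (c : Config P r) (x : Versions) (loc : ℕ → ℕ) : Prop where
  mem : memColours ρ c.mem ⊆ x.1
  disk : ∀ a, blockColours P ρ c.disk a ⊆ x.2 (loc a)
  loc : ∀ a, loc a < m + s ∨ loc a = m + T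

lemma Source.colours_eval_subset {M : ℕ} {mem : Fin M → Cell} (src : Source M) :
    (src.eval mem).colours ρ ⊆ memColours ρ mem := by
  cases src with
  | word n => simp [Source.eval, Cell.colours]
  | copy j => exact fun z hz => mem_memColours.2 ⟨j, hz⟩

/-- Internal computation can only copy or lose colours. Writes create new versions rather than
replacing old ones, so only the map `loc` remembers which block is where. -/
lemma Simulates.exec (hvB : ∀ i, (v i).card ≤ P.B) {c : Config P r} {x : Versions} {loc : ℕ → ℕ}
    (h : Simulates ρ m T s c x loc) (hx : x ∈ reachable P m T v s) (hs : s < T) (d : Command P r) :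
    ∃ x' loc', x' ∈ reachable P m T v (s + 1) ∧ Simulates ρ m T (s + 1) (d.exec c) x' loc' := by
  classical
  obtain ⟨h1, h2⟩ := card_le_of_mem_reachable hvB hx
  have hB := P.two_mul_le
  cases hd : d.transfer with
  | read a =>
    have hsub : memColours ρ (d.exec c).mem ⊆ x.1 ∪ x.2 (loc a) := by
      intro z hz
      obtain ⟨j, hj⟩ := mem_memColours.1 hz
      simp only [Command.exec, Transfer.exec, hd] at hj
      split_ifs at hj with hlt
      · refine Finset.mem_union_right _ (h.disk a (mem_blockColours.2 ⟨_, ?_, hj⟩))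
        rw [mul_comm, Nat.mul_add_div P.B_pos, Nat.div_eq_of_lt hlt, add_zero]
      · exact Finset.mem_union_left _ (h.mem (Source.colours_eval_subset _ hj))
    have hdisk : (d.exec c).disk = c.disk := by simp [Command.exec, Transfer.exec, hd]
    -- The memory may lose many colours at once, but the recorded set is allowed to be larger. It is
    -- cut down only to size `M`, for which dropping `B` colours suffices.
    obtain ⟨X, hX₁, hX₂, hX₃, hX₄⟩ : ∃ X, memColours ρ (d.exec c).mem ⊆ X ∧
        X ⊆ x.1 ∪ x.2 (loc a) ∧ X.card ≤ P.M ∧ ((x.1 ∪ x.2 (loc a)) \ X).card ≤ P.B := by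
      by_cases hle : (x.1 ∪ x.2 (loc a)).card ≤ P.M
      · exact ⟨_, hsub, subset_rfl, hle, by simp⟩
      · obtain ⟨X, h3, h4, h5⟩ := Finset.exists_subsuperset_card_eq hsub
          (card_memColours_le _) (by omega : P.M ≤ _)
        refine ⟨X, h3, h4, h5.le, ?_⟩
        have h6 := Finset.card_union_le x.1 (x.2 (loc a))
        have h7 := h2 (loc a)
        rw [Finset.card_sdiff_of_subset h4]
        omega
    refine ⟨(X, x.2), loc, ?_, hX₁, ?_, fun a' => (h.loc a').imp_left (by omega)⟩
    · rw [reachable, Finset.mem_biUnion]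
      refine ⟨x, hx, mem_successors.2 ⟨hX₃, .inl ⟨loc a, (x.1 ∪ x.2 (loc a)) \ X, ?_,
        Finset.sdiff_subset, hX₄, ?_⟩⟩⟩
      · have := h.loc a
        omega
      · rw [Finset.sdiff_sdiff_eq_self hX₂]
    · rw [hdisk]
      exact h.disk
  | write a =>
    have hmem : (d.exec c).mem = fun j => (d.mem j).eval c.mem := by
      simp [Command.exec, Transfer.exec, hd]
    have hY : blockColours P ρ (d.exec c).disk a ⊆ x.1 := by
      intro z hz
      obtain ⟨y, hy, hz⟩ := mem_blockColours.1 hz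
      simp only [Command.exec, Transfer.exec, hd, if_pos hy] at hz
      exact h.mem (Source.colours_eval_subset _ hz)
    refine ⟨(x.1, Function.update x.2 (m + s) (blockColours P ρ (d.exec c).disk a)),
      Function.update loc a (m + s), ?_, fun z hz => ?_, fun a' => ?_, fun a' => ?_⟩
    · rw [reachable, Finset.mem_biUnion]
      exact ⟨x, hx, mem_successors.2 ⟨h1, .inr ⟨_, hY, card_blockColours_le _ _, rfl⟩⟩⟩
    · obtain ⟨j, hj⟩ := mem_memColours.1 hz
      rw [hmem] at hj
      exact h.mem (Source.colours_eval_subset _ hj)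
    · rcases eq_or_ne a' a with rfl | hne
      · simp
      · have h3 := h.loc a'
        have h4 : loc a' ≠ m + s := by omega
        simp only [Function.update_of_ne hne, Function.update_of_ne h4]
        intro z hz
        obtain ⟨y, hy, hz⟩ := mem_blockColours.1 hz
        rw [d.exec_disk c (by rw [hd]; exact hy ▸ hne)] at hz
        exact h.disk a' (mem_blockColours.2 ⟨y, hy, hz⟩)
    · rcases eq_or_ne a' a with rfl | hne
      · left
        simp
      · rw [Function.update_of_ne hne]
        exact (h.loc a').imp_left (by omega)

lemma Simulates.halts (hvB : ∀ i, (v i).card ≤ P.B) {A : Machine P r} {W t : ℕ} {c c' : Config P r}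
    (hc : HaltsIn A W c t c') {x : Versions} {loc : ℕ → ℕ} (h : Simulates ρ m T s c x loc)
    (hx : x ∈ reachable P m T v s) (hs : s + t ≤ T) :
    ∃ x' loc', x' ∈ reachable P m T v (s + t) ∧ Simulates ρ m T (s + t) c' x' loc' := by
  induction hc generalizing s x loc with
  | halt c _ _ => exact ⟨x, loc, hx, h⟩
  | step c c' d t _ _ _ _ ih =>
    obtain ⟨x₁, loc₁, hx₁, h₁⟩ := h.exec hvB hx (by omega) d
    have := ih h₁ hx₁ (by omega)
    rwa [show s + (t + 1) = s + 1 + t by ring]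

end Reachable

open Classical in
/-- The arrangements of colours in the cells `y`, lying in the blocks `blk y`, which `T` transfers
can lead to. -/
noncomputable def arrangements (P : EMParams) (m T : ℕ) (v : ℕ → Finset ℕ) {ι : Type} [Fintype ι]
    {o : ℕ} (blk : ι → Fin o) : Finset (ι → ℕ) :=
  (reachable P m T v T).biUnion fun x =>
    (Fintype.piFinset fun _ : Fin o => Finset.range (m + T + 1)).biUnion fun loc =>
      Fintype.piFinset fun y => x.2 (loc (blk y))

/-- After the history has been chosen, each output block picks its version, and each cell one of the
at most `B` colours of that version. -/
lemma card_arrangements_le {v : ℕ → Finset ℕ} {N o : ℕ} {ι : Type} [Fintype ι] (blk : ι → Fin o)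
    (hN : ∀ Z : Finset ℕ, Z.card ≤ 2 * P.M → (smallSubsets P.B Z).card ≤ N)
    (hv : ∀ i, (v i).card ≤ P.B) :
    (arrangements P m T v blk).card ≤
      ((m + T + 2) * N) ^ T * ((m + T + 1) ^ o * P.B ^ Fintype.card ι) := by
  classical
  refine (Finset.card_biUnion_le_card_mul _ _ ((m + T + 1) ^ o * P.B ^ Fintype.card ι)
    fun x hx => ?_).trans (Nat.mul_le_mul_right _ (card_reachable_le hN hv T))
  refine (Finset.card_biUnion_le_card_mul _ _ (P.B ^ Fintype.card ι) fun loc _ => ?_).trans ?_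
  · rw [Fintype.card_piFinset, ← Finset.card_univ, ← Finset.prod_const]
    exact Finset.prod_le_prod' fun y _ => (card_le_of_mem_reachable hv hx).2 _
  · simp [Fintype.card_piFinset]

/-! ### Initial versions from the palette, invariant under relabelling within its blocks. -/

section Palette

variable {V : ℕ}

/-- The number of blocks reserved for the palette. -/
def paletteSize (P : EMParams) (V : ℕ) : ℕ := V / P.B + 2

/-- The palette in the blocks in which it is given. -/
def palette (P : EMParams) (V i : ℕ) : Finset ℕ :=
  (Finset.range V).filter fun c => (3 * V + c) / P.B = 3 * V / P.B + i

lemma add_div_lt_paletteSize {s c : ℕ} (hc : c < V) :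
    s / P.B ≤ (s + c) / P.B ∧ (s + c) / P.B < s / P.B + paletteSize P V := by
  refine ⟨Nat.div_le_div_right (Nat.le_add_right _ _), ?_⟩
  rw [Nat.div_lt_iff_lt_mul P.B_pos, paletteSize, add_mul, add_mul]
  have h1 := Nat.div_add_mod s P.B
  have h2 := Nat.mod_lt s P.B_pos
  have h3 := Nat.div_add_mod V P.B
  have h4 := Nat.mod_lt V P.B_pos
  rw [mul_comm] at h1 h3
  omega

/-- The block of the palette in which a colour is given. -/
def paletteBlock (P : EMParams) (V c : ℕ) : Fin (paletteSize P V + 1) :=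
  if h : c < V then
    ⟨(3 * V + c) / P.B - 3 * V / P.B, by
      have := add_div_lt_paletteSize (P := P) (s := 3 * V) h
      omega⟩
  else Fin.last _

lemma mem_palette_of_paletteBlock_eq {c c' : ℕ} (hc : c < V)
    (h : paletteBlock P V c' = paletteBlock P V c) :
    c' ∈ palette P V ((3 * V + c) / P.B - 3 * V / P.B) := by
  have h1 := add_div_lt_paletteSize (P := P) (s := 3 * V) hc
  rw [paletteBlock, paletteBlock, dif_pos hc] at h
  split_ifs at h with h'
  · have h2 := add_div_lt_paletteSize (P := P) (s := 3 * V) h'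
    rw [Fin.mk.injEq] at h
    simp only [palette, Finset.mem_filter, Finset.mem_range]
    omega
  · have := congrArg Fin.val h
    simp only [Fin.val_last] at this
    omega

lemma card_palette_le (i : ℕ) : (palette P V i).card ≤ P.B := by
  have h : (palette P V i).card ≤ (Finset.Ico ((3 * V / P.B + i) * P.B)
      ((3 * V / P.B + i) * P.B + P.B)).card := by
    refine Finset.card_le_card_of_injOn (fun c => 3 * V + c) (fun c hc => ?_) fun c _ c' _ h => ?_
    · simp only [palette, Finset.coe_filter, Finset.mem_range, Set.mem_ofPred_eq] at hc
      have h1 := Nat.div_add_mod (3 * V + c) P.B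
      have h2 := Nat.mod_lt (3 * V + c) P.B_pos
      rw [hc.2, mul_comm] at h1
      simp only [Finset.coe_Ico, Set.mem_Ico]
      omega
    · simp only at h
      omega
  simpa using h

lemma palette_eq_empty {i : ℕ} (hi : paletteSize P V ≤ i) : palette P V i = ∅ := by
  refine Finset.filter_eq_empty_iff.2 fun c hc => ?_
  have := add_div_lt_paletteSize (P := P) (s := 3 * V) (Finset.mem_range.1 hc)
  omega

lemma colouringDisk_colour {S : IntervalRep V} {x c : ℕ} (h : colouringDisk S x = .colour c) :
    c < V ∧ x = 3 * V + c := by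
  unfold colouringDisk at h
  by_cases h0 : 0 ≤ x ∧ x < 0 + V
  · simp [storeArray, h0] at h
    split_ifs at h
    omega
  rw [storeArray_of_notMem h0] at h
  by_cases h1 : V ≤ x ∧ x < V + V
  · rw [storeArray, dif_pos h1] at h
    cases h
  rw [storeArray_of_notMem h1] at h
  by_cases h2 : 2 * V ≤ x ∧ x < 2 * V + V
  · rw [storeArray, dif_pos h2] at h
    cases h
  rw [storeArray_of_notMem h2] at h
  by_cases h3 : 3 * V ≤ x ∧ x < 3 * V + V
  · rw [storeArray, dif_pos h3] at h
    simp only [Cell.colour.injEq] at h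
    omega
  · rw [storeArray_of_notMem h3] at h
    cases h

/-- A relabelling that respects the blocks of the palette does not change the initial versions, so
one count covers all of them. Blocks outside the palette are assigned the empty version. -/
lemma simulates_start (S : IntervalRep V) (hρ : ∀ c, paletteBlock P V (ρ c) = paletteBlock P V c)
    (T : ℕ) : ∃ loc, Simulates ρ (paletteSize P V) T 0 (startConfig P r V (colouringDisk S))
      (∅, palette P V) loc := by
  refine ⟨fun a => if 3 * V / P.B ≤ a ∧ a < 3 * V / P.B + paletteSize P V then a - 3 * V / P.B
    else paletteSize P V + T, fun z hz => ?_, fun a z hz => ?_, fun a => ?_⟩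
  · obtain ⟨j, hj⟩ := mem_memColours.1 hz
    simp [startConfig, Cell.colours] at hj
  · obtain ⟨x, rfl, hx⟩ := mem_blockColours.1 hz
    simp only [startConfig] at hx
    cases hc : colouringDisk S x with
    | word n => simp [hc, Cell.colours] at hx
    | colour c =>
      obtain ⟨hcV, rfl⟩ := colouringDisk_colour hc
      rw [hc, Cell.colours, Finset.mem_singleton] at hx
      subst hx
      simp only [if_pos (add_div_lt_paletteSize (P := P) (s := 3 * V) hcV)]
      exact mem_palette_of_paletteBlock_eq hcV (hρ c)
  · split_ifs <;> omega

/-- The block, counted from the beginning of the output, of an output cell. -/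
def outputBlock (P : EMParams) (i : Fin V) : Fin (paletteSize P V) :=
  ⟨(4 * V + i) / P.B - 4 * V / P.B, by
    have := add_div_lt_paletteSize (P := P) (s := 4 * V) i.2
    omega⟩

/-- All relabellings of a colouring which is found in `T` transfers are among the arrangements. -/
lemma mem_arrangements {A : Machine P r} {W t : ℕ} {S : IntervalRep V} {c' : Config P r}
    {f : Fin V → ℕ} (hc : HaltsIn A W (startConfig P r V (colouringDisk S)) t c')
    (hf : ∀ i : Fin V, c'.disk (4 * V + i) = .colour (f i)) (ht : t ≤ T)
    (hρ : ∀ c, paletteBlock P V (ρ c) = paletteBlock P V c) {ι : Type} [Fintype ι] (e : ι → Fin V) :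
    (fun y => ρ (f (e y))) ∈
      arrangements P (paletteSize P V) T (palette P V) fun y => outputBlock P (e y) := by
  classical
  obtain ⟨loc₀, h₀⟩ := simulates_start (r := r) S hρ T
  obtain ⟨x, loc, hx, h⟩ := h₀.halts card_palette_le hc (v := palette P V) (by simp [reachable])
    (by omega)
  rw [zero_add] at hx h
  have hx' := mem_reachable_of_le card_palette_le (fun i => palette_eq_empty) ht hx
  rw [arrangements, Finset.mem_biUnion]
  refine ⟨x, hx', Finset.mem_biUnion.2 ⟨fun b => loc (4 * V / P.B + b), ?_, ?_⟩⟩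
  · rw [Fintype.mem_piFinset]
    intro b
    have := h.loc (4 * V / P.B + b)
    rw [Finset.mem_range]
    omega
  · rw [Fintype.mem_piFinset]
    intro y
    have h1 := add_div_lt_paletteSize (P := P) (s := 4 * V) (e y).2
    change ρ (f (e y)) ∈ x.2 (loc (4 * V / P.B + ((4 * V + e y) / P.B - 4 * V / P.B)))
    rw [Nat.add_sub_cancel' h1.1]
    refine h.disk _ (mem_blockColours.2 ⟨_, rfl, ?_⟩)
    rw [hf, Cell.colours, Finset.mem_singleton]

end Palette

end Traces

/-! ### The lower bound -/

section LowerBound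

variable {P : EMParams} {V χ k r T : ℕ}

/-- Few subsets are small. -/
lemma card_smallSubsets_le (P : EMParams) {Z : Finset ℕ} (hZ : Z.card ≤ 2 * P.M) :
    ((smallSubsets P.B Z).card : ℝ) ≤ ((P.M : ℝ) / P.B) ^ (4 * P.B) := by
  have hB : (0 : ℝ) < P.B := by exact_mod_cast P.B_pos
  have hM2 : (2 : ℝ) * P.B ≤ P.M := by exact_mod_cast P.two_mul_le
  have hM : (0 : ℝ) < P.M := by linarith
  -- Weight each subset `Y` by `y ^ Y.card`: the total is `(1 + y) ^ Z.card ≤ exp (2 * B)`, and a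
  -- subset with at most `B` elements weighs at least `y ^ B`.
  obtain ⟨y, hy⟩ : ∃ y : ℝ, y = P.B / P.M := ⟨_, rfl⟩
  have hy0 : 0 < y := hy ▸ div_pos hB hM
  have hy1 : y ≤ 1 := by
    rw [hy, div_le_one hM]
    linarith
  have h1 : y ^ P.B * (smallSubsets P.B Z).card ≤ (y + 1) ^ Z.card := by
    rw [← Finset.sum_pow_mul_eq_add_pow, mul_comm, ← nsmul_eq_mul, ← Finset.sum_const]
    refine (Finset.sum_le_sum fun Y hY => ?_).trans
      (Finset.sum_le_sum_of_subset_of_nonneg (Finset.filter_subset _ _) fun Y _ _ => ?_)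
    · rw [one_pow, mul_one]
      exact pow_le_pow_of_le_one hy0.le hy1 (mem_smallSubsets.1 hY).2
    · positivity
  have h2 : (y + 1) ^ Z.card ≤ Real.exp 1 ^ (2 * P.B) := by
    calc (y + 1) ^ Z.card ≤ Real.exp y ^ Z.card :=
          pow_le_pow_left₀ (by linarith) (Real.add_one_le_exp y) _
      _ ≤ Real.exp y ^ (2 * P.M) := pow_le_pow_right₀ (Real.one_le_exp hy0.le) hZ
      _ = Real.exp 1 ^ (2 * P.B) := by
          rw [← Real.exp_nat_mul, ← Real.exp_nat_mul]
          congr 1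
          push_cast
          rw [hy]
          field_simp
  have h3 : Real.exp 1 ^ 2 ≤ ((P.M : ℝ) / P.B) ^ 3 := by
    have h4 : (2 : ℝ) ≤ (P.M : ℝ) / P.B := (le_div_iff₀ hB).2 hM2
    calc Real.exp 1 ^ 2 ≤ 2.7182818286 ^ 2 :=
          pow_le_pow_left₀ (Real.exp_pos _).le Real.exp_one_lt_d9.le 2
      _ ≤ 2 ^ 3 := by norm_num
      _ ≤ _ := pow_le_pow_left₀ (by norm_num) h4 3
  have h5 : y ^ P.B * ((P.M : ℝ) / P.B) ^ P.B = 1 := by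
    rw [← mul_pow, hy, div_mul_div_cancel₀ hM.ne', div_self hB.ne', one_pow]
  have h6 : 0 ≤ ((P.M : ℝ) / P.B) ^ P.B := by positivity
  calc ((smallSubsets P.B Z).card : ℝ) =
        y ^ P.B * (smallSubsets P.B Z).card * ((P.M : ℝ) / P.B) ^ P.B := by
          rw [mul_right_comm, h5, one_mul]
    _ ≤ (((P.M : ℝ) / P.B) ^ 3) ^ P.B * ((P.M : ℝ) / P.B) ^ P.B := by
          refine mul_le_mul_of_nonneg_right ((h1.trans h2).trans ?_) h6
          rw [pow_mul]
          exact pow_le_pow_left₀ (by positivity) h3 _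
    _ = _ := by
          rw [← pow_mul, ← pow_add]
          congr 1
          ring

/-- The permutations which preserve a function with `q` values. -/
lemma le_card_stabilizer {q : ℕ} (φ : Fin χ → Fin q) (b : ℕ) :
    (b : ℝ) ^ χ * Real.exp (-(b * q)) ≤
      (Fintype.card {σ : Equiv.Perm (Fin χ) // φ ∘ σ = φ} : ℝ) := by
  classical
  -- The number is the product of the factorials of the fibre sizes `n`, and `n! ≥ b ^ n * exp
  -- (-b)`.
  rw [DomMulAct.stabilizer_card]
  have hsum : ∑ i : Fin q, Fintype.card {a // φ a = i} = χ := by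
    rw [← Fintype.card_sigma, Fintype.card_congr (Equiv.sigmaFiberEquiv φ), Fintype.card_fin]
  have h1 : (b : ℝ) ^ χ * Real.exp (-(b * q)) =
      ∏ i : Fin q, ((b : ℝ) ^ Fintype.card {a // φ a = i} * Real.exp (-b)) := by
    rw [Finset.prod_mul_distrib, Finset.prod_pow_eq_pow_sum, hsum, Finset.prod_const,
      Finset.card_univ, Fintype.card_fin, ← Real.exp_nat_mul]
    congr 2
    ring
  rw [h1, Nat.cast_prod]
  refine Finset.prod_le_prod (fun i _ => by positivity) fun i _ => ?_
  have h2 := Real.pow_div_factorial_le_exp (b : ℝ) (Nat.cast_nonneg b) (Fintype.card {a // φ a = i})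
  rw [div_le_iff₀ (by exact_mod_cast Nat.factorial_pos _)] at h2
  rw [Real.exp_neg, ← div_eq_mul_inv, div_le_iff₀ (Real.exp_pos _), mul_comm]
  exact h2

/-- All permutations, and all relabellings within the blocks of the palette, lead to different
arrangements. -/
theorem card_arrangements_ge (hχ : 0 < χ) (hV : (k + 1) * χ ≤ V) (hk : k * χ ≤ V) (A : Machine P r)
    (hA : ∀ τ, ∃ W t, ColoursIn A W (IntervalRep.shuffled hχ hk τ) t ∧ t ≤ T) :
    ((χ.factorial : ℝ) ^ k * ((P.B : ℝ) ^ χ * Real.exp (-(P.B * (paletteSize P V + 1 : ℕ))))) ≤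
      ((arrangements P (paletteSize P V) T (palette P V)
        fun y => outputBlock P (IntervalRep.blockEmb hV y)).card : ℝ) := by
  classical
  choose W t hA ht using hA
  choose c' f hc hf hf' using hA
  let g : (Fin k → Equiv.Perm (Fin χ)) → Fin (k + 1) × Fin χ → ℕ :=
    fun τ y => f τ (IntervalRep.blockEmb hV y)
  have hg : ∀ τ, (∀ j a, g τ (j.succ, τ j a) = g τ (j.castSucc, a)) ∧
      Function.Injective fun a => g τ (0, a) := fun τ =>
    IntervalRep.shuffled_coloring hχ hV hk τ (f τ) (hf' τ)
  let emb : (Fin k → Equiv.Perm (Fin χ)) → Fin χ ↪ ℕ := fun τ => ⟨fun a => g τ (0, a), (hg τ).2⟩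
  let φ : (Fin k → Equiv.Perm (Fin χ)) → Fin χ → Fin (paletteSize P V + 1) :=
    fun τ a => paletteBlock P V (emb τ a)
  -- Relabellings permute the `χ` colours of the first block of intervals within the blocks of the
  -- palette and fix all other numbers.
  let ρ : (Σ τ, {σ : Equiv.Perm (Fin χ) // φ τ ∘ σ = φ τ}) → Equiv.Perm ℕ :=
    fun z => Equiv.Perm.viaEmbedding z.2.1 (emb z.1)
  have hρ : ∀ z c, paletteBlock P V (ρ z c) = paletteBlock P V c := by
    intro z c
    by_cases hmem : c ∈ Set.range (emb z.1)
    · obtain ⟨a, rfl⟩ := hmem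
      simp only [ρ]
      rw [Equiv.Perm.viaEmbedding_apply]
      exact congrFun z.2.2 a
    · simp only [ρ]
      rw [Equiv.Perm.viaEmbedding_apply_of_notMem _ _ _ hmem]
  have hinj : Function.Injective fun z y => ρ z (g z.1 y) := by
    rintro ⟨τ, σ⟩ ⟨τ', σ'⟩ h
    -- The forced equations are invariant under relabelling, so the permutations are determined
    -- first; the relabelling is then seen on the first block of intervals, where the colouring is
    -- injective.
    obtain rfl : τ = τ' := by
      refine shift_injective (g := fun y => ρ ⟨τ, σ⟩ (g τ y)) (fun j a => ?_) (fun j a => ?_) ?_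
      · exact congrArg _ ((hg τ).1 j a)
      · have h1 := congrFun h (j.succ, τ' j a)
        have h2 := congrFun h (j.castSucc, a)
        simp only at h1 h2 ⊢
        rw [h1, h2, (hg τ').1]
      · exact (Equiv.injective _).comp (hg τ).2
    congr 1
    ext a : 2
    have h1 := congrFun h (0, a)
    simp only [ρ] at h1
    rw [show g τ (0, a) = emb τ a from rfl, Equiv.Perm.viaEmbedding_apply,
      Equiv.Perm.viaEmbedding_apply] at h1
    exact (emb τ).injective h1
  have hcard := Finset.card_le_card_of_injOn (s := Finset.univ)
    (t := arrangements P (paletteSize P V) T (palette P V)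
      fun y => outputBlock P (IntervalRep.blockEmb hV y)) (fun z y => ρ z (g z.1 y))
    (fun z _ => mem_arrangements (hc z.1) (hf z.1) (ht z.1) (hρ z) _) hinj.injOn
  rw [Finset.card_univ, Fintype.card_sigma] at hcard
  refine le_trans ?_ (Nat.cast_le.2 hcard)
  rw [Nat.cast_sum]
  calc _ = ∑ _τ : Fin k → Equiv.Perm (Fin χ),
        ((P.B : ℝ) ^ χ * Real.exp (-(P.B * (paletteSize P V + 1 : ℕ)))) := by
        rw [Finset.sum_const, Finset.card_univ, Fintype.card_fun, Fintype.card_perm,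
          Fintype.card_fin, Fintype.card_fin, nsmul_eq_mul, Nat.cast_pow]
    _ ≤ _ := Finset.sum_le_sum fun τ _ => le_card_stabilizer (φ τ) P.B

/-- The inequality between the number of permutations and the number of transfers, in logarithms. -/
theorem log_inequality (hχ : 0 < χ) (hV : (k + 1) * χ ≤ V) (hk : k * χ ≤ V) (A : Machine P r)
    (hA : ∀ τ, ∃ W t, ColoursIn A W (IntervalRep.shuffled hχ hk τ) t ∧ t ≤ T) :
    (k * χ : ℝ) * (Real.log ((χ : ℝ) / P.B) - 1) ≤ P.B * (paletteSize P V + 1) +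
      T * (Real.log (paletteSize P V + T + 2) + 4 * P.B * Real.log ((P.M : ℝ) / P.B)) +
      paletteSize P V * Real.log (paletteSize P V + T + 2) := by
  have hB : (0 : ℝ) < P.B := by exact_mod_cast P.B_pos
  have hχ' : (0 : ℝ) < χ := by exact_mod_cast hχ
  have hM : (0 : ℝ) < (P.M : ℝ) / P.B := by
    have : 0 < P.M := by
      have := P.two_mul_le
      have := P.B_pos
      omega
    have : (0 : ℝ) < P.M := by exact_mod_cast this
    positivity
  have h1 := card_arrangements_ge hχ hV hk A hA
  set m := paletteSize P V with hm
  have h2 := card_arrangements_le (P := P) (m := m) (T := T) (v := palette P V)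
    (N := ⌊((P.M : ℝ) / P.B) ^ (4 * P.B)⌋₊) (fun y => outputBlock P (IntervalRep.blockEmb hV y))
    (fun Z hZ => Nat.le_floor (card_smallSubsets_le P hZ)) card_palette_le
  have hN := Nat.floor_le (a := ((P.M : ℝ) / P.B) ^ (4 * P.B)) (by positivity)
  set N := ⌊((P.M : ℝ) / P.B) ^ (4 * P.B)⌋₊
  have h3 : ((m : ℝ) + T + 1) ≤ m + T + 2 := by linarith
  have hw : (0 : ℝ) < m + T + 2 := by positivity
  have h4 : (χ.factorial : ℝ) ^ k * ((P.B : ℝ) ^ χ * Real.exp (-(P.B * (m + 1 : ℕ)))) ≤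
      ((m + T + 2) * ((P.M : ℝ) / P.B) ^ (4 * P.B)) ^ T *
        ((m + T + 2) ^ m * (P.B : ℝ) ^ ((k + 1) * χ)) := by
    refine (h1.trans (Nat.cast_le.2 h2)).trans ?_
    rw [Fintype.card_prod, Fintype.card_fin, Fintype.card_fin]
    push_cast
    gcongr
  have hfac : (χ : ℝ) * Real.log χ - χ ≤ Real.log χ.factorial := by
    have h5 := Real.pow_div_factorial_le_exp (χ : ℝ) hχ'.le χ
    have h6 : (0 : ℝ) < χ.factorial := by exact_mod_cast Nat.factorial_pos _
    have h7 := Real.log_le_log (by positivity) h5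
    rw [Real.log_exp, Real.log_div (by positivity) h6.ne', Real.log_pow] at h7
    linarith
  have h6 : (0 : ℝ) < χ.factorial := by exact_mod_cast Nat.factorial_pos _
  have h7 := Real.log_le_log (by positivity) h4
  rw [Real.log_mul (by positivity) (by positivity), Real.log_mul (by positivity) (by positivity),
    Real.log_exp, Real.log_mul (by positivity) (by positivity),
    Real.log_mul (by positivity) (by positivity), Real.log_pow, Real.log_pow, Real.log_pow,
    Real.log_pow, Real.log_pow, Real.log_mul (by positivity) (by positivity), Real.log_pow] at h7
  push_cast at h7
  -- The relabellings contribute `χ * log B`, which leaves `k * χ * log B` of the candidates for the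
  -- cells, just enough to turn `log χ` into `log (χ / B)`.
  rw [Real.log_div hχ'.ne' hB.ne']
  have h8 := mul_le_mul_of_nonneg_left hfac (Nat.cast_nonneg (α := ℝ) k)
  linarith

/-- If `χ / B` is large, the bound is attained. -/
theorem exists_slow_of_large (hχ : 0 < χ) (hV : 2 * χ ≤ V)
    (hVB : (V : ℝ) ≤ P.B * ((P.M : ℝ) / P.B) ^ P.B)
    (h₁ : 100 ≤ Real.log ((χ : ℝ) / P.B))
    (h₂ : 100 * Real.log ((P.M : ℝ) / P.B) ≤ Real.log ((χ : ℝ) / P.B)) (A : Machine P r) :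
    ∃ S : IntervalRep V, S.graph.chromaticNumber = (χ : ℕ∞) ∧
      ∀ W t : ℕ, ColoursIn A W S t → 1 / 1000 * colouringBound P V χ ≤ (t : ℝ) := by
  by_contra! hcon
  have hB : (0 : ℝ) < P.B := by exact_mod_cast P.B_pos
  have hχ' : (0 : ℝ) < χ := by exact_mod_cast hχ
  obtain ⟨k, hk⟩ : ∃ k, V / χ = k + 1 ∧ 1 ≤ k := by
    have : 2 ≤ V / χ := (Nat.le_div_iff_mul_le hχ).2 hV
    exact ⟨V / χ - 1, by omega, by omega⟩
  have hkV : (k + 1) * χ ≤ V := hk.1 ▸ Nat.div_mul_le_self V χ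
  have hkV' : k * χ ≤ V := le_trans (Nat.mul_le_mul_right _ (by omega)) hkV
  -- At most `V < (k + 2) * χ`, and `1 ≤ k`: the permuted blocks are a third of the input.
  have hVk : (V : ℝ) ≤ 3 * (k * χ) := by
    have h3 : V < (k + 1 + 1) * χ := by
      rw [← hk.1, ← Nat.div_lt_iff_lt_mul hχ]
      exact Nat.lt_succ_self _
    have h4 : (k + 1 + 1) * χ ≤ 3 * k * χ := Nat.mul_le_mul_right _ (by omega)
    rw [← mul_assoc]
    exact_mod_cast h3.le.trans h4
  obtain ⟨T, hT⟩ : ∃ T, T = ⌊1 / 1000 * colouringBound P V χ⌋₊ := ⟨_, rfl⟩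
  have hL0 : 0 ≤ 1 / 1000 * colouringBound P V χ := by
    unfold colouringBound scanBound
    positivity
  have key := log_inequality (T := T) hχ hkV hkV' A fun τ => by
    obtain ⟨W, t, hWt, hlt⟩ := hcon (IntervalRep.shuffled hχ hkV' τ)
      (IntervalRep.shuffled_chromaticNumber hχ (by omega) hkV' τ)
    exact ⟨W, t, hWt, hT ▸ Nat.le_floor hlt.le⟩
  have hTle : (T : ℝ) ≤ 1 / 1000 * colouringBound P V χ := hT ▸ Nat.floor_le hL0
  obtain ⟨l, hl⟩ : ∃ l, l = Real.log ((χ : ℝ) / P.B) := ⟨_, rfl⟩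
  obtain ⟨q, hq⟩ : ∃ q, q = Real.log ((P.M : ℝ) / P.B) := ⟨_, rfl⟩
  obtain ⟨b, hb⟩ : ∃ b : ℝ, b = V / P.B := ⟨_, rfl⟩
  have hbV : b * P.B = V := by rw [hb, div_mul_cancel₀ _ hB.ne']
  have hMB : (2 : ℝ) ≤ (P.M : ℝ) / P.B := by
    rw [le_div_iff₀ hB]
    exact_mod_cast P.two_mul_le
  have hq2 : (1 / 2 : ℝ) ≤ q := by
    have := Real.log_le_log (by norm_num) hMB
    have := Real.log_two_gt_d9
    rw [hq]
    linarith
  rw [← hl, ← hq] at h₂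
  rw [← hl] at h₁
  have hlb : l ≤ b := by
    have h3 := Real.log_le_sub_one_of_pos (div_pos hχ' hB)
    have h4 : (χ : ℝ) / P.B ≤ V / P.B := by
      gcongr
      omega
    rw [hl, hb]
    linarith
  have hm : (paletteSize P V : ℝ) ≤ b + 2 := by
    rw [paletteSize, hb]
    push_cast
    have := Nat.cast_div_le (α := ℝ) (m := V) (n := P.B)
    linarith
  have hL : colouringBound P V χ ≤ 2 * b * (l / q) := by
    unfold colouringBound scanBound
    have h3 : Real.logb ((P.M : ℝ) / P.B) ((χ : ℝ) / P.B) = l / q := by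
      rw [Real.logb, hl, hq]
    have h4 : 1 ≤ l / q := by
      rw [le_div_iff₀ (by linarith)]
      linarith
    rw [h3, max_eq_right h4, ← hb]
    have h5 := Nat.ceil_lt_add_one (a := b) (by linarith)
    exact mul_le_mul_of_nonneg_right (by linarith) (by linarith)
  have hTq : (T : ℝ) * q ≤ 1 / 500 * (b * l) := by
    have h3 : (T : ℝ) ≤ 1 / 500 * (b * l) / q := by
      refine hTle.trans ((mul_le_mul_of_nonneg_left hL (by norm_num)).trans (le_of_eq ?_))
      ring
    rwa [le_div_iff₀ (by linarith)] at h3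
  have hT0 : (0 : ℝ) ≤ T := Nat.cast_nonneg T
  have hTb : (T : ℝ) ≤ b ^ 2 := by nlinarith
  -- Here the size restriction on `V` enters: naming a version costs no more, up to a constant, than
  -- selecting the colours transferred.
  have hw : Real.log (paletteSize P V + T + 2) ≤ 3 * (P.B * q) := by
    have h3 : (paletteSize P V + T + 2 : ℝ) ≤ b ^ 3 := by nlinarith
    have h4 : b ≤ ((P.M : ℝ) / P.B) ^ P.B := by
      rw [hb, div_le_iff₀ hB, mul_comm]
      exact hVB
    have h5 := Real.log_le_log (by positivity) h3
    have h6 := Real.log_le_log (by linarith) h4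
    rw [Real.log_pow] at h5 h6
    rw [← hq] at h6
    push_cast at h5
    linarith
  rw [← hl, ← hq] at key
  have hVpos : (0 : ℝ) < V := by
    have : 0 < V := by omega
    exact_mod_cast this
  have hBq : 0 ≤ P.B * q := by
    have : 0 ≤ q := by linarith
    positivity
  have e1 : (P.B : ℝ) * (paletteSize P V + 1) ≤ P.B * (b + 3) :=
    mul_le_mul_of_nonneg_left (by linarith) hB.le
  have e2 : (T : ℝ) * (Real.log (paletteSize P V + T + 2) + 4 * P.B * q) ≤
      T * (7 * (P.B * q)) := mul_le_mul_of_nonneg_left (by linarith) hT0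
  have e3 : (paletteSize P V : ℝ) * Real.log (paletteSize P V + T + 2) ≤
      (b + 2) * (3 * (P.B * q)) := by
    have h3 : (0 : ℝ) ≤ paletteSize P V := Nat.cast_nonneg _
    exact (mul_le_mul_of_nonneg_left hw h3).trans
      (mul_le_mul_of_nonneg_right hm (by linarith))
  have e4 : (T : ℝ) * (7 * (P.B * q)) ≤ 7 / 500 * (V * l) := by
    have := mul_le_mul_of_nonneg_left hTq hB.le
    rw [← hbV]
    linarith
  have e5 : (P.B : ℝ) * (b + 3) ≤ 2 * V := by
    have := mul_le_mul_of_nonneg_left (by linarith : (3 : ℝ) ≤ b) hB.le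
    linarith
  have e6 : (b + 2) * (3 * (P.B * q)) ≤ 6 / 100 * (V * l) := by
    have h3 : (b + 2) * (3 * (P.B * q)) ≤ (2 * b) * (3 * (P.B * q)) :=
      mul_le_mul_of_nonneg_right (by linarith) (by linarith)
    have h4 := mul_le_mul_of_nonneg_left h₂ hVpos.le
    have h5 : (2 * b) * (3 * (P.B * q)) = 6 * (V * q) := by
      rw [← hbV]
      ring
    linarith
  have e7 : (V : ℝ) * (l - 1) ≤ 3 * (k * χ) * (l - 1) :=
    mul_le_mul_of_nonneg_right hVk (by linarith)
  have e8 : (V : ℝ) * 100 ≤ V * l := mul_le_mul_of_nonneg_left h₁ hVpos.le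
  -- About a third of `V * l` would be at most `(0.02 + 0.014 + 0.06) * V * l`.
  nlinarith

/-- The lower bound. -/
theorem exists_slow (hχ : 0 < χ) (hV : 2 * χ ≤ V)
    (hVB : (V : ℝ) ≤ P.B * ((P.M : ℝ) / P.B) ^ P.B) (A : Machine P r) :
    ∃ S : IntervalRep V, S.graph.chromaticNumber = (χ : ℕ∞) ∧
      ∀ W t : ℕ, ColoursIn A W S t → 1 / 1000 * colouringBound P V χ ≤ (t : ℝ) := by
  by_cases h : 100 ≤ Real.log ((χ : ℝ) / P.B) ∧
      100 * Real.log ((P.M : ℝ) / P.B) ≤ Real.log ((χ : ℝ) / P.B)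
  · exact exists_slow_of_large hχ hV hVB h.1 h.2 A
  -- The logarithm in the bound is now at most `200`, so writing the output is slow enough on any
  -- instance.
  · refine ⟨IntervalRep.shuffled hχ (k := 0) (by omega) fun _ => 1,
      IntervalRep.shuffled_chromaticNumber hχ (by omega) _ _, fun W t ht => ?_⟩
    refine le_trans ?_ ht.scan_le
    have hB : (0 : ℝ) < P.B := by exact_mod_cast P.B_pos
    have hMB : (2 : ℝ) ≤ (P.M : ℝ) / P.B := by
      rw [le_div_iff₀ hB]
      exact_mod_cast P.two_mul_le
    have hq : (1 / 2 : ℝ) ≤ Real.log ((P.M : ℝ) / P.B) := by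
      have := Real.log_le_log (by norm_num) hMB
      have := Real.log_two_gt_d9
      linarith
    have h1 : Real.logb ((P.M : ℝ) / P.B) ((χ : ℝ) / P.B) ≤ 200 := by
      rw [Real.logb, div_le_iff₀ (by linarith)]
      by_contra! hlt
      exact h ⟨by linarith, by linarith⟩
    have h2 : max 1 (Real.logb ((P.M : ℝ) / P.B) ((χ : ℝ) / P.B)) ≤ 1000 :=
      max_le (by norm_num) (by linarith)
    have h3 : 0 ≤ scanBound P V := Nat.cast_nonneg _
    have h4 := mul_le_mul_of_nonneg_left h2 h3
    unfold colouringBound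
    linarith

end LowerBound
theorem mainTheorem9 :
    -- an optimal colouring can be computed within the bound, by a single algorithm
    (∃ (r k : ℕ) (C : ℝ) (A : ∀ P : EMParams, Machine P r),
      ∀ (P : EMParams) (V χ : ℕ) (S : IntervalRep V), 0 < V →
        S.graph.chromaticNumber = (χ : ℕ∞) →
        ∃ t : ℕ, ColoursIn (A P) (wordLimit P S k) S t ∧ (t : ℝ) ≤ C * colouringBound P V χ) ∧
    -- the matching lower bound
    (∃ c : ℝ, 0 < c ∧
      ∀ (P : EMParams) (V χ r : ℕ) (A : Machine P r), 0 < χ → 2 * χ ≤ V →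
        (V : ℝ) ≤ P.B * ((P.M : ℝ) / P.B) ^ P.B →
        (∀ S : IntervalRep V, S.graph.chromaticNumber = (χ : ℕ∞) → ∃ W t : ℕ, ColoursIn A W S t) →
        ∃ S : IntervalRep V, S.graph.chromaticNumber = (χ : ℕ∞) ∧
          ∀ W t : ℕ, ColoursIn A W S t → c * colouringBound P V χ ≤ (t : ℝ)) ∧
    -- the clique number can be computed by scanning the sorted endpoints
    (∃ (r k : ℕ) (C : ℝ) (A : ∀ P : EMParams, Machine P r),
      ∀ (P : EMParams) (V : ℕ) (S : IntervalRep V), 0 < V →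
        ∃ t : ℕ, FindsCliqueNumberIn (A P) (wordLimit P S k) S t ∧
          (t : ℝ) ≤ C * scanBound P V) := by
  refine ⟨?_, ?_, ?_⟩
  · choose A hA using exists_machine_colours
    -- The four registers hold `V`, the program counter, the scalar and the words of the last lane.
    exact ⟨4, 40, 3000, A, fun P V χ S hV hχ => hA P V χ S hV hχ⟩
  · exact ⟨1 / 1000, by norm_num, fun P V χ r A hχ hV hVB _ => exists_slow hχ hV hVB A⟩
  · choose A hA using exists_machine_findsCliqueNumber
    exact ⟨4, 40, 60, A, fun P V S hV => hA P V S hV⟩
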